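/- **Setting.** Let $(\mathsf X,\mathcal X)$ be a measurable space and $G_n:\mathsf X\to[0,\infty)$, $n\ge 0$, bounded measurable functions. For $s\in\{f,c\}$ let $\eta_0^s$ be a probability measure on $\mathsf X$ and $M_n^s$, $n\ge1$, Markov kernels on $\mathsf X$. Let $\check\eta_0$ be a coupling of $(\eta_0^f,\eta_0^c)$, and let $\check M_n$ be Markov kernels on $\mathsf X\times\mathsf X$ such that $\check M_n((x,x'),\cdot)$ is a coupling of $M_n^f(x,\cdot)$ and $M_n^c(x',\cdot)$. Put $Q_n^s(x,dy)=G_{n-1}(x)M_n^s(x,dy)$, $Q_{p,n}^s=Q_{p+1}^s\cdots Q_n^s$ ($Q_{n,n}^s=\mathrm{Id}$), $\gamma_n^s=\eta_0^sQ_{0,n}^s$, $\eta_n^s=\gamma_n^s/\gamma_n^s(1)$, $\overline\eta_n^s(\cdot)=\eta_n^s(G_n\,\cdot)/\eta_n^s(G_n)$, and $$D_{p,n}^s(\varphi)=\frac{Q_{p,n}^s(\varphi-\eta_n^s(\varphi))}{\eta_p^s(Q_{p,n}^s(1))},\quad h_{p,n}^s=\frac{Q_{p,n}^s(1)}{\eta_p^s(Q_{p,n}^s(1))},\quad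 S_{p,n}^{f,c}(\varphi)=\frac{Q_{p,n}^f(\varphi)}{Q_{p,n}^f(1)}-\frac{Q_{p,n}^c(\varphi)}{Q_{p,n}^c(1)}.$$ **Limiting pair laws** $\check\eta_n^s$, $s\in\{I,M,C,W\}$. - $I$ (IRCPF): $\check\eta_0^I=\check\eta_0$ and $\check\eta_n^I=\frac{\mu([G_{n-1}\otimes G_{n-1}]\check M_n)}{\mu(G_{n-1}\otimes G_{n-1})}$ with $\mu=\eta_{n-1}^f\otimes\eta_{n-1}^c$. - $M$ (MCRPF): $\check\eta_0^M=\check\eta_0$ and, with $\mu=\check\eta_{n-1}^M$, $F_f(x,y)=G_{n-1}(x)/\mu(G_{n-1}\otimes1)$, $F_c(x,y)=G_{n-1}(y)/\mu(1\otimes G_{n-1})$, $\overline F_\bullet=(F_\bullet-F_f\wedge F_c)/\mu(F_\bullet-F_f\wedge F_c)$, $$\check\eta_n^M=\mu(\{F_f\wedge F_c\}\check M_n)+(1-\mu(F_f\wedge F_c))\,(\mu\otimes\mu)(\{\overline F_f\otimes\overline F_c\}\bar M_n),\quad \bar M_n((x,y),(u,v))=\check M_n(x,v).$$ - $C$ (MCPF;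 assuming that $\eta_0^s$ and $M_n^s(x,\cdot)$ have jointly measurable densities with respect to a $\sigma$-finite measure $dx$): $\check\eta_n^C$ is the maximal coupling of $(\eta_n^f,\eta_n^c)$, that is, with densities $p,q$ of $\eta_n^f,\eta_n^c$, the image of $(p\wedge q)(u)du$ under $u\mapsto(u,u)$ plus $\frac{(p-p\wedge q)(x)\,(q-p\wedge q)(y)}{1-\int p\wedge q}\,dx\,dy$. - $W$ (WCPF; assuming $\mathsf X=\mathbb R$): $\check\eta_0^W=\check\eta_0$ and $\check\eta_n^W=\int_0^1\check M_n\big((F_{\overline\eta_{n-1}^f}^{-1}(w),F_{\overline\eta_{n-1}^c}^{-1}(w)),\cdot\big)dw$, with $F_\mu^{-1}$ the (generalised) inverse of the distribution function of $\mu$. (A term multiplied by a vanishing residual mass is read as $0$.) The asymptotic variance is $$\sigma_n^{2,s}(\varphi)=\sum_{p=0}^n\check\eta_p^s\big(\{D_{p,n}^f(\varphi)\otimes1-1\otimes D_{p,n}^c(\varphi)\}^2\big).$$ For $w:\mathsf X\to[1,\infty)$ write $\|\varphi\|_w=\sup_x|\varphi(x)|/w(x)$, $\|\varphi\|=\|\varphi\|_1$,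 and $\mathcal L_w$ for the functions with $\|\varphi\|_w<\infty$; let $\mathcal B_b(\mathsf X)$ be the bounded measurable functions; for a metric $\mathsf d$ let $\mathrm{Lip}_{w,\mathsf d}$ be the functions with $|\varphi(x)-\varphi(y)|\le L\,\mathsf d(x,y)w(x)w(y)$ for some $L<\infty$, and $\mathrm{Lip}_{\mathsf d}=\mathrm{Lip}_{1,\mathsf d}$. **Assumptions.** There are a measurable unbounded $\tilde V:\mathsf X\to[1,\infty)$, with $v=e^{\tilde V}$ and $C_d=\{\tilde V\le d\}$, constants $\delta\in(0,1)$, $\underline d\ge1$, and for each $d\ge\underline d$ a probability measure $\nu_d$ with $\nu_d(v)<\infty$, such that for both $s\in\{f,c\}$: - (H1) for every $d>\underline d$ there is $b_d<\infty$ with $\sup_{n\ge1}Q_n^s(v)(x)\le e^{(1-\delta)\tilde V(x)+b_d\mathbb I_{C_d}(x)}$ for all $x$; - (H2) $\eta_0^s(v)\le c$, and for every $r>1$, $\eta_0^s(C_r)^{-1}\le c_r<\infty$; - (H3) for every $d\ge\underline d$: $Q_n^s(x,C_d)>0$ for all $x$ and $n\ge1$, and there is $\tilde\epsilon_d^->0$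 with $Q_n^s(x,C_d\cap B)\ge\tilde\epsilon_d^-\nu_d(C_d\cap B)$ for all $n\geq 1$, $x\in C_d$, $B\in\mathcal X$; - (H4) for every $d\ge\underline d$ there is $\tilde\epsilon_d^+\in[\tilde\epsilon_d^-,\infty)$ with $Q_n^s(x,C_d\cap B)\le\tilde\epsilon_d^+\nu_d(C_d\cap B)$ for all $n\geq 1$, $x\in C_d$, $B\in\mathcal X$; - (H5) $\sup_n\|G_n\|<\infty$, and for every $r>1$, $\inf_{C_r}G_0\ge g_r>0$; - (H6) for every $d\ge\underline d$, $\sup_{n\ge1}\|1/Q_n^s(\mathbb I_{C_d})\|_v<\infty$. For a metric $\mathsf d$ on $\mathsf X$ that is measurable on $\mathsf X\times\mathsf X$: - (H7) for every $\xi\in(0,1]$ there is $c_\xi<\infty$ such that for all measurable $\varphi\in\mathcal L_{v^\xi}\cap\mathrm{Lip}_{v^\xi,\mathsf d}$, $x,y\in\mathsf X$, $s\in\{f,c\}$: $\sup_{n\ge1}|Q_n^s(\varphi)(x)-Q_n^s(\varphi)(y)|\le c_\xi\|\varphi\|_{v^\xi}\mathsf d(x,y)[v(x)v(y)]^\xi$.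 Put $$B(n,f,c,\varphi,\xi)=\|\varphi\|\sum_{p=0}^{n-1}\rho^{n-p}\Big\{\|h_{p,n}^fS_{p,n}^{f,c}(\varphi)\|_{v^\xi}+|[\eta_n^f-\eta_n^c](\varphi)|+\|\varphi\|\,\|h_{p,n}^f-h_{p,n}^c\|_{v^\xi}\rho^{n-p}\Big\}.$$ **Theorem.** (1) Assume (H1)–(H6) and that $A=\{(x,y):x\ne y\}$ is measurable. For every $\xi\in(0,1/4)$ there are $\rho\in(0,1)$ and $C<\infty$, depending only on $\xi$ and the numerical constants in (H1)–(H6), such that for all $\varphi\in\mathcal B_b(\mathsf X)$, $n\ge1$ and $s\in\{I,M,C,W\}$ $$\sigma_n^{2,s}(\varphi)\le\check\eta_n^s\Big(\{\varphi\otimes1-1\otimes\varphi-[\eta_n^f-\eta_n^c](\varphi)\}^2\Big)+C\Big\{B(n,f,c,\varphi,\xi)+\|\varphi\|^2\sum_{p=0}^{n-1}\rho^{n-p}\,\check\eta_p^s\big(\mathbb I_A(v\otimes v)^{2\xi}\big)(\rho^{n-p}+1)\Big\}.$$ (2) Assume (H1)–(H7) and $\mathsf d^2\in\mathcal L_{(v\otimes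 v)^{\tilde\xi}}$ for some $\tilde\xi\in(0,1/2)$. For every $\xi\in(0,(1-2\tilde\xi)/12)$ there are $\rho\in(0,1)$ and $C<\infty$, depending only on $\xi,\tilde\xi$ and the numerical constants in (H1)–(H7), such that for all $\varphi\in\mathcal B_b(\mathsf X)\cap\mathrm{Lip}_{\mathsf d}(\mathsf X)$, $n\ge1$ and $s\in\{I,M,C,W\}$ $$\sigma_n^{2,s}(\varphi)\le\check\eta_n^s\Big(\{\varphi\otimes1-1\otimes\varphi-[\eta_n^f-\eta_n^c](\varphi)\}^2\Big)+C\Big\{B(n,f,c,\varphi,\xi)+\|\varphi\|^2\sum_{p=0}^{n-1}\rho^{n-p}\,\check\eta_p^s\big(\mathsf d^2(v^{4\xi}\otimes v^{8\xi})\big)(\rho^{n-p}+1)\Big\}.$$ -/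

import Mathlib

open MeasureTheory ProbabilityTheory
open scoped NNReal ENNReal

universe u

namespace CPF

/-- The two levels of the pair of filters: fine and coarse. -/
inductive Level
  | f
  | c

/-- A pair of Feynman-Kac models on `X` with common potentials, together with a coupling of the
initial laws and of the transition kernels. Time is shifted by one for kernels: `M s n` and `cM n`
are the transitions from time `n` to time `n + 1`. -/
structure CoupledModel (X : Type u) [MeasurableSpace X] where
  /-- potentials -/
  G : ℕ → X → ℝ≥0
  measurable_G : ∀ n, Measurable (G n)
  bounded_G : ∀ n, ∃ K : ℝ≥0, ∀ x, G n x ≤ K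
  /-- initial laws -/
  init : Level → Measure X
  prob_init : ∀ s, IsProbabilityMeasure (init s)
  /-- Markov transitions -/
  M : Level → ℕ → Kernel X X
  markov_M : ∀ s n, IsMarkovKernel (M s n)
  /-- coupling of the initial laws -/
  cinit : Measure (X × X)
  prob_cinit : IsProbabilityMeasure cinit
  cinit_fst : cinit.map Prod.fst = init .f
  cinit_snd : cinit.map Prod.snd = init .c
  /-- coupling of the transitions -/
  cM : ℕ → Kernel (X × X) (X × X)
  markov_cM : ∀ n, IsMarkovKernel (cM n)
  cM_fst : ∀ n z, (cM n z).map Prod.fst = M .f n z.1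
  cM_snd : ∀ n z, (cM n z).map Prod.snd = M .c n z.2

attribute [instance] CoupledModel.prob_init CoupledModel.markov_M CoupledModel.prob_cinit
  CoupledModel.markov_cM

/-- The supremum norm of `φ / w`. -/
noncomputable def wnorm {X : Type u} (w φ : X → ℝ) : ℝ := ⨆ x, |φ x| / w x

/-- The supremum norm. -/
noncomputable def supNorm {X : Type u} (φ : X → ℝ) : ℝ := wnorm (fun _ => 1) φ

namespace CoupledModel

variable {X : Type u} [MeasurableSpace X] (m : CoupledModel X)

/-- One-step kernel `Q(x, dy) = G_n(x) M(x, dy)` from time `n` to time `n + 1`. -/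
noncomputable def Q (s : Level) (n : ℕ) : Kernel X X :=
  Kernel.withDensity (m.M s n) (fun x _ => (m.G n x : ℝ≥0∞))

/-- Product of the `k` one-step kernels from time `p` to time `p + k`. -/
noncomputable def Qiter (s : Level) (p : ℕ) : ℕ → Kernel X X
  | 0 => Kernel.id
  | k + 1 => (m.Q s (p + k)).comp (Qiter s p k)

/-- The semigroup `Q_{p,n}`, for `p ≤ n`. -/
noncomputable def Qpn (s : Level) (p n : ℕ) : Kernel X X := m.Qiter s p (n - p)

/-- Unnormalised predictor. -/
noncomputable def gamma (s : Level) (n : ℕ) : Measure X := (m.init s).bind (m.Qpn s 0 n)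

/-- Predictor. -/
noncomputable def eta (s : Level) (n : ℕ) : Measure X :=
  (m.gamma s n Set.univ)⁻¹ • m.gamma s n

/-- The function `Q_{p,n}(φ)`. -/
noncomputable def Qop (s : Level) (p n : ℕ) (φ : X → ℝ) (x : X) : ℝ := ∫ y, φ y ∂(m.Qpn s p n x)

/-- The normaliser `η_p(Q_{p,n}(1))`. -/
noncomputable def mass (s : Level) (p n : ℕ) : ℝ := ∫ x, m.Qop s p n (fun _ => 1) x ∂(m.eta s p)

/-- `D_{p,n}(φ) = Q_{p,n}(φ - η_n(φ)) / η_p(Q_{p,n}(1))`. -/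
noncomputable def D (s : Level) (p n : ℕ) (φ : X → ℝ) (x : X) : ℝ :=
  m.Qop s p n (fun y => φ y - ∫ z, φ z ∂(m.eta s n)) x / m.mass s p n

/-- `h_{p,n} = Q_{p,n}(1) / η_p(Q_{p,n}(1))`. -/
noncomputable def h (s : Level) (p n : ℕ) (x : X) : ℝ :=
  m.Qop s p n (fun _ => 1) x / m.mass s p n

/-- Difference of the two normalised semigroups. -/
noncomputable def S (p n : ℕ) (φ : X → ℝ) (x : X) : ℝ :=
  m.Qop .f p n φ x / m.Qop .f p n (fun _ => 1) x
    - m.Qop .c p n φ x / m.Qop .c p n (fun _ => 1) x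

/-- `[η_n^f - η_n^c](φ)`. -/
noncomputable def etaDiff (n : ℕ) (φ : X → ℝ) : ℝ :=
  (∫ x, φ x ∂(m.eta .f n)) - ∫ x, φ x ∂(m.eta .c n)

/-- Asymptotic variance of the particle filter whose limiting pair law at time `p` is `κ p`. -/
noncomputable def asympVar (κ : ℕ → Measure (X × X)) (n : ℕ) (φ : X → ℝ) : ℝ :=
  ∑ p ∈ Finset.range (n + 1), ∫ z, (m.D .f p n φ z.1 - m.D .c p n φ z.2) ^ 2 ∂(κ p)

/-! ### The limiting pair laws of the four coupled particle filters -/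

/-- Independent pair resampling, followed by the coupled transition. -/
noncomputable def PhiI (n : ℕ) (μ : Measure (X × X)) : Measure (X × X) :=
  (∫⁻ z, (m.G n z.1 : ℝ≥0∞) * m.G n z.2 ∂μ)⁻¹ •
    (μ.withDensity (fun z => (m.G n z.1 : ℝ≥0∞) * m.G n z.2)).bind (m.cM n)

/-- Limiting pair law of the IRCPF. The pairs at different times are independent in its defining
joint law, so that the marginal at time `n + 1` is `PhiI` of the product of predictors. -/
noncomputable def couplingI : ℕ → Measure (X × X)
  | 0 => m.cinit
  | n + 1 => m.PhiI n ((m.eta .f n).prod (m.eta .c n))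

/-- Normalised potential of the first coordinate. -/
noncomputable def Ff (n : ℕ) (μ : Measure (X × X)) (z : X × X) : ℝ≥0∞ :=
  (m.G n z.1 : ℝ≥0∞) / ∫⁻ w, (m.G n w.1 : ℝ≥0∞) ∂μ

/-- Normalised potential of the second coordinate. -/
noncomputable def Fc (n : ℕ) (μ : Measure (X × X)) (z : X × X) : ℝ≥0∞ :=
  (m.G n z.2 : ℝ≥0∞) / ∫⁻ w, (m.G n w.2 : ℝ≥0∞) ∂μ

/-- Pointwise minimum of the two normalised potentials. -/
noncomputable def Fmin (n : ℕ) (μ : Measure (X × X)) (z : X × X) : ℝ≥0∞ :=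
  min (m.Ff n μ z) (m.Fc n μ z)

/-- Normalised residual of the first potential. -/
noncomputable def FfBar (n : ℕ) (μ : Measure (X × X)) (z : X × X) : ℝ≥0∞ :=
  (m.Ff n μ z - m.Fmin n μ z) / ∫⁻ w, (m.Ff n μ w - m.Fmin n μ w) ∂μ

/-- Normalised residual of the second potential. -/
noncomputable def FcBar (n : ℕ) (μ : Measure (X × X)) (z : X × X) : ℝ≥0∞ :=
  (m.Fc n μ z - m.Fmin n μ z) / ∫⁻ w, (m.Fc n μ w - m.Fmin n μ w) ∂μ

/-- Maximally coupled resampling, followed by the coupled transition. In the second term two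
independent pairs `(x, y)`, `(u, v)` are drawn and the transition starts from `(x, v)`; when the
total mass of `Fmin` is `1` that term vanishes. -/
noncomputable def PhiM (n : ℕ) (μ : Measure (X × X)) : Measure (X × X) :=
  (μ.withDensity (m.Fmin n μ)).bind (m.cM n) +
    (1 - ∫⁻ z, m.Fmin n μ z ∂μ) •
      ((μ.prod μ).withDensity (fun w => m.FfBar n μ w.1 * m.FcBar n μ w.2)).bind
        (fun w => m.cM n (w.1.1, w.2.2))

/-- Limiting pair law of the MCRPF. -/
noncomputable def couplingM : ℕ → Measure (X × X)
  | 0 => m.cinit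
  | n + 1 => m.PhiM n (couplingM n)

/-- Densities of the initial laws and transitions with respect to a `σ`-finite measure. -/
structure Densities where
  ref : Measure X
  sigmaFinite_ref : SigmaFinite ref
  dinit : Level → X → ℝ≥0∞
  measurable_dinit : ∀ s, Measurable (dinit s)
  init_eq : ∀ s, m.init s = ref.withDensity (dinit s)
  dM : Level → ℕ → X → X → ℝ≥0∞
  measurable_dM : ∀ s n, Measurable (Function.uncurry (dM s n))
  M_eq : ∀ s n x, m.M s n x = ref.withDensity (dM s n x)

/-- The maximal coupling of the probability measures with densities `p` and `q` with respect to
`ref`. When they coincide the second term vanishes. -/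
noncomputable def maxCoupling (ref : Measure X) (p q : X → ℝ≥0∞) : Measure (X × X) :=
  (ref.withDensity (fun u => min (p u) (q u))).map (fun u => (u, u)) +
    (1 - ∫⁻ u, min (p u) (q u) ∂ref)⁻¹ •
      (ref.prod ref).withDensity
        (fun z => (p z.1 - min (p z.1) (q z.1)) * (q z.2 - min (p z.2) (q z.2)))

/-- Density at `x` of the probability measure `μ(G_n M(·)) / μ(G_n)`. -/
noncomputable def predDensity (d : m.Densities) (s : Level) (n : ℕ) (μ : Measure X) (x : X) :
    ℝ≥0∞ :=
  (∫⁻ u, (m.G n u : ℝ≥0∞) * d.dM s n u x ∂μ) / ∫⁻ u, (m.G n u : ℝ≥0∞) ∂μ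

/-- The maximal coupling of the one-step predictions of `μ` and `ν`. -/
noncomputable def PhiC (d : m.Densities) (n : ℕ) (μ ν : Measure X) : Measure (X × X) :=
  maxCoupling d.ref (m.predDensity d .f n μ) (m.predDensity d .c n ν)

/-- Limiting pair law of the MCPF: the maximal coupling of the two predictors. -/
noncomputable def couplingC (d : m.Densities) : ℕ → Measure (X × X)
  | 0 => maxCoupling d.ref (d.dinit .f) (d.dinit .c)
  | n + 1 => m.PhiC d n (m.eta .f n) (m.eta .c n)

/-- The filter: the predictor reweighted by the potential. -/
noncomputable def etaBar (s : Level) (n : ℕ) : Measure X :=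
  (∫⁻ x, (m.G n x : ℝ≥0∞) ∂(m.eta s n))⁻¹ • (m.eta s n).withDensity (fun x => (m.G n x : ℝ≥0∞))

end CoupledModel

/-- Inverse of the distribution function of a probability measure on `ℝ`, used on `(0, 1)`. -/
noncomputable def quantile (μ : Measure ℝ) (w : ℝ) : ℝ := sInf {x : ℝ | w ≤ cdf μ x}

namespace CoupledModel

/-- Resampling both coordinates with one uniform variable, followed by the coupled transition. -/
noncomputable def PhiW (m : CoupledModel ℝ) (n : ℕ) (μ ν : Measure ℝ) : Measure (ℝ × ℝ) :=
  (((volume : Measure ℝ).restrict (Set.Ioo 0 1)).map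
    (fun w => (quantile μ w, quantile ν w))).bind (m.cM n)

/-- Limiting pair law of the WCPF. -/
noncomputable def couplingW (m : CoupledModel ℝ) : ℕ → Measure (ℝ × ℝ)
  | 0 => m.cinit
  | n + 1 => m.PhiW n (m.etaBar .f n) (m.etaBar .c n)

end CoupledModel

/-! ### The assumptions -/

/-- The numerical constants in the assumptions `H1` to `H6`. Functions of `d` are used for
`dmin ≤ d`, functions of `r` for `1 < r`. -/
structure HConstants where
  δ : ℝ
  δ_pos : 0 < δ
  δ_lt_one : δ < 1
  dmin : ℝ
  one_le_dmin : 1 ≤ dmin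
  b : ℝ → ℝ
  initV : ℝ
  initC : ℝ → ℝ
  epsLo : ℝ → ℝ
  epsLo_pos : ∀ d, dmin ≤ d → 0 < epsLo d
  epsHi : ℝ → ℝ
  epsLo_le_epsHi : ∀ d, dmin ≤ d → epsLo d ≤ epsHi d
  supG : ℝ≥0
  infG : ℝ → ℝ≥0
  infG_pos : ∀ r, 1 < r → 0 < infG r
  invQ : ℝ → ℝ

section Assumptions

variable {X : Type u} [MeasurableSpace X] (m : CoupledModel X) (V : X → ℝ) (K : HConstants)

/-- Sublevel sets of the Lyapunov function. -/
def Csub {X : Type u} (V : X → ℝ) (d : ℝ) : Set X := {x | V x ≤ d}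

/-- Multiplicative drift. -/
def H1 : Prop :=
  Measurable V ∧ (∀ x, 1 ≤ V x) ∧ (∀ a : ℝ, ∃ x, a < V x) ∧
    ∀ d, K.dmin < d → ∀ (s : Level) (n : ℕ) (x : X),
      ∫⁻ y, ENNReal.ofReal (Real.exp (V y)) ∂(m.Q s n x) ≤
        ENNReal.ofReal (Real.exp ((1 - K.δ) * V x + (Csub V d).indicator (fun _ => K.b d) x))

/-- Initial laws. -/
def H2 : Prop :=
  (∀ s : Level, ∫⁻ x, ENNReal.ofReal (Real.exp (V x)) ∂(m.init s) ≤ ENNReal.ofReal K.initV) ∧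
    ∀ r, 1 < r → ∀ s : Level, (m.init s (Csub V r))⁻¹ ≤ ENNReal.ofReal (K.initC r)

/-- Local minorization, by the measures `ν d`. -/
def H3 (ν : ℝ → Measure X) : Prop :=
  ∀ d, K.dmin ≤ d →
    (∀ (s : Level) (n : ℕ) (x : X), 0 < m.Q s n x (Csub V d)) ∧
    IsProbabilityMeasure (ν d) ∧ (∫⁻ x, ENNReal.ofReal (Real.exp (V x)) ∂(ν d) < ⊤) ∧
    ∀ B : Set X, MeasurableSet B → ∀ (s : Level) (n : ℕ), ∀ x ∈ Csub V d,
      ENNReal.ofReal (K.epsLo d) * ν d (Csub V d ∩ B) ≤ m.Q s n x (Csub V d ∩ B)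

/-- Local majorization, by the same measures `ν d`. -/
def H4 (ν : ℝ → Measure X) : Prop :=
  ∀ d, K.dmin ≤ d → ∀ B : Set X, MeasurableSet B → ∀ (s : Level) (n : ℕ), ∀ x ∈ Csub V d,
    m.Q s n x (Csub V d ∩ B) ≤ ENNReal.ofReal (K.epsHi d) * ν d (Csub V d ∩ B)

/-- Bounds on the potentials. -/
def H5 : Prop :=
  (∀ n x, m.G n x ≤ K.supG) ∧ ∀ r, 1 < r → ∀ x ∈ Csub V r, K.infG r ≤ m.G 0 x

/-- `1 / Q(C_d)` is bounded by a multiple of `v = exp V`. -/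
def H6 : Prop :=
  ∀ d, K.dmin ≤ d → ∀ (s : Level) (n : ℕ) (x : X),
    (m.Q s n x (Csub V d))⁻¹ ≤ ENNReal.ofReal (K.invQ d * Real.exp (V x))

/-- The assumptions `H1` to `H6` together, with constants `K`. -/
def H1to6 : Prop :=
  H1 m V K ∧ H2 m V K ∧ (∃ ν : ℝ → Measure X, H3 m V K ν ∧ H4 m V K ν) ∧ H5 m V K ∧ H6 m V K

/-- `d` is a metric. -/
structure IsMetric {X : Type u} (d : X → X → ℝ) : Prop where
  eq_zero_iff : ∀ x y, d x y = 0 ↔ x = y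
  symm : ∀ x y, d x y = d y x
  triangle : ∀ x y z, d x z ≤ d x y + d y z

/-- The weighted Lipschitz class; the Lipschitz constant is arbitrary. -/
def IsLip {X : Type u} (w : X → ℝ) (d : X → X → ℝ) (φ : X → ℝ) : Prop :=
  ∃ L : ℝ, ∀ x y, |φ x - φ y| ≤ L * d x y * w x * w y

/-- `φ` is bounded by a multiple of `w`. -/
def InL {Y : Type u} (w φ : Y → ℝ) : Prop := ∃ L : ℝ, ∀ x, |φ x| ≤ L * w x

/-- The Lyapunov function `v = exp V` to the power `ξ`. -/
noncomputable def vpow {X : Type u} (V : X → ℝ) (ξ : ℝ) (x : X) : ℝ := Real.exp (V x) ^ ξ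

/-- Lipschitz regularisation by one step, with constants `K7 ξ`. -/
def H7 (d : X → X → ℝ) (K7 : ℝ → ℝ) : Prop :=
  ∀ ξ, 0 < ξ → ξ ≤ 1 → ∀ φ : X → ℝ, Measurable φ → InL (vpow V ξ) φ → IsLip (vpow V ξ) d φ →
    ∀ (x y : X) (s : Level) (n : ℕ),
      |(∫ z, φ z ∂(m.Q s n x)) - ∫ z, φ z ∂(m.Q s n y)| ≤
        K7 ξ * wnorm (vpow V ξ) φ * d x y * (Real.exp (V x) * Real.exp (V y)) ^ ξ

/-! ### The terms of the bound -/

/-- The squared centred difference under the pair law at time `n`. -/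
noncomputable def leadTerm (κ : ℕ → Measure (X × X)) (n : ℕ) (φ : X → ℝ) : ℝ :=
  ∫ z, (φ z.1 - φ z.2 - m.etaDiff n φ) ^ 2 ∂(κ n)

/-- The term `B(n, f, c, φ, ξ)`, with rate `ρ`. -/
noncomputable def Bterm (ρ : ℝ) (n : ℕ) (φ : X → ℝ) (ξ : ℝ) : ℝ :=
  supNorm φ * ∑ p ∈ Finset.range n, ρ ^ (n - p) *
    (wnorm (vpow V ξ) (fun x => m.h .f p n x * m.S p n φ x) + |m.etaDiff n φ|
      + supNorm φ * wnorm (vpow V ξ) (fun x => m.h .f p n x - m.h .c p n x) * ρ ^ (n - p))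

/-- Geometrically weighted sum of the integrals of `g` under the pair laws. -/
noncomputable def geomTerm (κ : ℕ → Measure (X × X)) (ρ : ℝ) (n : ℕ) (φ : X → ℝ)
    (g : X × X → ℝ) : ℝ :=
  supNorm φ ^ 2 * ∑ p ∈ Finset.range n, ρ ^ (n - p) * ((∫ z, g z ∂(κ p)) * (ρ ^ (n - p) + 1))

/-- The indicator of `{x ≠ y}` times `(v ⊗ v)^{2ξ}`. -/
noncomputable def offDiagWeight {X : Type u} (V : X → ℝ) (ξ : ℝ) : X × X → ℝ :=
  {z : X × X | z.1 ≠ z.2}.indicator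
    (fun z => (Real.exp (V z.1) * Real.exp (V z.2)) ^ (2 * ξ))

/-- `d² (v^{4ξ} ⊗ v^{8ξ})`. -/
noncomputable def metricWeight {X : Type u} (V : X → ℝ) (d : X → X → ℝ) (ξ : ℝ) (z : X × X) : ℝ :=
  d z.1 z.2 ^ 2 * (vpow V (4 * ξ) z.1 * vpow V (8 * ξ) z.2)

/-- The asymptotic variance bound for limiting pair laws `κ`, with weight `g` in the last term. -/
def VarBound (κ : ℕ → Measure (X × X)) (ρ C ξ : ℝ) (g : X × X → ℝ) (n : ℕ) (φ : X → ℝ) : Prop :=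
  m.asympVar κ n φ ≤
    leadTerm m κ n φ + C * (Bterm m V ρ n φ ξ + geomTerm κ ρ n φ g)

/-- The bound for the IRCPF, the MCRPF and, whenever densities are given, the MCPF. -/
def VarBoundIMC (ρ C ξ : ℝ) (g : X × X → ℝ) (n : ℕ) (φ : X → ℝ) : Prop :=
  VarBound m V m.couplingI ρ C ξ g n φ ∧ VarBound m V m.couplingM ρ C ξ g n φ ∧
    ∀ D : m.Densities, VarBound m V (m.couplingC D) ρ C ξ g n φ

end Assumptions

/-- Bounded measurable functions. -/
def IsBdd {X : Type u} [MeasurableSpace X] (φ : X → ℝ) : Prop :=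
  Measurable φ ∧ ∃ L : ℝ, ∀ x, |φ x| ≤ L

end CPF

/-!
The `p`-th term of the asymptotic variance compares the centred semigroups `D` of the two levels at
the two points of a pair, and the term at `p = n` is exactly the leading term of the bound. For
`p < n` the comparison is split at the second point of the pair: an increment of the fine centred
semigroup between the two points, and the difference of the two centred semigroups at one point.

Both parts rest on the stability of the normalised semigroup `Q_{p,n}(φ) / Q_{p,n}(1)`, proved here
with constants that depend only on those in the assumptions. The multiplicative drift is so strong
that its factor outside a large sublevel set is below the rate at which mass is lost by staying in a
fixed sublevel set. Hence the total mass of `Q_{p,n}(x, ·)` is at most a multiple of `exp (ξ V x)`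
times its infimum over that fixed set (`exists_U_le_low`), and the predictors integrate `exp V`
uniformly in time (`exists_gamma_vE_le`). This bounds `h_{p,n}` from both sides
(`exists_h_le`, `exists_one_le_h`). The kernels twisted by the remaining mass are then Markov, have
`exp V / h` as Lyapunov function and a common minorant on sublevel sets, and Harris' argument gives
a geometric contraction (`exists_contraction`). Interpolating with the trivial bound by the supremum
norm lowers the power of `exp V` to any `ξ > 0`
(`exists_abs_normQ_sub_le`, `exists_abs_D_le`).

In the square of the difference of the centred semigroups at one point, one factor is bounded by this
decay and the other is split by the identity `D_sub_D` into the three terms of `Bterm`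
(`exists_sq_D_sub_D_le`). The result carries the weight `exp (3 ξ V) ≤ exp V`, integrable since each
limiting pair law is a coupling of the two predictors (`isPairLaw_couplingI`, `isPairLaw_couplingM`,
`isPairLaw_couplingC`, `isPairLaw_couplingW`). Nothing else about the pair laws is used. The increment
of the fine centred semigroup vanishes on the diagonal and otherwise is bounded by the decay at both
points; under the Lipschitz assumption, one step of regularisation applied to the decayed semigroup
bounds it by the metric.
-/

namespace CPF

/-! ### Algebra of the Feynman-Kac semigroup -/

namespace CoupledModel

variable {X : Type u} [MeasurableSpace X] (m : CoupledModel X)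

instance (s : Level) (n : ℕ) : IsSFiniteKernel (m.Q s n) := by
  unfold Q; infer_instance

lemma Q_apply (s : Level) (n : ℕ) (x : X) : m.Q s n x = (m.G n x : ℝ≥0∞) • m.M s n x := by
  have h : Measurable (Function.uncurry fun (x : X) (_ : X) => (m.G n x : ℝ≥0∞)) := by
    have := m.measurable_G n
    exact (this.comp measurable_fst).coe_nnreal_ennreal
  rw [Q, Kernel.withDensity_apply _ h, withDensity_const]

lemma Q_univ (s : Level) (n : ℕ) (x : X) : m.Q s n x Set.univ = m.G n x := by
  simp [Q_apply]

instance (s : Level) (n : ℕ) : IsFiniteKernel (m.Q s n) := by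
  obtain ⟨K, hK⟩ := m.bounded_G n
  exact ⟨⟨K, ENNReal.coe_lt_top, fun x => by rw [Q_univ]; exact_mod_cast hK x⟩⟩

instance (s : Level) (p k : ℕ) : IsFiniteKernel (m.Qiter s p k) := by
  induction k with
  | zero => unfold Qiter; infer_instance
  | succ k ih => unfold Qiter; infer_instance

instance (s : Level) (p n : ℕ) : IsFiniteKernel (m.Qpn s p n) := by
  unfold Qpn; infer_instance

/-- Splitting off the first step rather than the last. -/
lemma Qiter_succ' (s : Level) (p k : ℕ) :
    m.Qiter s p (k + 1) = (m.Qiter s (p + 1) k).comp (m.Q s p) := by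
  induction k generalizing p with
  | zero => simp [Qiter]
  | succ k ih =>
    rw [Qiter, ih, ← Kernel.comp_assoc]
    conv_rhs => rw [Qiter]
    rw [show p + 1 + k = p + (k + 1) by ring]

/-- Total mass of `Q_{p,p+k}(x, ·)`. -/
noncomputable def U (s : Level) (p k : ℕ) (x : X) : ℝ≥0∞ := m.Qiter s p k x Set.univ

lemma measurable_U (s : Level) (p k : ℕ) : Measurable (m.U s p k) :=
  Kernel.measurable_coe _ MeasurableSet.univ

lemma U_zero (s : Level) (p : ℕ) (x : X) : m.U s p 0 x = 1 := by
  simp [U, Qiter]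

lemma U_succ (s : Level) (p k : ℕ) (x : X) :
    m.U s p (k + 1) x = ∫⁻ y, m.U s (p + 1) k y ∂(m.Q s p x) := by
  rw [U, Qiter_succ', Kernel.comp_apply' _ _ _ MeasurableSet.univ]
  rfl

lemma U_lt_top (s : Level) (p k : ℕ) (x : X) : m.U s p k x < ⊤ := measure_lt_top _ _

lemma gamma_zero (s : Level) : m.gamma s 0 = m.init s := by
  simp [gamma, Qpn, Qiter]

lemma gamma_add (s : Level) (p k : ℕ) :
    m.gamma s (p + k) = (m.gamma s p).bind (m.Qiter s p k) := by
  induction k with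
  | zero => simp [Qiter]
  | succ k ih =>
    have h : m.gamma s (p + (k + 1)) = (m.gamma s (p + k)).bind (m.Q s (p + k)) := by
      rw [gamma, gamma, Measure.comp_assoc]
      simp [Qpn, ← add_assoc, Qiter]
    rw [h, ih, Measure.comp_assoc, Qiter]

lemma gamma_succ (s : Level) (p : ℕ) :
    m.gamma s (p + 1) = (m.gamma s p).bind (m.Q s p) := by
  rw [gamma_add]; simp [Qiter]

lemma lintegral_gamma_succ (s : Level) (p : ℕ) {φ : X → ℝ≥0∞} (hφ : Measurable φ) :
    ∫⁻ x, φ x ∂(m.gamma s (p + 1)) = ∫⁻ x, ∫⁻ y, φ y ∂(m.Q s p x) ∂(m.gamma s p) := by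
  rw [gamma_succ, Measure.lintegral_bind (Kernel.aemeasurable _) hφ.aemeasurable]

instance (s : Level) (n : ℕ) : IsFiniteMeasure (m.gamma s n) := by
  unfold gamma; infer_instance

lemma lintegral_U_gamma (s : Level) (p k : ℕ) :
    ∫⁻ x, m.U s p k x ∂(m.gamma s p) = m.gamma s (p + k) Set.univ := by
  rw [gamma_add, Measure.bind_apply MeasurableSet.univ (Kernel.aemeasurable _)]
  rfl

end CoupledModel

/-! ### One-step consequences of the assumptions -/

/-- The exponential `exp (ξ V)`, as an extended nonnegative function. -/
noncomputable def vE {X : Type u} (V : X → ℝ) (ξ : ℝ) (x : X) : ℝ≥0∞ :=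
  ENNReal.ofReal (Real.exp (ξ * V x))

namespace HConstants

/-- A level strictly above `dmin`, at which the drift condition and the lower bounds are used. -/
noncomputable def d0 (K : HConstants) : ℝ := K.dmin + 1

/-- One step multiplies `exp (ξ V)` by at most this constant. -/
noncomputable def drift (K : HConstants) : ℝ≥0 :=
  K.supG + (Real.exp (max (K.b K.d0) 0)).toNNReal

/-- The mass that one step from `x` sends into the sublevel set at `d0` is at least
`(keep * exp (V x))⁻¹`. -/
noncomputable def keep (K : HConstants) : ℝ≥0 :=
  1 + (K.invQ K.d0).toNNReal * (Real.exp K.d0).toNNReal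

/-- Ratio of the two constants in the local two-sided bounds. -/
noncomputable def ratio (K : HConstants) (d : ℝ) : ℝ≥0 := (K.epsHi d / K.epsLo d).toNNReal

lemma one_lt_d0 (K : HConstants) : 1 < K.d0 := by
  have := K.one_le_dmin; unfold d0; linarith

lemma dmin_lt_d0 (K : HConstants) : K.dmin < K.d0 := by unfold d0; linarith

lemma one_le_keep (K : HConstants) : 1 ≤ K.keep := le_self_add

end HConstants

section OneStep

variable {X : Type u} [MeasurableSpace X] {m : CoupledModel X} {V : X → ℝ} {K : HConstants}

lemma H1to6.measurable_V (H : H1to6 m V K) : Measurable V := H.1.1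

lemma H1to6.one_le_V (H : H1to6 m V K) (x : X) : 1 ≤ V x := H.1.2.1 x

lemma H1to6.measurableSet_Csub (H : H1to6 m V K) (d : ℝ) : MeasurableSet (Csub V d) :=
  H.measurable_V measurableSet_Iic

lemma H1to6.measurable_vE (H : H1to6 m V K) (ξ : ℝ) : Measurable (vE V ξ) :=
  ((H.measurable_V.const_mul ξ).exp).ennreal_ofReal

lemma H1to6.one_le_vE (H : H1to6 m V K) {ξ : ℝ} (hξ : 0 ≤ ξ) (x : X) : 1 ≤ vE V ξ x := by
  rw [vE, ENNReal.one_le_ofReal]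
  exact Real.one_le_exp (mul_nonneg hξ (by linarith [H.one_le_V x]))

/-- The drift condition for all powers of `exp V`. It is Jensen's inequality up to a constant,
here from a pointwise comparison of `exp (ξ V y)` with `exp (V y)`. -/
lemma H1to6.drift (H : H1to6 m V K) {ξ : ℝ} (h0 : 0 ≤ ξ) (h1 : ξ ≤ 1) (s : Level) (n : ℕ)
    (x : X) :
    ∫⁻ y, vE V ξ y ∂(m.Q s n x) ≤ K.drift * vE V (ξ * (1 - K.δ)) x := by
  set t := (1 - K.δ) * V x with ht
  have hpt : ∀ y, vE V ξ y ≤ ENNReal.ofReal (Real.exp (ξ * t))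
      + ENNReal.ofReal (Real.exp ((ξ - 1) * t)) * ENNReal.ofReal (Real.exp (V y)) := by
    intro y
    rw [vE, ← ENNReal.ofReal_mul (Real.exp_nonneg _), ← Real.exp_add]
    rcases le_total (V y) t with h | h
    · refine le_add_right (ENNReal.ofReal_le_ofReal (Real.exp_le_exp.2 ?_))
      exact mul_le_mul_of_nonneg_left h h0
    · refine le_add_left (ENNReal.ofReal_le_ofReal (Real.exp_le_exp.2 ?_))
      nlinarith
  have hV : Measurable fun y => ENNReal.ofReal (Real.exp (V y)) :=
    H.measurable_V.exp.ennreal_ofReal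
  have hD := H.1.2.2.2 K.d0 K.dmin_lt_d0 s n x
  have hG : (m.G n x : ℝ≥0∞) ≤ K.supG := by exact_mod_cast H.2.2.2.1.1 n x
  have hD' : ∫⁻ y, ENNReal.ofReal (Real.exp (V y)) ∂(m.Q s n x)
      ≤ ENNReal.ofReal (Real.exp (max (K.b K.d0) 0)) * ENNReal.ofReal (Real.exp t) := by
    refine hD.trans ?_
    rw [← ENNReal.ofReal_mul (Real.exp_nonneg _), ← Real.exp_add]
    refine ENNReal.ofReal_le_ofReal (Real.exp_le_exp.2 ?_)
    rw [add_comm]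
    refine add_le_add ?_ le_rfl
    by_cases hx : x ∈ Csub V K.d0 <;> simp [hx]
  calc ∫⁻ y, vE V ξ y ∂(m.Q s n x)
      ≤ ∫⁻ y, (ENNReal.ofReal (Real.exp (ξ * t))
        + ENNReal.ofReal (Real.exp ((ξ - 1) * t)) * ENNReal.ofReal (Real.exp (V y)))
          ∂(m.Q s n x) := lintegral_mono hpt
    _ = ENNReal.ofReal (Real.exp (ξ * t)) * m.G n x + ENNReal.ofReal (Real.exp ((ξ - 1) * t)) *
          ∫⁻ y, ENNReal.ofReal (Real.exp (V y)) ∂(m.Q s n x) := by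
        rw [lintegral_add_left measurable_const, lintegral_const, m.Q_univ,
          lintegral_const_mul _ hV]
    _ ≤ ENNReal.ofReal (Real.exp (ξ * t)) * K.supG + ENNReal.ofReal (Real.exp ((ξ - 1) * t)) *
          (ENNReal.ofReal (Real.exp (max (K.b K.d0) 0)) * ENNReal.ofReal (Real.exp t)) := by
        gcongr
    _ = K.drift * vE V (ξ * (1 - K.δ)) x := by
        have e : ENNReal.ofReal (Real.exp (ξ * t)) = ENNReal.ofReal (Real.exp ((ξ - 1) * t))
            * ENNReal.ofReal (Real.exp t) := by
          rw [← ENNReal.ofReal_mul (Real.exp_nonneg _), ← Real.exp_add]; congr 2; ring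
        have e2 : vE V (ξ * (1 - K.δ)) x = ENNReal.ofReal (Real.exp (ξ * t)) := by
          rw [vE, ht, mul_assoc]
        rw [e2, HConstants.drift, ENNReal.coe_add,
          show ((Real.exp (max (K.b K.d0) 0)).toNNReal : ℝ≥0∞)
            = ENNReal.ofReal (Real.exp (max (K.b K.d0) 0)) from rfl, add_mul]
        conv_rhs => rw [e]
        rw [e]
        ring

lemma H1to6.drift_le (H : H1to6 m V K) {ξ : ℝ} (h0 : 0 ≤ ξ) (h1 : ξ ≤ 1) (s : Level) (n : ℕ)
    (x : X) : ∫⁻ y, vE V ξ y ∂(m.Q s n x) ≤ K.drift * vE V ξ x := by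
  refine (H.drift h0 h1 s n x).trans ?_
  gcongr
  refine ENNReal.ofReal_le_ofReal (Real.exp_le_exp.2 ?_)
  have := mul_nonneg (mul_nonneg h0 K.δ_pos.le) (zero_le_one.trans (H.one_le_V x))
  nlinarith

/-- Outside a sublevel set the drift factor is as small as desired. -/
lemma H1to6.drift_off (H : H1to6 m V K) {ξ : ℝ} (h0 : 0 ≤ ξ) (h1 : ξ ≤ 1) (s : Level) (n : ℕ)
    {d : ℝ} {x : X} (hx : x ∉ Csub V d) :
    ∫⁻ y, vE V ξ y ∂(m.Q s n x) ≤
      (K.drift * (Real.exp (-(ξ * K.δ * d))).toNNReal : ℝ≥0) * vE V ξ x := by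
  refine (H.drift h0 h1 s n x).trans ?_
  rw [ENNReal.coe_mul, mul_assoc]
  gcongr
  change _ ≤ ENNReal.ofReal _ * ENNReal.ofReal _
  rw [← ENNReal.ofReal_mul (Real.exp_nonneg _), ← Real.exp_add]
  refine ENNReal.ofReal_le_ofReal (Real.exp_le_exp.2 ?_)
  have hx' : d ≤ V x := (not_le.1 hx).le
  have := mul_le_mul_of_nonneg_left hx' (mul_nonneg h0 K.δ_pos.le)
  nlinarith

lemma H1to6.one_le_Q_Csub (H : H1to6 m V K) (s : Level) (n : ℕ) (x : X) :
    1 ≤ (K.keep : ℝ≥0∞) * vE V 1 x * m.Q s n x (Csub V K.d0) := by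
  have h := H.2.2.2.2 K.d0 K.dmin_lt_d0.le s n x
  have hpos : m.Q s n x (Csub V K.d0) ≠ 0 := by
    obtain ⟨ν, h3, -⟩ := H.2.2.1
    exact ((h3 K.d0 K.dmin_lt_d0.le).1 s n x).ne'
  have hfin : m.Q s n x (Csub V K.d0) ≠ ⊤ := measure_ne_top _ _
  calc (1 : ℝ≥0∞) = (m.Q s n x (Csub V K.d0))⁻¹ * m.Q s n x (Csub V K.d0) :=
        (ENNReal.inv_mul_cancel hpos hfin).symm
    _ ≤ _ := by
        gcongr
        refine h.trans ?_
        rw [vE, one_mul, mul_comm (K.invQ _), ENNReal.ofReal_mul (Real.exp_nonneg _), mul_comm]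
        gcongr
        change ((K.invQ K.d0).toNNReal : ℝ≥0∞) ≤ _
        rw [ENNReal.coe_le_coe]
        refine le_add_left (le_mul_of_one_le_right (zero_le) ?_)
        rw [Real.one_le_toNNReal]
        exact Real.one_le_exp (by linarith [K.one_lt_d0])

lemma H1to6.nonempty_Csub (H : H1to6 m V K) : (Csub V K.d0).Nonempty := by
  by_contra hemp
  obtain ⟨y, -⟩ := H.1.2.2.1 0
  have := H.one_le_Q_Csub .f 0 y
  rw [Set.not_nonempty_iff_eq_empty.1 hemp] at this
  simp at this

lemma H1to6.one_le_keep_mul (H : H1to6 m V K) (s : Level) (n : ℕ) {d : ℝ} {x : X}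
    (hx : x ∈ Csub V d) :
    1 ≤ (K.keep : ℝ≥0∞) * ENNReal.ofReal (Real.exp d) * m.Q s n x (Csub V K.d0) := by
  refine (H.one_le_Q_Csub s n x).trans ?_
  gcongr
  rw [vE, one_mul]
  exact ENNReal.ofReal_le_ofReal (Real.exp_le_exp.2 hx)

/-- Inside a sublevel set, the restricted kernels are comparable. -/
lemma H1to6.restrict_le (H : H1to6 m V K) (s : Level) (n : ℕ) {d : ℝ} (hd : K.dmin ≤ d)
    {x y : X} (hx : x ∈ Csub V d) (hy : y ∈ Csub V d) :
    (m.Q s n x).restrict (Csub V d) ≤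
      (K.ratio d : ℝ≥0∞) • (m.Q s n y).restrict (Csub V d) := by
  obtain ⟨ν, h3, h4⟩ := H.2.2.1
  obtain ⟨-, -, -, hlo⟩ := h3 d hd
  refine Measure.le_iff.2 fun B hB => ?_
  have hpos := K.epsLo_pos d hd
  rw [Measure.smul_apply, Measure.restrict_apply hB, Measure.restrict_apply hB,
    Set.inter_comm, smul_eq_mul]
  calc m.Q s n x (Csub V d ∩ B) ≤ ENNReal.ofReal (K.epsHi d) * ν d (Csub V d ∩ B) :=
        h4 d hd B hB s n x hx
    _ = K.ratio d * (ENNReal.ofReal (K.epsLo d) * ν d (Csub V d ∩ B)) := by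
        rw [← mul_assoc]
        congr 1
        change _ = ENNReal.ofReal _ * _
        rw [← ENNReal.ofReal_mul (div_nonneg (hpos.le.trans (K.epsLo_le_epsHi d hd)) hpos.le),
          div_mul_cancel₀ _ hpos.ne']
    _ ≤ K.ratio d * m.Q s n y (Csub V d ∩ B) := by
        gcongr
        exact hlo B hB s n y hy

end OneStep

/-! ### Uniform comparison of the total masses -/

/-- `B` with `1 ≤ B * Q(x, C)` for `x` in the sublevel set `C` at `d0`. -/
noncomputable def HConstants.keepIn (K : HConstants) : ℝ≥0 := K.keep * (Real.exp K.d0).toNNReal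

lemma HConstants.exists_level (K : HConstants) {ξ : ℝ} (hξ : 0 < ξ) (M : ℝ≥0) :
    ∃ d, K.d0 ≤ d ∧ M * (Real.exp (-(ξ * K.δ * d))).toNNReal ≤ 1 / 2 := by
  have h1 : Filter.Tendsto (fun d : ℝ => (M : ℝ) * Real.exp (-(ξ * K.δ * d))) Filter.atTop
      (nhds ((M : ℝ) * 0)) := by
    refine Filter.Tendsto.const_mul _ (Real.tendsto_exp_neg_atTop_nhds_zero.comp ?_)
    exact Filter.tendsto_id.const_mul_atTop (mul_pos hξ K.δ_pos)
  rw [mul_zero] at h1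
  obtain ⟨d, hd, hd'⟩ := ((h1.eventually (gt_mem_nhds (by norm_num : (0:ℝ) < 1 / 2))).and
    (Filter.eventually_ge_atTop K.d0)).exists
  refine ⟨d, hd', ?_⟩
  rw [← NNReal.coe_le_coe]
  push_cast
  rw [Real.coe_toNNReal _ (Real.exp_nonneg _)]
  exact hd.le

section

variable {X : Type u} [MeasurableSpace X] {m : CoupledModel X} {V : X → ℝ} {K : HConstants}

/-- Infimum over the sublevel set at level `a` of the total mass of `Q_{p,p+k}`. -/
noncomputable def low (m : CoupledModel X) (V : X → ℝ) (a : ℝ) (s : Level) (p k : ℕ) : ℝ≥0∞ :=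
  ⨅ x ∈ Csub V a, m.U s p k x

lemma low_le {a : ℝ} (s : Level) (p k : ℕ) {x : X} (hx : x ∈ Csub V a) :
    low m V a s p k ≤ m.U s p k x := iInf₂_le x hx

lemma low_zero (a : ℝ) (s : Level) (p : ℕ) : 1 ≤ low m V a s p 0 :=
  le_iInf₂ fun x _ => (m.U_zero s p x).ge

lemma mul_low_le (s : Level) (p k : ℕ) (x : X) :
    m.Q s p x (Csub V K.d0) * low m V K.d0 s (p + 1) k ≤ m.U s p (k + 1) x := by
  rw [m.U_succ, mul_comm]
  calc low m V K.d0 s (p + 1) k * m.Q s p x (Csub V K.d0)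
      = ∫⁻ _ in Csub V K.d0, low m V K.d0 s (p + 1) k ∂(m.Q s p x) := by simp
    _ ≤ ∫⁻ y in Csub V K.d0, m.U s (p + 1) k y ∂(m.Q s p x) :=
        setLIntegral_mono (m.measurable_U _ _ _) fun y hy => low_le s _ _ hy
    _ ≤ _ := setLIntegral_le_lintegral _ _

lemma H1to6.low_succ_le_U (H : H1to6 m V K) (s : Level) (p k : ℕ) (x : X) :
    low m V K.d0 s (p + 1) k ≤ K.keep * vE V 1 x * m.U s p (k + 1) x :=
  calc low m V K.d0 s (p + 1) k = 1 * low m V K.d0 s (p + 1) k := (one_mul _).symm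
    _ ≤ K.keep * vE V 1 x * m.Q s p x (Csub V K.d0) * low m V K.d0 s (p + 1) k := by
        gcongr; exact H.one_le_Q_Csub s p x
    _ ≤ _ := by
        rw [mul_assoc]
        gcongr
        exact mul_low_le s p k x

lemma H1to6.low_succ_le (H : H1to6 m V K) (s : Level) (p k : ℕ) :
    low m V K.d0 s (p + 1) k ≤ K.keepIn * low m V K.d0 s p (k + 1) := by
  have hne : (K.keepIn : ℝ≥0∞) ≠ 0 := by
    have : 0 < K.keepIn := mul_pos (zero_lt_one.trans_le K.one_le_keep)
      (Real.toNNReal_pos.2 (Real.exp_pos _))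
    exact_mod_cast this.ne'
  rw [low, low, ENNReal.mul_iInf_of_ne hne ENNReal.coe_ne_top]
  refine le_iInf fun x => ?_
  by_cases hx : x ∈ Csub V K.d0
  · simp only [hx, iInf_pos]
    refine (H.low_succ_le_U s p k x).trans ?_
    gcongr
    rw [HConstants.keepIn, ENNReal.coe_mul, vE, one_mul]
    gcongr
    exact ENNReal.ofReal_le_ofReal (Real.exp_le_exp.2 hx)
  · simp [hx, ENNReal.mul_top hne]

/-- One step of the comparison, losing a constant factor. -/
lemma H1to6.U_succ_le_low (H : H1to6 m V K) {ξ : ℝ} (h0 : 0 ≤ ξ) (h1 : ξ ≤ 1) {s : Level}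
    {p k : ℕ} {R : ℝ≥0}
    (hR : ∀ x, m.U s (p + 1) k x ≤ R * vE V ξ x * low m V K.d0 s (p + 1) k) (x : X) :
    m.U s p (k + 1) x ≤ R * K.drift * vE V ξ x * low m V K.d0 s (p + 1) k := by
  rw [m.U_succ]
  calc ∫⁻ y, m.U s (p + 1) k y ∂(m.Q s p x)
      ≤ ∫⁻ y, R * vE V ξ y * low m V K.d0 s (p + 1) k ∂(m.Q s p x) := lintegral_mono hR
    _ = R * (∫⁻ y, vE V ξ y ∂(m.Q s p x)) * low m V K.d0 s (p + 1) k := by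
        rw [lintegral_mul_const _ ((H.measurable_vE ξ).const_mul _),
          lintegral_const_mul _ (H.measurable_vE ξ)]
    _ ≤ R * (K.drift * vE V ξ x) * low m V K.d0 s (p + 1) k := by
        gcongr; exact H.drift_le h0 h1 s p x
    _ = _ := by ring

lemma H1to6.U_succ_le_low_off (H : H1to6 m V K) {ξ : ℝ} (h0 : 0 ≤ ξ) (h1 : ξ ≤ 1) {s : Level}
    {p k : ℕ} {R : ℝ≥0}
    (hR : ∀ x, m.U s (p + 1) k x ≤ R * vE V ξ x * low m V K.d0 s (p + 1) k) {d : ℝ} {x : X}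
    (hx : x ∉ Csub V d) :
    m.U s p (k + 1) x ≤ R * (K.drift * (Real.exp (-(ξ * K.δ * d))).toNNReal : ℝ≥0) * vE V ξ x *
      low m V K.d0 s (p + 1) k := by
  rw [m.U_succ]
  calc ∫⁻ y, m.U s (p + 1) k y ∂(m.Q s p x)
      ≤ ∫⁻ y, R * vE V ξ y * low m V K.d0 s (p + 1) k ∂(m.Q s p x) := lintegral_mono hR
    _ = R * (∫⁻ y, vE V ξ y ∂(m.Q s p x)) * low m V K.d0 s (p + 1) k := by
        rw [lintegral_mul_const _ ((H.measurable_vE ξ).const_mul _),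
          lintegral_const_mul _ (H.measurable_vE ξ)]
    _ ≤ R * (_ * vE V ξ x) * low m V K.d0 s (p + 1) k := by
        gcongr; exact H.drift_off h0 h1 s p hx
    _ = _ := by ring

end

/-- The total mass of `Q_{p,n}(x, ·)` is at most a multiple of `exp (ξ V x)` times its infimum over
a fixed sublevel set, uniformly in `p` and `n`. From outside a large sublevel set, one step of the
drift beats the mass lost by staying in the fixed sublevel set; inside, the first step is compared
with the one from the fixed sublevel set, or else leaves, and then the drift applies again. -/
lemma exists_U_le_low (K : HConstants) {ξ : ℝ} (h0 : 0 < ξ) (h1 : ξ ≤ 1) :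
    ∃ R : ℝ≥0, 1 ≤ R ∧ ∀ (X : Type u) [MeasurableSpace X] (m : CoupledModel X) (V : X → ℝ),
      H1to6 m V K → ∀ (s : Level) (p k : ℕ) (x : X),
        m.U s p k x ≤ R * vE V ξ x * low m V K.d0 s p k := by
  set B := K.keepIn with hB
  set L := K.drift with hL
  obtain ⟨d, hd, hsmall⟩ := K.exists_level h0 (L * B * (1 + L * B))
  set l : ℝ≥0 := L * (Real.exp (-(ξ * K.δ * d))).toNNReal with hl
  have hl1 : l * B ≤ 1 / 2 := by
    refine le_trans ?_ hsmall
    calc l * B = (L * B * (Real.exp (-(ξ * K.δ * d))).toNNReal) * 1 := by rw [hl]; ring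
      _ ≤ (L * B * (Real.exp (-(ξ * K.δ * d))).toNNReal) * (1 + L * B) := by
          gcongr; exact le_self_add
      _ = _ := by ring
  have hl2 : l * L * B * B ≤ 1 / 2 := by
    refine le_trans ?_ hsmall
    calc l * L * B * B = (L * B * (Real.exp (-(ξ * K.δ * d))).toNNReal) * (L * B) := by
          rw [hl]; ring
      _ ≤ (L * B * (Real.exp (-(ξ * K.δ * d))).toNNReal) * (1 + L * B) := by
          gcongr; exact le_add_self
      _ = _ := by ring
  set R : ℝ≥0 := 1 + L * B + 2 * K.ratio d with hR
  refine ⟨R, le_add_right le_self_add, fun X _ m V H s p k => ?_⟩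
  have hlow : ∀ p k, low m V K.d0 s (p + 1) k ≤ B * low m V K.d0 s p (k + 1) :=
    fun p k => H.low_succ_le s p k
  induction k using Nat.twoStepInduction generalizing p with
  | zero =>
    intro x
    rw [m.U_zero]
    have hR1 : (1 : ℝ≥0∞) ≤ R := by exact_mod_cast le_add_right le_self_add
    calc (1 : ℝ≥0∞) = 1 * 1 * 1 := by simp
      _ ≤ _ := by gcongr; exacts [H.one_le_vE h0.le x, low_zero _ _ _]
  | one =>
    intro x
    have h := H.U_succ_le_low h0.le h1 (s := s) (p := p) (k := 0) (R := 1) (fun y => by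
      rw [m.U_zero]
      calc (1 : ℝ≥0∞) = 1 * 1 * 1 := by simp
        _ ≤ _ := by gcongr; exacts [le_rfl, H.one_le_vE h0.le y, low_zero _ _ _]) x
    refine h.trans ?_
    calc ((1 : ℝ≥0) : ℝ≥0∞) * L * vE V ξ x * low m V K.d0 s (p + 1) 0
        ≤ ((1 : ℝ≥0) : ℝ≥0∞) * L * vE V ξ x * (B * low m V K.d0 s p 1) := by
          gcongr; exact hlow p 0
      _ = (L * B : ℝ≥0) * vE V ξ x * low m V K.d0 s p 1 := by push_cast; ring
      _ ≤ _ := by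
          gcongr
          rw [hR, add_assoc]
          exact le_add_left le_self_add
  | more k ih0 ih1 =>
    intro x
    have hoff : ∀ q j, (∀ y, m.U s (q + 1) j y ≤ R * vE V ξ y * low m V K.d0 s (q + 1) j) →
        ∀ y, y ∉ Csub V d → m.U s q (j + 1) y ≤
          R * l * vE V ξ y * low m V K.d0 s (q + 1) j := fun q j h y hy =>
      H.U_succ_le_low_off h0.le h1 h hy
    by_cases hx : x ∈ Csub V d
    · have hin : ∫⁻ y in Csub V d, m.U s (p + 1) (k + 1) y ∂(m.Q s p x)
          ≤ K.ratio d * low m V K.d0 s p (k + 2) := by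
        have hr0 : ∀ x0 ∈ Csub V K.d0,
            ∫⁻ y in Csub V d, m.U s (p + 1) (k + 1) y ∂(m.Q s p x)
              ≤ K.ratio d * m.U s p (k + 2) x0 := by
          intro x0 hx0
          have hle := H.restrict_le s p (K.dmin_lt_d0.le.trans hd) hx
            (y := x0) (le_trans (show V x0 ≤ K.d0 from hx0) hd)
          calc ∫⁻ y in Csub V d, m.U s (p + 1) (k + 1) y ∂(m.Q s p x)
              ≤ ∫⁻ y, m.U s (p + 1) (k + 1) y
                  ∂((K.ratio d : ℝ≥0∞) • (m.Q s p x0).restrict (Csub V d)) :=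
                lintegral_mono' hle le_rfl
            _ = K.ratio d * ∫⁻ y in Csub V d, m.U s (p + 1) (k + 1) y ∂(m.Q s p x0) := by
                rw [lintegral_smul_measure, smul_eq_mul]
            _ ≤ _ := by
                rw [m.U_succ s p (k + 1)]
                gcongr
                exact Measure.restrict_le_self
        rcases eq_or_ne (K.ratio d) 0 with hz | hz
        · obtain ⟨x0, hx0⟩ := H.nonempty_Csub
          have := hr0 x0 hx0
          rw [hz] at this ⊢
          simpa using this
        · rw [low, ENNReal.mul_iInf_of_ne (by exact_mod_cast hz) ENNReal.coe_ne_top]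
          refine le_iInf fun x0 => ?_
          by_cases hx0 : x0 ∈ Csub V K.d0
          · simpa [hx0] using hr0 x0 hx0
          · simp [hx0, hz]
      have hout : ∫⁻ y in (Csub V d)ᶜ, m.U s (p + 1) (k + 1) y ∂(m.Q s p x)
          ≤ R * (1 / 2 : ℝ≥0) * vE V ξ x * low m V K.d0 s p (k + 2) := by
        calc ∫⁻ y in (Csub V d)ᶜ, m.U s (p + 1) (k + 1) y ∂(m.Q s p x)
            ≤ ∫⁻ y in (Csub V d)ᶜ, R * l * vE V ξ y * low m V K.d0 s (p + 1 + 1) k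
                ∂(m.Q s p x) :=
              setLIntegral_mono (((H.measurable_vE ξ).const_mul _).mul_const _)
                fun y hy => hoff (p + 1) k (ih0 (p + 1 + 1)) y hy
          _ ≤ ∫⁻ y, R * l * vE V ξ y * low m V K.d0 s (p + 1 + 1) k ∂(m.Q s p x) :=
              setLIntegral_le_lintegral _ _
          _ = R * l * (∫⁻ y, vE V ξ y ∂(m.Q s p x)) * low m V K.d0 s (p + 1 + 1) k := by
              rw [lintegral_mul_const _ ((H.measurable_vE ξ).const_mul _),
                lintegral_const_mul _ (H.measurable_vE ξ)]
          _ ≤ R * l * (L * vE V ξ x) * (B * (B * low m V K.d0 s p (k + 2))) := by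
              gcongr
              · exact H.drift_le h0.le h1 s p x
              · refine (hlow (p + 1) k).trans ?_
                gcongr
                exact hlow p (k + 1)
          _ = R * (l * L * B * B : ℝ≥0) * vE V ξ x * low m V K.d0 s p (k + 2) := by
              push_cast; ring
          _ ≤ _ := by gcongr
      rw [m.U_succ s p (k + 1), ← lintegral_add_compl _ (H.measurableSet_Csub d)]
      calc _ ≤ K.ratio d * low m V K.d0 s p (k + 2)
            + R * (1 / 2 : ℝ≥0) * vE V ξ x * low m V K.d0 s p (k + 2) := add_le_add hin hout
        _ ≤ K.ratio d * (vE V ξ x * low m V K.d0 s p (k + 2))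
            + R * (1 / 2 : ℝ≥0) * vE V ξ x * low m V K.d0 s p (k + 2) := by
            gcongr
            exact le_mul_of_one_le_left zero_le (H.one_le_vE h0.le x)
        _ = (K.ratio d + R * (1 / 2) : ℝ≥0) * vE V ξ x * low m V K.d0 s p (k + 2) := by
            push_cast; ring
        _ ≤ _ := by
            gcongr
            have : 2 * K.ratio d ≤ R := le_add_self
            rw [← NNReal.coe_le_coe] at this ⊢
            push_cast at this ⊢
            linarith
    · refine (hoff p (k + 1) (ih1 (p + 1)) x hx).trans ?_
      calc (R : ℝ≥0∞) * l * vE V ξ x * low m V K.d0 s (p + 1) (k + 1)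
          ≤ R * l * vE V ξ x * (B * low m V K.d0 s p (k + 2)) := by
            gcongr; exact hlow p (k + 1)
        _ = R * (l * B : ℝ≥0) * vE V ξ x * low m V K.d0 s p (k + 2) := by push_cast; ring
        _ ≤ R * (1 : ℝ≥0) * vE V ξ x * low m V K.d0 s p (k + 2) := by
            gcongr
            exact hl1.trans (by norm_num)
        _ = _ := by simp

/-- The weighted moment of the unnormalised predictors is at most a multiple of their mass in a
fixed sublevel set. -/
lemma exists_gamma_vE_le (K : HConstants) :
    ∃ T : ℝ≥0, 1 ≤ T ∧ ∀ (X : Type u) [MeasurableSpace X] (m : CoupledModel X) (V : X → ℝ),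
      H1to6 m V K → ∀ (s : Level) (p : ℕ),
        ∫⁻ x, vE V 1 x ∂(m.gamma s p) ≤ T * m.gamma s p (Csub V K.d0) := by
  obtain ⟨d, hd, hsmall⟩ := K.exists_level one_pos (K.drift * K.keepIn)
  set l : ℝ≥0 := K.drift * (Real.exp (-(1 * K.δ * d))).toNNReal with hl
  set E : ℝ≥0 := (Real.exp d).toNNReal
  set T : ℝ≥0 := 1 + K.initV.toNNReal * (K.initC K.d0).toNNReal
    + 2 * (K.drift * E * (K.keep * E)) with hT
  refine ⟨T, le_add_right le_self_add, fun X _ m V H s p => ?_⟩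
  induction p with
  | zero =>
    rw [m.gamma_zero]
    have hV : ∫⁻ x, vE V 1 x ∂(m.init s) ≤ K.initV.toNNReal := by
      simp only [vE, one_mul]
      exact H.2.1.1 s
    have hC := H.2.1.2 K.d0 K.one_lt_d0 s
    have hC0 : m.init s (Csub V K.d0) ≠ 0 := by
      intro h; rw [h] at hC; simp at hC
    have hC' : 1 ≤ ((K.initC K.d0).toNNReal : ℝ≥0∞) * m.init s (Csub V K.d0) := by
      rw [← ENNReal.inv_mul_cancel hC0 (measure_ne_top _ _)]
      gcongr
      exact hC
    calc ∫⁻ x, vE V 1 x ∂(m.init s) ≤ K.initV.toNNReal * 1 := by simpa using hV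
      _ ≤ K.initV.toNNReal * ((K.initC K.d0).toNNReal * m.init s (Csub V K.d0)) := by gcongr
      _ = (K.initV.toNNReal * (K.initC K.d0).toNNReal : ℝ≥0) * m.init s (Csub V K.d0) := by
          push_cast; ring
      _ ≤ _ := by gcongr; exact le_add_right le_add_self
  | succ p ih =>
    have hmV := H.measurable_vE 1
    have hCs := H.measurableSet_Csub K.d0
    have hnext : m.gamma s (p + 1) (Csub V K.d0)
        = ∫⁻ x, m.Q s p x (Csub V K.d0) ∂(m.gamma s p) := by
      rw [m.gamma_succ, Measure.bind_apply hCs (Kernel.aemeasurable _)]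
    have hstay : ∀ a, m.gamma s p (Csub V a) ≤
        (K.keep * (Real.exp a).toNNReal : ℝ≥0) * m.gamma s (p + 1) (Csub V K.d0) := by
      intro a
      rw [hnext, ← lintegral_const_mul _ (Kernel.measurable_coe _ hCs),
        ← lintegral_indicator_one (H.measurableSet_Csub a)]
      refine lintegral_mono fun x => ?_
      by_cases hx : x ∈ Csub V a
      · simp only [hx, Set.indicator_of_mem, Pi.one_apply]
        have := H.one_le_keep_mul s p hx
        rwa [ENNReal.coe_mul]
      · simp [hx]
    rw [m.lintegral_gamma_succ s p hmV]
    have hpt : ∀ x, ∫⁻ y, vE V 1 y ∂(m.Q s p x) ≤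
        l * vE V 1 x + (K.drift * E : ℝ≥0) * (Csub V d).indicator 1 x := by
      intro x
      by_cases hx : x ∈ Csub V d
      · refine le_add_left ?_
        simp only [hx, Set.indicator_of_mem, Pi.one_apply, mul_one]
        refine (H.drift_le zero_le_one le_rfl s p x).trans ?_
        rw [ENNReal.coe_mul]
        gcongr
        rw [vE, one_mul]
        exact ENNReal.ofReal_le_ofReal (Real.exp_le_exp.2 hx)
      · exact le_add_right (H.drift_off zero_le_one le_rfl s p hx)
    have hmi : Measurable ((Csub V d).indicator (1 : X → ℝ≥0∞)) :=
      measurable_one.indicator (H.measurableSet_Csub d)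
    calc ∫⁻ x, ∫⁻ y, vE V 1 y ∂(m.Q s p x) ∂(m.gamma s p)
        ≤ ∫⁻ x, (l * vE V 1 x + (K.drift * E : ℝ≥0) * (Csub V d).indicator 1 x)
            ∂(m.gamma s p) := lintegral_mono hpt
      _ = l * ∫⁻ x, vE V 1 x ∂(m.gamma s p)
            + (K.drift * E : ℝ≥0) * m.gamma s p (Csub V d) := by
          rw [lintegral_add_left (hmV.const_mul _), lintegral_const_mul _ hmV,
            lintegral_const_mul _ hmi, lintegral_indicator_one (H.measurableSet_Csub d)]
      _ ≤ l * (T * (K.keepIn * m.gamma s (p + 1) (Csub V K.d0)))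
            + (K.drift * E : ℝ≥0) * ((K.keep * E : ℝ≥0) * m.gamma s (p + 1) (Csub V K.d0)) := by
          gcongr
          · refine ih.trans ?_
            gcongr
            exact hstay _
          · exact hstay d
      _ = (T * (l * K.keepIn) + K.drift * E * (K.keep * E) : ℝ≥0)
            * m.gamma s (p + 1) (Csub V K.d0) := by push_cast; ring
      _ ≤ T * m.gamma s (p + 1) (Csub V K.d0) := by
          gcongr
          have h1 : T * (l * K.keepIn) ≤ T * (1 / 2) := by
            gcongr
            refine le_trans (le_of_eq ?_) hsmall
            rw [hl]; ring
          have h2 : 2 * (K.drift * E * (K.keep * E)) ≤ T := le_add_self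
          rw [← NNReal.coe_le_coe] at h1 h2 ⊢
          push_cast at h1 h2 ⊢
          linarith

/-! ### Normalised quantities -/

lemma integral_bind {α β : Type*} [MeasurableSpace α] [MeasurableSpace β] {μ : Measure α}
    {κ : Kernel α β} {f : β → ℝ} (hf : Integrable f (μ.bind κ)) :
    ∫ y, f y ∂(μ.bind κ) = ∫ x, ∫ y, f y ∂(κ x) ∂μ := by
  have h : μ.bind κ = (κ.comp (Kernel.const Unit μ)) () := by
    rw [Kernel.comp_apply, Kernel.const_apply]
  rw [h] at hf ⊢
  rw [Kernel.integral_comp hf, Kernel.const_apply]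

lemma IsBdd.integrable {X : Type u} [MeasurableSpace X] {φ : X → ℝ} (hφ : IsBdd φ)
    (μ : Measure X) [IsFiniteMeasure μ] : Integrable φ μ := by
  obtain ⟨L, hL⟩ := hφ.2
  exact Integrable.of_bound hφ.1.aestronglyMeasurable L (ae_of_all _ hL)

lemma IsBdd.sub_const {X : Type u} [MeasurableSpace X] {φ : X → ℝ} (hφ : IsBdd φ) (c : ℝ) :
    IsBdd fun x => φ x - c := by
  obtain ⟨L, hL⟩ := hφ.2
  exact ⟨hφ.1.sub_const c, L + |c|, fun x => (abs_sub _ _).trans (by linarith [hL x])⟩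

lemma isBdd_const {X : Type u} [MeasurableSpace X] (c : ℝ) : IsBdd fun _ : X => c :=
  ⟨measurable_const, |c|, fun _ => le_rfl⟩

lemma wnorm_nonneg {X : Type u} {w φ : X → ℝ} (hw : ∀ x, 0 ≤ w x) : 0 ≤ wnorm w φ :=
  Real.iSup_nonneg fun x => div_nonneg (abs_nonneg _) (hw x)

lemma le_wnorm {X : Type u} {w φ : X → ℝ} (hw : ∀ x, 0 < w x) {L : ℝ}
    (hL : ∀ x, |φ x| ≤ L * w x) (x : X) : |φ x| ≤ wnorm w φ * w x := by
  rw [← div_le_iff₀ (hw x)]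
  exact le_ciSup (f := fun x => |φ x| / w x)
    ⟨L, by rintro _ ⟨y, rfl⟩; exact (div_le_iff₀ (hw y)).2 (hL y)⟩ x

lemma wnorm_le {X : Type u} {w φ : X → ℝ} (hw : ∀ x, 0 < w x) {L : ℝ} (h0 : 0 ≤ L)
    (hL : ∀ x, |φ x| ≤ L * w x) : wnorm w φ ≤ L :=
  Real.iSup_le (fun x => (div_le_iff₀ (hw x)).2 (hL x)) h0

lemma supNorm_nonneg {X : Type u} (φ : X → ℝ) : 0 ≤ supNorm φ :=
  wnorm_nonneg fun _ => zero_le_one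

lemma IsBdd.le_supNorm {X : Type u} [MeasurableSpace X] {φ : X → ℝ} (hφ : IsBdd φ) (x : X) :
    |φ x| ≤ supNorm φ := by
  obtain ⟨L, hL⟩ := hφ.2
  have h := le_wnorm (w := fun _ => 1) (fun _ => one_pos) (L := L) (by simpa using hL) x
  rwa [mul_one] at h

section

variable {X : Type u} {V : X → ℝ}

lemma vpow_eq (V : X → ℝ) (ξ : ℝ) (x : X) : vpow V ξ x = Real.exp (ξ * V x) := by
  rw [vpow, mul_comm, Real.exp_mul]

lemma vE_eq (V : X → ℝ) (ξ : ℝ) (x : X) : vE V ξ x = ENNReal.ofReal (vpow V ξ x) := by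
  rw [vpow_eq, vE]

lemma vpow_pos (V : X → ℝ) (ξ : ℝ) (x : X) : 0 < vpow V ξ x := by
  rw [vpow_eq]; exact Real.exp_pos _

lemma vpow_add (V : X → ℝ) (a b : ℝ) (x : X) : vpow V (a + b) x = vpow V a x * vpow V b x := by
  simp only [vpow_eq]; rw [← Real.exp_add]; ring_nf

end

section

variable {X : Type u} [MeasurableSpace X] {m : CoupledModel X} {V : X → ℝ} {K : HConstants}

lemma H1to6.measurable_vpow (H : H1to6 m V K) (ξ : ℝ) : Measurable (vpow V ξ) :=
  H.measurable_V.exp.pow_const ξ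

lemma H1to6.vpow_mono (H : H1to6 m V K) {a b : ℝ} (hab : a ≤ b) (x : X) :
    vpow V a x ≤ vpow V b x := by
  simp only [vpow_eq]
  exact Real.exp_le_exp.2 (mul_le_mul_of_nonneg_right hab (zero_le_one.trans (H.one_le_V x)))

lemma H1to6.one_le_vpow (H : H1to6 m V K) {a : ℝ} (ha : 0 ≤ a) (x : X) : 1 ≤ vpow V a x := by
  rw [vpow_eq]
  exact Real.one_le_exp (mul_nonneg ha (zero_le_one.trans (H.one_le_V x)))

lemma H1to6.Q_univ_pos (H : H1to6 m V K) (s : Level) (n : ℕ) (x : X) :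
    0 < m.Q s n x Set.univ := by
  obtain ⟨ν, h3, -⟩ := H.2.2.1
  exact ((h3 K.d0 K.dmin_lt_d0.le).1 s n x).trans_le (measure_mono (Set.subset_univ _))

lemma H1to6.gamma_univ_ne_zero (H : H1to6 m V K) (s : Level) (p : ℕ) :
    m.gamma s p Set.univ ≠ 0 := by
  induction p with
  | zero => simp [m.gamma_zero]
  | succ p ih =>
    have hm : Measurable fun x => m.Q s p x Set.univ := Kernel.measurable_coe _ .univ
    rw [m.gamma_succ, Measure.bind_apply .univ (Kernel.aemeasurable _)]
    refine ((lintegral_pos_iff_support hm).2 ?_).ne'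
    have : Function.support (fun x => m.Q s p x Set.univ) = Set.univ :=
      Set.eq_univ_of_forall fun x => (H.Q_univ_pos s p x).ne'
    rw [this]
    exact pos_iff_ne_zero.2 ih

lemma H1to6.isProbabilityMeasure_eta (H : H1to6 m V K) (s : Level) (p : ℕ) :
    IsProbabilityMeasure (m.eta s p) :=
  ⟨by rw [CoupledModel.eta, Measure.smul_apply, smul_eq_mul,
    ENNReal.inv_mul_cancel (H.gamma_univ_ne_zero s p) (measure_ne_top _ _)]⟩

lemma H1to6.gamma_eq (H : H1to6 m V K) (s : Level) (p : ℕ) :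
    m.gamma s p = m.gamma s p Set.univ • m.eta s p := by
  rw [CoupledModel.eta, smul_smul,
    ENNReal.mul_inv_cancel (H.gamma_univ_ne_zero s p) (measure_ne_top _ _), one_smul]

lemma H1to6.gamma_real_pos (H : H1to6 m V K) (s : Level) (p : ℕ) :
    0 < (m.gamma s p Set.univ).toReal :=
  ENNReal.toReal_pos (H.gamma_univ_ne_zero s p) (measure_ne_top _ _)

/-- The normaliser `η_p(Q_{p,p+k}(1))` as an extended nonnegative number. -/
noncomputable def massE (m : CoupledModel X) (s : Level) (p k : ℕ) : ℝ≥0∞ :=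
  ∫⁻ x, m.U s p k x ∂(m.eta s p)

lemma H1to6.massE_eq (_H : H1to6 m V K) (s : Level) (p k : ℕ) :
    massE m s p k = (m.gamma s p Set.univ)⁻¹ * m.gamma s (p + k) Set.univ := by
  rw [massE, CoupledModel.eta, lintegral_smul_measure, m.lintegral_U_gamma, smul_eq_mul]

lemma H1to6.eta_succ (H : H1to6 m V K) (s : Level) (p : ℕ) :
    m.eta s (p + 1) = (massE m s p 1)⁻¹ • (m.eta s p).bind (m.Q s p) := by
  have h0 := H.gamma_univ_ne_zero s p
  have hb : (m.gamma s p).bind (m.Q s p) =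
      m.gamma s p Set.univ • (m.eta s p).bind (m.Q s p) := by
    conv_lhs => rw [H.gamma_eq s p]
    rw [Measure.comp_smul]
  rw [H.massE_eq]
  conv_lhs => rw [CoupledModel.eta, m.gamma_succ, hb, smul_smul]
  rw [← hb, ← m.gamma_succ]
  congr 1
  rw [ENNReal.mul_inv (Or.inr (measure_ne_top _ _)) (Or.inr (H.gamma_univ_ne_zero s _)), inv_inv,
    mul_comm]

lemma Qop_one (m : CoupledModel X) (s : Level) (p k : ℕ) (x : X) :
    m.Qop s p (p + k) (fun _ => 1) x = (m.U s p k x).toReal := by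
  simp [CoupledModel.Qop, CoupledModel.Qpn, CoupledModel.U, measureReal_def]

lemma H1to6.mass_eq (H : H1to6 m V K) (s : Level) (p k : ℕ) :
    m.mass s p (p + k) =
      (m.gamma s (p + k) Set.univ).toReal / (m.gamma s p Set.univ).toReal := by
  rw [CoupledModel.mass]
  simp only [Qop_one]
  rw [integral_toReal (m.measurable_U s p k).aemeasurable (ae_of_all _ fun x => m.U_lt_top s p k x)]
  change (massE m s p k).toReal = _
  rw [H.massE_eq, ENNReal.toReal_mul, ENNReal.toReal_inv, div_eq_inv_mul]

lemma H1to6.mass_eq_massE (H : H1to6 m V K) (s : Level) (p k : ℕ) :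
    m.mass s p (p + k) = (massE m s p k).toReal := by
  rw [H.mass_eq, H.massE_eq, ENNReal.toReal_mul, ENNReal.toReal_inv, div_eq_inv_mul]

lemma H1to6.massE_ne_top (H : H1to6 m V K) (s : Level) (p k : ℕ) : massE m s p k ≠ ⊤ := by
  rw [H.massE_eq]
  exact ENNReal.mul_ne_top (ENNReal.inv_ne_top.2 (H.gamma_univ_ne_zero s p)) (measure_ne_top _ _)

lemma H1to6.mass_pos (H : H1to6 m V K) (s : Level) (p k : ℕ) : 0 < m.mass s p (p + k) := by
  rw [H.mass_eq]
  exact div_pos (H.gamma_real_pos _ _) (H.gamma_real_pos _ _)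

lemma H1to6.U_pos (H : H1to6 m V K) (s : Level) (p k : ℕ) (x : X) : 0 < m.U s p k x := by
  induction k generalizing p x with
  | zero => simp [m.U_zero]
  | succ k ih =>
    rw [m.U_succ, lintegral_pos_iff_support (m.measurable_U _ _ _)]
    have : Function.support (m.U s (p + 1) k) = Set.univ :=
      Set.eq_univ_of_forall fun y => (ih (p + 1) y).ne'
    rw [this]
    exact H.Q_univ_pos s p x

lemma H1to6.Qop_one_pos (H : H1to6 m V K) (s : Level) (p k : ℕ) (x : X) :
    0 < m.Qop s p (p + k) (fun _ => 1) x := by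
  rw [Qop_one]
  exact ENNReal.toReal_pos (H.U_pos s p k x).ne' (m.U_lt_top s p k x).ne

lemma H1to6.h_pos (H : H1to6 m V K) (s : Level) (p k : ℕ) (x : X) : 0 < m.h s p (p + k) x :=
  div_pos (H.Qop_one_pos s p k x) (H.mass_pos s p k)

lemma measurable_Qop (m : CoupledModel X) (s : Level) (p n : ℕ) {φ : X → ℝ}
    (hφ : Measurable φ) : Measurable (m.Qop s p n φ) :=
  hφ.stronglyMeasurable.integral_kernel.measurable

lemma abs_Qop_le (m : CoupledModel X) (s : Level) (p n : ℕ) {φ : X → ℝ} {L : ℝ}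
    (hL : ∀ x, |φ x| ≤ L) (x : X) :
    |m.Qop s p n φ x| ≤ L * m.Qop s p n (fun _ => 1) x := by
  rw [CoupledModel.Qop, CoupledModel.Qop]
  have := norm_integral_le_of_norm_le_const (μ := m.Qpn s p n x) (f := φ) (ae_of_all _ hL)
  simpa using this

lemma Qop_succ (m : CoupledModel X) (s : Level) (p k : ℕ) {φ : X → ℝ} (hφ : IsBdd φ) (x : X) :
    m.Qop s p (p + (k + 1)) φ x
      = ∫ y, m.Qop s (p + 1) (p + 1 + k) φ y ∂(m.Q s p x) := by
  have h := m.Qiter_succ' s p k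
  simp only [CoupledModel.Qop, CoupledModel.Qpn, Nat.add_sub_cancel_left]
  rw [h]
  refine Kernel.integral_comp ?_
  rw [← h]
  exact hφ.integrable _

lemma Qop_self (m : CoupledModel X) (s : Level) (n : ℕ) {φ : X → ℝ} (hφ : Measurable φ) (x : X) :
    m.Qop s n n φ x = φ x := by
  simp only [CoupledModel.Qop, CoupledModel.Qpn, Nat.sub_self, CoupledModel.Qiter,
    Kernel.id_apply]
  exact integral_dirac' _ _ hφ.stronglyMeasurable

lemma H1to6.integral_Qop_eta (H : H1to6 m V K) (s : Level) (p k : ℕ) {φ : X → ℝ}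
    (hφ : IsBdd φ) :
    ∫ x, m.Qop s p (p + k) φ x ∂(m.eta s p)
      = m.mass s p (p + k) * ∫ x, φ x ∂(m.eta s (p + k)) := by
  have h1 : ∫ x, φ x ∂(m.gamma s (p + k)) = ∫ x, m.Qop s p (p + k) φ x ∂(m.gamma s p) := by
    have hg := m.gamma_add s p k
    rw [hg, integral_bind (by rw [← hg]; exact hφ.integrable _)]
    simp [CoupledModel.Qop, CoupledModel.Qpn]
  rw [H.mass_eq, CoupledModel.eta, CoupledModel.eta, integral_smul_measure, integral_smul_measure,
    h1, ENNReal.toReal_inv, ENNReal.toReal_inv, smul_eq_mul, smul_eq_mul]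
  have := (H.gamma_real_pos s (p + k)).ne'
  have := (H.gamma_real_pos s p).ne'
  field_simp

/-- The normalised semigroup `Q_{p,n}(φ) / Q_{p,n}(1)`. -/
noncomputable def normQ (m : CoupledModel X) (s : Level) (p n : ℕ) (φ : X → ℝ) (x : X) : ℝ :=
  m.Qop s p n φ x / m.Qop s p n (fun _ => 1) x

lemma measurable_normQ (m : CoupledModel X) (s : Level) (p n : ℕ) {φ : X → ℝ}
    (hφ : Measurable φ) : Measurable (normQ m s p n φ) :=
  (measurable_Qop m s p n hφ).div (measurable_Qop m s p n measurable_const)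

lemma H1to6.abs_normQ_le (H : H1to6 m V K) (s : Level) (p k : ℕ) {φ : X → ℝ} {L : ℝ}
    (hL : ∀ x, |φ x| ≤ L) (x : X) : |normQ m s p (p + k) φ x| ≤ L := by
  have h := H.Qop_one_pos s p k x
  rw [normQ, abs_div, abs_of_pos h, div_le_iff₀ h]
  exact abs_Qop_le m s p _ hL x

lemma h_mul_normQ (H : H1to6 m V K) (s : Level) (p k : ℕ) (φ : X → ℝ) (x : X) :
    m.h s p (p + k) x * normQ m s p (p + k) φ x
      = m.Qop s p (p + k) φ x / m.mass s p (p + k) := by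
  have h := (H.Qop_one_pos s p k x).ne'
  have h' := (H.mass_pos s p k).ne'
  rw [normQ, CoupledModel.h]
  field_simp

lemma H1to6.D_eq (H : H1to6 m V K) (s : Level) (p k : ℕ) {φ : X → ℝ} (hφ : IsBdd φ) (x : X) :
    m.D s p (p + k) φ x = m.h s p (p + k) x *
      (normQ m s p (p + k) φ x - ∫ z, φ z ∂(m.eta s (p + k))) := by
  rw [mul_sub, h_mul_normQ H, CoupledModel.D, CoupledModel.h, CoupledModel.Qop,
    integral_sub (hφ.integrable _) (integrable_const _), CoupledModel.Qop, CoupledModel.Qop,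
    integral_const, integral_const, smul_eq_mul, smul_eq_mul]
  ring

lemma H1to6.integral_h (H : H1to6 m V K) (s : Level) (p k : ℕ) :
    ∫ x, m.h s p (p + k) x ∂(m.eta s p) = 1 := by
  have := H.isProbabilityMeasure_eta s (p + k)
  simp only [CoupledModel.h]
  rw [integral_div, H.integral_Qop_eta s p k (isBdd_const 1)]
  simp [(H.mass_pos s p k).ne']

lemma H1to6.integral_h_mul_normQ (H : H1to6 m V K) (s : Level) (p k : ℕ) {φ : X → ℝ}
    (hφ : IsBdd φ) :
    ∫ x, m.h s p (p + k) x * normQ m s p (p + k) φ x ∂(m.eta s p)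
      = ∫ x, φ x ∂(m.eta s (p + k)) := by
  simp only [h_mul_normQ H]
  rw [integral_div, H.integral_Qop_eta s p k hφ, mul_div_cancel_left₀ _ (H.mass_pos s p k).ne']

lemma H1to6.mass_succ (H : H1to6 m V K) (s : Level) (p k : ℕ) :
    m.mass s p (p + (k + 1)) = m.mass s p (p + 1) * m.mass s (p + 1) (p + 1 + k) := by
  rw [H.mass_eq, H.mass_eq, H.mass_eq, show p + (k + 1) = p + 1 + k by ring]
  have := (H.gamma_real_pos s (p + 1)).ne'
  have := (H.gamma_real_pos s p).ne'
  field_simp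

lemma H1to6.mass_self (H : H1to6 m V K) (s : Level) (p : ℕ) : m.mass s p p = 1 := by
  have := H.mass_eq s p 0
  rw [add_zero] at this
  rw [this, div_self (H.gamma_real_pos s p).ne']

end

/-! ### Bounds on the normalised quantities, uniform in the model -/

lemma exists_eta_bounds (K : HConstants) :
    ∃ T : ℝ≥0, 1 ≤ T ∧ ∀ (X : Type u) [MeasurableSpace X] (m : CoupledModel X) (V : X → ℝ),
      H1to6 m V K → ∀ (s : Level) (p : ℕ),
        ∫⁻ x, vE V 1 x ∂(m.eta s p) ≤ T ∧ 1 ≤ T * m.eta s p (Csub V K.d0) := by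
  obtain ⟨T, hT, h⟩ := exists_gamma_vE_le.{u} K
  refine ⟨T, hT, fun X _ m V H s p => ?_⟩
  have := H.isProbabilityMeasure_eta s p
  have key : ∫⁻ x, vE V 1 x ∂(m.eta s p) ≤ T * m.eta s p (Csub V K.d0) := by
    rw [CoupledModel.eta, lintegral_smul_measure, Measure.smul_apply, smul_eq_mul, smul_eq_mul,
      mul_left_comm]
    gcongr
    exact h X m V H s p
  refine ⟨key.trans (mul_le_of_le_one_right zero_le prob_le_one), le_trans ?_ key⟩
  calc (1 : ℝ≥0∞) = ∫⁻ _, 1 ∂(m.eta s p) := by simp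
    _ ≤ _ := lintegral_mono fun x => H.one_le_vE zero_le_one x

/-- The growth of the mass over one step is bounded below. -/
lemma exists_one_le_mass_one (K : HConstants) :
    ∃ C : ℝ, 1 ≤ C ∧ ∀ (X : Type u) [MeasurableSpace X] (m : CoupledModel X) (V : X → ℝ),
      H1to6 m V K → ∀ (s : Level) (p : ℕ), 1 ≤ C * m.mass s p (p + 1) := by
  obtain ⟨T, hT, h⟩ := exists_eta_bounds.{u} K
  have hB : 1 ≤ K.keepIn := one_le_mul K.one_le_keep
    (by rw [Real.one_le_toNNReal]; exact Real.one_le_exp (by linarith [K.one_lt_d0]))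
  refine ⟨T * K.keepIn, one_le_mul_of_one_le_of_one_le (by exact_mod_cast hT)
    (by exact_mod_cast hB), fun X _ m V H s p => ?_⟩
  have hE : 1 ≤ (T * K.keepIn : ℝ≥0) * massE m s p 1 := by
    refine (h X m V H s p).2.trans ?_
    rw [ENNReal.coe_mul, mul_assoc]
    gcongr
    rw [massE, ← lintegral_const_mul _ (m.measurable_U _ _ _),
      ← lintegral_indicator_one (H.measurableSet_Csub K.d0)]
    refine lintegral_mono fun x => ?_
    by_cases hx : x ∈ Csub V K.d0
    · simp only [hx, Set.indicator_of_mem, Pi.one_apply]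
      refine (H.one_le_keep_mul s p hx).trans ?_
      rw [HConstants.keepIn, ENNReal.coe_mul]
      change _ * ENNReal.ofReal _ * _ ≤ _ * ENNReal.ofReal _ * _
      gcongr
      rw [m.U_succ]
      simp only [m.U_zero, lintegral_one]
      exact measure_mono (Set.subset_univ _)
    · simp [hx]
  rw [H.mass_eq_massE]
  have := ENNReal.toReal_mono (ENNReal.mul_ne_top ENNReal.coe_ne_top (H.massE_ne_top s p 1)) hE
  rw [ENNReal.toReal_mul] at this
  simpa using this

lemma exists_h_le (K : HConstants) {ξ : ℝ} (h0 : 0 < ξ) (h1 : ξ ≤ 1) :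
    ∃ C : ℝ, 1 ≤ C ∧ ∀ (X : Type u) [MeasurableSpace X] (m : CoupledModel X) (V : X → ℝ),
      H1to6 m V K → ∀ (s : Level) (p k : ℕ) (x : X),
        m.h s p (p + k) x ≤ C * vpow V ξ x := by
  obtain ⟨T, hT, hη⟩ := exists_eta_bounds.{u} K
  obtain ⟨R, hR, hU⟩ := exists_U_le_low.{u} K h0 h1
  refine ⟨R * T, one_le_mul_of_one_le_of_one_le (by exact_mod_cast hR) (by exact_mod_cast hT),
    fun X _ m V H s p k x => ?_⟩
  have hlow : low m V K.d0 s p k ≤ T * massE m s p k := by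
    calc low m V K.d0 s p k = 1 * low m V K.d0 s p k := (one_mul _).symm
      _ ≤ T * m.eta s p (Csub V K.d0) * low m V K.d0 s p k := by
          gcongr; exact (hη X m V H s p).2
      _ = T * ∫⁻ _ in Csub V K.d0, low m V K.d0 s p k ∂(m.eta s p) := by
          rw [setLIntegral_const]; ring
      _ ≤ T * ∫⁻ y in Csub V K.d0, m.U s p k y ∂(m.eta s p) := by
          gcongr 1
          exact setLIntegral_mono (m.measurable_U _ _ _) fun y hy => low_le s _ _ hy
      _ ≤ T * massE m s p k := by
          gcongr
          exact setLIntegral_le_lintegral _ _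
  have hE : m.U s p k x ≤ R * vE V ξ x * (T * massE m s p k) := by
    refine (hU X m V H s p k x).trans ?_
    gcongr
  rw [CoupledModel.h, div_le_iff₀ (H.mass_pos s p k), Qop_one, H.mass_eq_massE]
  rw [vE_eq] at hE
  have := ENNReal.toReal_mono (by
    refine ENNReal.mul_ne_top (ENNReal.mul_ne_top ENNReal.coe_ne_top ENNReal.ofReal_ne_top)
      (ENNReal.mul_ne_top ENNReal.coe_ne_top (H.massE_ne_top s p k))) hE
  simp only [ENNReal.toReal_mul, ENNReal.coe_toReal,
    ENNReal.toReal_ofReal (vpow_pos V ξ x).le] at this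
  linarith

lemma exists_one_le_h (K : HConstants) :
    ∃ C : ℝ, 1 ≤ C ∧ ∀ (X : Type u) [MeasurableSpace X] (m : CoupledModel X) (V : X → ℝ),
      H1to6 m V K → ∀ (s : Level) (p k : ℕ) (x : X),
        1 ≤ C * vpow V 1 x * m.h s p (p + k) x := by
  obtain ⟨T, hT, hη⟩ := exists_eta_bounds.{u} K
  obtain ⟨R, hR, hU⟩ := exists_U_le_low.{u} K one_pos le_rfl
  set C : ℝ≥0 := 1 + R * K.drift * T * K.keep with hC
  refine ⟨C, by exact_mod_cast (le_self_add : (1 : ℝ≥0) ≤ _), fun X _ m V H s p k x => ?_⟩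
  have hE : massE m s p k ≤ C * vE V 1 x * m.U s p k x := by
    have := H.isProbabilityMeasure_eta s p
    cases k with
    | zero =>
      simp only [massE, m.U_zero, lintegral_one, measure_univ, mul_one]
      have h1 : (1 : ℝ≥0∞) ≤ C := by exact_mod_cast (le_self_add : (1 : ℝ≥0) ≤ _)
      calc (1 : ℝ≥0∞) = 1 * 1 := by simp
        _ ≤ _ := by gcongr; exact H.one_le_vE zero_le_one x
    | succ k =>
      calc massE m s p (k + 1)
          ≤ ∫⁻ y, R * K.drift * vE V 1 y * low m V K.d0 s (p + 1) k ∂(m.eta s p) :=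
            lintegral_mono fun y => H.U_succ_le_low zero_le_one le_rfl (hU X m V H s (p + 1) k) y
        _ = R * K.drift * (∫⁻ y, vE V 1 y ∂(m.eta s p)) * low m V K.d0 s (p + 1) k := by
            rw [lintegral_mul_const _ ((H.measurable_vE 1).const_mul _),
              lintegral_const_mul _ (H.measurable_vE 1)]
        _ ≤ R * K.drift * T * (K.keep * vE V 1 x * m.U s p (k + 1) x) := by
            gcongr
            · exact (hη X m V H s p).1
            · exact H.low_succ_le_U s p k x
        _ = (R * K.drift * T * K.keep : ℝ≥0) * vE V 1 x * m.U s p (k + 1) x := by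
            push_cast; ring
        _ ≤ _ := by gcongr; exact le_add_self
  rw [CoupledModel.h, mul_div_assoc', le_div_iff₀ (H.mass_pos s p k), one_mul, Qop_one,
    H.mass_eq_massE]
  rw [vE_eq] at hE
  have := ENNReal.toReal_mono (by
    refine ENNReal.mul_ne_top (ENNReal.mul_ne_top ENNReal.coe_ne_top ENNReal.ofReal_ne_top)
      (m.U_lt_top s p k x).ne) hE
  simpa only [ENNReal.toReal_mul, ENNReal.coe_toReal,
    ENNReal.toReal_ofReal (vpow_pos V 1 x).le] using this

lemma exists_integral_vpow_le (K : HConstants) :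
    ∃ T : ℝ, 1 ≤ T ∧ ∀ (X : Type u) [MeasurableSpace X] (m : CoupledModel X) (V : X → ℝ),
      H1to6 m V K → ∀ (s : Level) (p : ℕ), Integrable (vpow V 1) (m.eta s p) ∧
        ∫ x, vpow V 1 x ∂(m.eta s p) ≤ T := by
  obtain ⟨T, hT, h⟩ := exists_eta_bounds.{u} K
  refine ⟨T, by exact_mod_cast hT, fun X _ m V H s p => ?_⟩
  have h1 := (h X m V H s p).1
  simp only [vE_eq] at h1
  have hm := (H.measurable_vpow 1).aestronglyMeasurable (μ := m.eta s p)
  have hn : 0 ≤ᵐ[m.eta s p] vpow V 1 := ae_of_all _ fun x => (vpow_pos V 1 x).le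
  refine ⟨⟨hm, ?_⟩, ?_⟩
  · rw [hasFiniteIntegral_iff_ofReal hn]
    exact h1.trans_lt ENNReal.coe_lt_top
  · rw [integral_eq_lintegral_of_nonneg_ae hn hm]
    exact ENNReal.toReal_le_coe_of_le_coe h1

/-! ### Stability of the normalised semigroup -/

/-- Two probability measures that dominate a common measure `τ` give close integrals to a function
with controlled oscillation. The constant `c` centres `φ` so that `|φ - c| ≤ M (1 + β W)`, and then
the parts of both integrals carried by `τ` cancel. -/
lemma integral_sub_le_of_common_minorant {X : Type u} [MeasurableSpace X] {P₁ P₂ τ : Measure X}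
    [IsProbabilityMeasure P₁] [IsProbabilityMeasure P₂] (h₁ : τ ≤ P₁) (h₂ : τ ≤ P₂)
    {W φ : X → ℝ} (hW : ∀ x, 0 ≤ W x) (hW₁ : Integrable W P₁) (hW₂ : Integrable W P₂)
    (hφ₁ : Integrable φ P₁) (hφ₂ : Integrable φ P₂) {M β α : ℝ} (hM : 0 ≤ M) (hβ : 0 ≤ β)
    (hα : α ≤ τ.real Set.univ)
    (hφ : ∀ x y, φ x - φ y ≤ M * (2 + β * W x + β * W y)) :
    ∫ x, φ x ∂P₁ - ∫ x, φ x ∂P₂ ≤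
      M * (2 - 2 * α + β * ∫ x, W x ∂P₁ + β * ∫ x, W x ∂P₂) := by
  obtain ⟨x₀⟩ : Nonempty X := by
    by_contra h
    rw [not_nonempty_iff] at h
    have := measure_univ (μ := P₁)
    simp [Measure.eq_zero_of_isEmpty P₁] at this
  have hbdd : ∀ y, ∀ x, φ x - M * (1 + β * W x) ≤ φ y + M * (1 + β * W y) := fun y x => by
    linarith [hφ x y]
  set c := ⨆ x, (φ x - M * (1 + β * W x)) with hc
  have hc₁ : ∀ x, φ x - M * (1 + β * W x) ≤ c := fun x =>
    le_ciSup (f := fun x => φ x - M * (1 + β * W x))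
      ⟨_, by rintro _ ⟨y, rfl⟩; exact hbdd x₀ y⟩ x
  have hc₂ : ∀ y, c ≤ φ y + M * (1 + β * W y) := fun y =>
    haveI : Nonempty X := ⟨x₀⟩
    ciSup_le (hbdd y)
  have hfin : IsFiniteMeasure τ := isFiniteMeasure_of_le P₁ h₁
  have hWτ : Integrable W τ := hW₁.mono_measure h₁
  have hφτ : Integrable φ τ := hφ₁.mono_measure h₁
  have i₁ : ∀ (P : Measure X) [IsFiniteMeasure P], Integrable W P → Integrable φ P →
      Integrable (fun x => M * (1 + β * W x) - (φ x - c)) P := fun P _ hw hp =>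
    (((integrable_const 1).add (hw.const_mul β)).const_mul M).sub (hp.sub (integrable_const c))
  have i₂ : ∀ (P : Measure X) [IsFiniteMeasure P], Integrable W P → Integrable φ P →
      Integrable (fun x => M * (1 + β * W x) + (φ x - c)) P := fun P _ hw hp =>
    (((integrable_const 1).add (hw.const_mul β)).const_mul M).add (hp.sub (integrable_const c))
  have e₁ : ∀ (P : Measure X) [IsFiniteMeasure P], Integrable W P → Integrable φ P →
      ∫ x, (M * (1 + β * W x) - (φ x - c)) ∂P
        = M * (P.real Set.univ + β * ∫ x, W x ∂P) - (∫ x, φ x ∂P - P.real Set.univ * c) :=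
    fun P _ hw hp => by
      have hw' : Integrable (fun x => β * W x) P := hw.const_mul β
      have hA : Integrable (fun x => M * (1 + β * W x)) P :=
        ((integrable_const 1).add hw').const_mul M
      have hB : Integrable (fun x => φ x - c) P := hp.sub (integrable_const c)
      rw [integral_sub hA hB, integral_const_mul, integral_add (integrable_const 1) hw',
        integral_const_mul, integral_sub hp (integrable_const c)]
      simp
  have e₂ : ∀ (P : Measure X) [IsFiniteMeasure P], Integrable W P → Integrable φ P →
      ∫ x, (M * (1 + β * W x) + (φ x - c)) ∂P
        = M * (P.real Set.univ + β * ∫ x, W x ∂P) + (∫ x, φ x ∂P - P.real Set.univ * c) :=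
    fun P _ hw hp => by
      have hw' : Integrable (fun x => β * W x) P := hw.const_mul β
      have hA : Integrable (fun x => M * (1 + β * W x)) P :=
        ((integrable_const 1).add hw').const_mul M
      have hB : Integrable (fun x => φ x - c) P := hp.sub (integrable_const c)
      rw [integral_add hA hB, integral_const_mul, integral_add (integrable_const 1) hw',
        integral_const_mul, integral_sub hp (integrable_const c)]
      simp
  have m₁ : ∫ x, (M * (1 + β * W x) - (φ x - c)) ∂τ
      ≤ ∫ x, (M * (1 + β * W x) - (φ x - c)) ∂P₁ :=
    integral_mono_measure h₁ (ae_of_all _ fun x => by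
      have := hc₁ x; simp only [Pi.zero_apply]; linarith) (i₁ P₁ hW₁ hφ₁)
  have m₂ : ∫ x, (M * (1 + β * W x) + (φ x - c)) ∂τ
      ≤ ∫ x, (M * (1 + β * W x) + (φ x - c)) ∂P₂ :=
    integral_mono_measure h₂ (ae_of_all _ fun x => by
      have := hc₂ x; simp only [Pi.zero_apply]; linarith) (i₂ P₂ hW₂ hφ₂)
  rw [e₁ τ hWτ hφτ, e₁ P₁ hW₁ hφ₁, probReal_univ (μ := P₁)] at m₁
  rw [e₂ τ hWτ hφτ, e₂ P₂ hW₂ hφ₂, probReal_univ (μ := P₂)] at m₂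
  have hτW : 0 ≤ M * (β * ∫ x, W x ∂τ) :=
    mul_nonneg hM (mul_nonneg hβ (integral_nonneg hW))
  have hMα := mul_le_mul_of_nonneg_left hα hM
  linarith

section

variable {X : Type u} [MeasurableSpace X] {m : CoupledModel X} {V : X → ℝ} {K : HConstants}

/-- The twisted transition: the one-step kernel reweighted by the remaining mass and normalised. It
is the Markov transition for which the normalised semigroup is a conditional expectation. -/
noncomputable def twist (m : CoupledModel X) (s : Level) (p k : ℕ) (x : X) : Measure X :=
  (m.U s p (k + 1) x)⁻¹ • (m.Q s p x).withDensity (m.U s (p + 1) k)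

lemma H1to6.isProbabilityMeasure_twist (H : H1to6 m V K) (s : Level) (p k : ℕ) (x : X) :
    IsProbabilityMeasure (twist m s p k x) := by
  refine ⟨?_⟩
  rw [twist, Measure.smul_apply, withDensity_apply _ .univ, Measure.restrict_univ, ← m.U_succ,
    smul_eq_mul]
  exact ENNReal.inv_mul_cancel (H.U_pos s p (k + 1) x).ne' (m.U_lt_top s p (k + 1) x).ne

lemma integral_twist (m : CoupledModel X) (s : Level) (p k : ℕ) (x : X) (f : X → ℝ) :
    ∫ y, f y ∂(twist m s p k x) = (m.Qop s p (p + (k + 1)) (fun _ => 1) x)⁻¹ *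
      ∫ y, m.Qop s (p + 1) (p + 1 + k) (fun _ => 1) y * f y ∂(m.Q s p x) := by
  rw [twist, integral_smul_measure, integral_withDensity_eq_integral_toReal_smul
    (m.measurable_U _ _ _) (ae_of_all _ fun y => m.U_lt_top _ _ _ y), ENNReal.toReal_inv,
    Qop_one]
  simp [Qop_one]

lemma H1to6.normQ_succ (H : H1to6 m V K) (s : Level) (p k : ℕ) {φ : X → ℝ} (hφ : IsBdd φ)
    (x : X) : normQ m s p (p + (k + 1)) φ x
      = ∫ y, normQ m s (p + 1) (p + 1 + k) φ y ∂(twist m s p k x) := by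
  rw [integral_twist, normQ, Qop_succ m s p k hφ, div_eq_inv_mul]
  congr 2
  funext y
  rw [normQ, mul_div_cancel₀ _ (H.Qop_one_pos s (p + 1) k y).ne']

lemma H1to6.integral_vpow_Q (H : H1to6 m V K) (s : Level) (p : ℕ) (x : X) {c : ℝ≥0}
    (h : ∫⁻ y, vE V 1 y ∂(m.Q s p x) ≤ c * vE V 1 x) :
    Integrable (vpow V 1) (m.Q s p x) ∧ ∫ y, vpow V 1 y ∂(m.Q s p x) ≤ c * vpow V 1 x := by
  simp only [vE_eq] at h
  have hm := (H.measurable_vpow 1).aestronglyMeasurable (μ := m.Q s p x)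
  have hn : 0 ≤ᵐ[m.Q s p x] vpow V 1 := ae_of_all _ fun x => (vpow_pos V 1 x).le
  have hfin : (c : ℝ≥0∞) * ENNReal.ofReal (vpow V 1 x) ≠ ⊤ :=
    ENNReal.mul_ne_top ENNReal.coe_ne_top ENNReal.ofReal_ne_top
  refine ⟨⟨hm, ?_⟩, ?_⟩
  · rw [hasFiniteIntegral_iff_ofReal hn]
    exact h.trans_lt hfin.lt_top
  · rw [integral_eq_lintegral_of_nonneg_ae hn hm]
    refine (ENNReal.toReal_mono hfin h).trans ?_
    rw [ENNReal.toReal_mul, ENNReal.coe_toReal, ENNReal.toReal_ofReal (vpow_pos V 1 x).le]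

/-- The Lyapunov function of the twisted transitions. -/
noncomputable def W (m : CoupledModel X) (V : X → ℝ) (s : Level) (p n : ℕ) (x : X) : ℝ :=
  vpow V 1 x / m.h s p n x

lemma H1to6.W_nonneg (H : H1to6 m V K) (s : Level) (p k : ℕ) (x : X) :
    0 ≤ W m V s p (p + k) x :=
  div_nonneg (vpow_pos V 1 x).le (H.h_pos s p k x).le

lemma H1to6.Qop_one_mul_W (H : H1to6 m V K) (s : Level) (p k : ℕ) (x : X) :
    m.Qop s p (p + k) (fun _ => 1) x * W m V s p (p + k) x
      = m.mass s p (p + k) * vpow V 1 x := by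
  have := (H.Qop_one_pos s p k x).ne'
  have := (H.mass_pos s p k).ne'
  rw [W, CoupledModel.h]
  field_simp

lemma H1to6.integral_W_twist (H : H1to6 m V K) (s : Level) (p k : ℕ) (x : X) :
    Integrable (W m V s (p + 1) (p + 1 + k)) (twist m s p k x) ∧
    ∫ y, W m V s (p + 1) (p + 1 + k) y ∂(twist m s p k x) =
      (∫ y, vpow V 1 y ∂(m.Q s p x)) / (m.mass s p (p + 1) * m.h s p (p + (k + 1)) x) := by
  constructor
  · refine Integrable.smul_measure ?_ (ENNReal.inv_ne_top.2 (H.U_pos s p (k + 1) x).ne')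
    rw [integrable_withDensity_iff_integrable_smul' (m.measurable_U _ _ _)
      (ae_of_all _ fun y => m.U_lt_top _ _ _ y)]
    have h : (fun y => (m.U s (p + 1) k y).toReal • W m V s (p + 1) (p + 1 + k) y)
        = fun y => m.mass s (p + 1) (p + 1 + k) * vpow V 1 y := by
      funext y
      rw [← Qop_one, smul_eq_mul, H.Qop_one_mul_W]
    rw [h]
    exact (H.integral_vpow_Q s p x (H.drift_le zero_le_one le_rfl s p x)).1.const_mul _
  · rw [integral_twist]
    simp only [H.Qop_one_mul_W]
    rw [integral_const_mul, CoupledModel.h, H.mass_succ s p k]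
    have := (H.mass_pos s (p + 1) k).ne'
    have := (H.mass_pos s p 1).ne'
    have := (H.Qop_one_pos s p (k + 1) x).ne'
    field_simp

end

/-- Drift of the twisted transitions. -/
lemma exists_integral_W_twist_le (K : HConstants) :
    ∃ c : ℝ, 0 ≤ c ∧ ∀ (X : Type u) [MeasurableSpace X] (m : CoupledModel X) (V : X → ℝ),
      H1to6 m V K → ∀ (s : Level) (p k : ℕ) (x : X),
        ∫ y, W m V s (p + 1) (p + 1 + k) y ∂(twist m s p k x)
          ≤ 1 / 2 * W m V s p (p + (k + 1)) x + c := by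
  obtain ⟨C₁, hC₁, hm⟩ := exists_one_le_mass_one.{u} K
  obtain ⟨C₃, hC₃, hh⟩ := exists_one_le_h.{u} K
  obtain ⟨d, hd, hsmall⟩ := K.exists_level one_pos (K.drift * C₁.toNNReal)
  have hC₁' : 0 ≤ C₁ := zero_le_one.trans hC₁
  have hC₃' : 0 ≤ C₃ := zero_le_one.trans hC₃
  refine ⟨C₁ * K.drift * Real.exp d * (C₃ * Real.exp d), by positivity,
    fun X _ m V H s p k x => ?_⟩
  rw [(H.integral_W_twist s p k x).2]
  have hpos := H.mass_pos s p 1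
  have hhp := H.h_pos s p (k + 1) x
  have hv := vpow_pos V 1 x
  have hI0 : 0 ≤ ∫ y, vpow V 1 y ∂(m.Q s p x) := integral_nonneg fun y => (vpow_pos V 1 y).le
  have hstep : (∫ y, vpow V 1 y ∂(m.Q s p x)) / (m.mass s p (p + 1) * m.h s p (p + (k + 1)) x)
      ≤ C₁ * (∫ y, vpow V 1 y ∂(m.Q s p x)) / m.h s p (p + (k + 1)) x := by
    rw [div_le_div_iff₀ (mul_pos hpos hhp) hhp]
    have := mul_le_mul_of_nonneg_left (hm X m V H s p) (mul_nonneg hI0 hhp.le)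
    linarith
  refine hstep.trans ?_
  by_cases hx : x ∈ Csub V d
  · refine le_add_of_nonneg_of_le (mul_nonneg (by norm_num) (H.W_nonneg s p (k + 1) x)) ?_
    have hI := (H.integral_vpow_Q s p x (H.drift_le zero_le_one le_rfl s p x)).2
    have hvx : vpow V 1 x ≤ Real.exp d := by
      rw [vpow_eq, one_mul]; exact Real.exp_le_exp.2 hx
    rw [div_le_iff₀ hhp]
    calc C₁ * ∫ y, vpow V 1 y ∂(m.Q s p x) ≤ C₁ * (K.drift * Real.exp d) * 1 := by
          rw [mul_one]
          gcongr
          exact hI.trans (by gcongr)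
      _ ≤ C₁ * (K.drift * Real.exp d) * (C₃ * vpow V 1 x * m.h s p (p + (k + 1)) x) := by
          gcongr
          exact hh X m V H s p (k + 1) x
      _ ≤ C₁ * (K.drift * Real.exp d) * (C₃ * Real.exp d * m.h s p (p + (k + 1)) x) := by
          gcongr
      _ = _ := by ring
  · refine le_add_of_le_of_nonneg ?_ (by positivity)
    have hI := (H.integral_vpow_Q s p x (H.drift_off zero_le_one le_rfl s p hx)).2
    have hsm : C₁ * (K.drift * Real.exp (-(1 * K.δ * d))) ≤ 1 / 2 := by
      rw [← NNReal.coe_le_coe] at hsmall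
      push_cast at hsmall
      rw [Real.coe_toNNReal _ hC₁', Real.coe_toNNReal _ (Real.exp_nonneg _)] at hsmall
      linarith
    rw [W, mul_div_assoc']
    refine div_le_div_of_nonneg_right ?_ hhp.le
    calc C₁ * ∫ y, vpow V 1 y ∂(m.Q s p x)
        ≤ C₁ * ((K.drift * (Real.exp (-(1 * K.δ * d))).toNNReal : ℝ≥0) * vpow V 1 x) := by
          gcongr
      _ = C₁ * (K.drift * Real.exp (-(1 * K.δ * d))) * vpow V 1 x := by
          rw [NNReal.coe_mul, Real.coe_toNNReal _ (Real.exp_nonneg _)]; ring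
      _ ≤ _ := by gcongr

/-- The twisted transitions from the points of a sublevel set have a common minorant, of mass
bounded below uniformly. -/
lemma exists_minorant_twist (K : HConstants) {d : ℝ} (hd : K.d0 ≤ d) :
    ∃ α : ℝ, 0 < α ∧ ∀ (X : Type u) [MeasurableSpace X] (m : CoupledModel X) (V : X → ℝ),
      H1to6 m V K → ∀ (s : Level) (p k : ℕ),
        ∃ τ : Measure X, α ≤ τ.real Set.univ ∧ ∀ x ∈ Csub V d, τ ≤ twist m s p k x := by
  obtain ⟨R, hR, hU⟩ := exists_U_le_low.{u} K one_pos le_rfl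
  set A : ℝ≥0 := 1 + K.ratio d * R * (Real.exp d).toNNReal with hA
  set A' : ℝ≥0 := 1 + R * K.drift * (Real.exp K.d0).toNNReal * K.keepIn with hA'
  have hA1 : 1 ≤ A := le_self_add
  have hA1' : 1 ≤ A' := le_self_add
  have hA0 : 0 < (A : ℝ) := by exact_mod_cast zero_lt_one.trans_le hA1
  have hA0' : 0 < (A' : ℝ) := by exact_mod_cast zero_lt_one.trans_le hA1'
  refine ⟨(A : ℝ)⁻¹ * (A' : ℝ)⁻¹, by positivity, fun X _ m V H s p k => ?_⟩
  obtain ⟨x₀, hx₀⟩ := H.nonempty_Csub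
  have hx₀d : x₀ ∈ Csub V d := le_trans (show V x₀ ≤ K.d0 from hx₀) hd
  have hP₀ := H.isProbabilityMeasure_twist s p k x₀
  have hU0 := (H.U_pos s p (k + 1) x₀).ne'
  have hUt := (m.U_lt_top s p (k + 1) x₀).ne
  have htw : ∀ x B, MeasurableSet B → twist m s p k x B
      = (m.U s p (k + 1) x)⁻¹ * ∫⁻ y in B, m.U s (p + 1) k y ∂(m.Q s p x) := fun x B hB => by
    rw [twist, Measure.smul_apply, withDensity_apply _ hB, smul_eq_mul]
  refine ⟨(A : ℝ≥0∞)⁻¹ • (twist m s p k x₀).restrict (Csub V d), ?_, fun x hx => ?_⟩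
  · have h1 : (A' : ℝ≥0∞)⁻¹ ≤ twist m s p k x₀ (Csub V d) := by
      have hC0 : m.U s p (k + 1) x₀ ≤
          A' * ∫⁻ y in Csub V d, m.U s (p + 1) k y ∂(m.Q s p x₀) := by
        calc m.U s p (k + 1) x₀
            ≤ R * K.drift * vE V 1 x₀ * low m V K.d0 s (p + 1) k :=
              H.U_succ_le_low zero_le_one le_rfl (hU X m V H s (p + 1) k) x₀
          _ ≤ R * K.drift * (Real.exp K.d0).toNNReal * (1 * low m V K.d0 s (p + 1) k) := by
              rw [one_mul]
              gcongr
              rw [vE, one_mul]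
              exact ENNReal.ofReal_le_ofReal (Real.exp_le_exp.2 hx₀)
          _ ≤ R * K.drift * (Real.exp K.d0).toNNReal *
                ((K.keepIn * m.Q s p x₀ (Csub V K.d0)) * low m V K.d0 s (p + 1) k) := by
              gcongr
              have := H.one_le_keep_mul s p hx₀
              rwa [HConstants.keepIn, ENNReal.coe_mul]
          _ = (R * K.drift * (Real.exp K.d0).toNNReal * K.keepIn : ℝ≥0) *
                ∫⁻ _ in Csub V K.d0, low m V K.d0 s (p + 1) k ∂(m.Q s p x₀) := by
              rw [setLIntegral_const]; push_cast; ring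
          _ ≤ (R * K.drift * (Real.exp K.d0).toNNReal * K.keepIn : ℝ≥0) *
                ∫⁻ y in Csub V K.d0, m.U s (p + 1) k y ∂(m.Q s p x₀) := by
              gcongr 1
              exact setLIntegral_mono (m.measurable_U _ _ _) fun y hy => low_le s _ _ hy
          _ ≤ _ := by
              gcongr
              · exact le_add_self
              · exact fun y hy => le_trans (show V y ≤ K.d0 from hy) hd
      rw [htw x₀ _ (H.measurableSet_Csub d), ENNReal.inv_le_iff_le_mul
        (fun _ => by exact_mod_cast (zero_lt_one.trans_le hA1').ne')
        (fun h => absurd h ENNReal.coe_ne_top), mul_left_comm, mul_comm, ← div_eq_mul_inv,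
        ENNReal.le_div_iff_mul_le (Or.inl hU0) (Or.inl hUt), one_mul]
      exact hC0
    rw [measureReal_def, Measure.smul_apply, Measure.restrict_apply_univ, smul_eq_mul,
      ENNReal.toReal_mul, ENNReal.toReal_inv, ENNReal.coe_toReal]
    gcongr
    have := ENNReal.toReal_mono (measure_ne_top _ _) h1
    rwa [ENNReal.toReal_inv, ENNReal.coe_toReal] at this
  · refine Measure.le_iff.2 fun B hB => ?_
    have hBC := hB.inter (H.measurableSet_Csub d)
    have hAne : (A : ℝ≥0∞) ≠ 0 := by exact_mod_cast (zero_lt_one.trans_le hA1).ne'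
    have hUx0 := (H.U_pos s p (k + 1) x).ne'
    have hUxt := (m.U_lt_top s p (k + 1) x).ne
    rw [Measure.smul_apply, Measure.restrict_apply hB, smul_eq_mul,
      ENNReal.inv_mul_le_iff hAne ENNReal.coe_ne_top, htw _ _ hBC, htw _ _ hB]
    have hint : ∫⁻ y in B ∩ Csub V d, m.U s (p + 1) k y ∂(m.Q s p x₀) ≤
        K.ratio d * ∫⁻ y in B, m.U s (p + 1) k y ∂(m.Q s p x) := by
      have hle := H.restrict_le s p (K.dmin_lt_d0.le.trans hd) hx₀d hx
      calc ∫⁻ y in B ∩ Csub V d, m.U s (p + 1) k y ∂(m.Q s p x₀)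
          = ∫⁻ y in B, m.U s (p + 1) k y ∂((m.Q s p x₀).restrict (Csub V d)) := by
            rw [Measure.restrict_restrict hB]
        _ ≤ ∫⁻ y in B, m.U s (p + 1) k y
              ∂((K.ratio d : ℝ≥0∞) • (m.Q s p x).restrict (Csub V d)) :=
            lintegral_mono' (Measure.restrict_mono le_rfl hle) le_rfl
        _ = K.ratio d * ∫⁻ y in B ∩ Csub V d, m.U s (p + 1) k y ∂(m.Q s p x) := by
            rw [Measure.restrict_smul, lintegral_smul_measure, smul_eq_mul,
              Measure.restrict_restrict hB]
        _ ≤ _ := by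
            gcongr
            exact Set.inter_subset_left
    have hUU : m.U s p (k + 1) x ≤ R * (Real.exp d).toNNReal * m.U s p (k + 1) x₀ := by
      refine (hU X m V H s p (k + 1) x).trans ?_
      gcongr
      · rw [vE, one_mul]
        exact ENNReal.ofReal_le_ofReal (Real.exp_le_exp.2 hx)
      · exact low_le s _ _ hx₀
    rw [ENNReal.inv_mul_le_iff hU0 hUt]
    set I := ∫⁻ y in B, m.U s (p + 1) k y ∂(m.Q s p x)
    calc _ ≤ K.ratio d * I := hint
      _ = K.ratio d * ((m.U s p (k + 1) x)⁻¹ * m.U s p (k + 1) x * I) := by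
          rw [ENNReal.inv_mul_cancel hUx0 hUxt, one_mul]
      _ ≤ K.ratio d * ((m.U s p (k + 1) x)⁻¹ *
            (R * (Real.exp d).toNNReal * m.U s p (k + 1) x₀) * I) := by gcongr
      _ = m.U s p (k + 1) x₀ * ((K.ratio d * R * (Real.exp d).toNNReal : ℝ≥0) *
            ((m.U s p (k + 1) x)⁻¹ * I)) := by push_cast; ring
      _ ≤ _ := by gcongr; exact le_add_self

/-- The contraction of Harris type for the normalised semigroup. Either both starting points lie in
a sublevel set, where the common minorant contracts, or the Lyapunov function is large at one of
them and its drift contracts. -/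
lemma exists_contraction (K : HConstants) :
    ∃ β ρ : ℝ, 0 < β ∧ 0 < ρ ∧ ρ < 1 ∧
      ∀ (X : Type u) [MeasurableSpace X] (m : CoupledModel X) (V : X → ℝ),
      H1to6 m V K → ∀ (s : Level) (φ : X → ℝ), IsBdd φ → ∀ (k p : ℕ) (x y : X),
        normQ m s p (p + k) φ x - normQ m s p (p + k) φ y ≤
          supNorm φ * ρ ^ k * (2 + β * W m V s p (p + k) x + β * W m V s p (p + k) y) := by
  obtain ⟨c, hc, hdrift⟩ := exists_integral_W_twist_le.{u} K
  obtain ⟨C₂, hC₂, hh⟩ := exists_h_le.{u} K (ξ := 1 / 2) (by norm_num) (by norm_num)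
  -- If `W x + W y ≥ 8 c + 8`, a quarter of `W x + W y` absorbs the `2 c` of the drift, and a further
  -- part of it contracts the constant `2`.
  set R₀ : ℝ := 8 * c + 8 with hR₀
  set d : ℝ := max K.d0 (2 * Real.log (R₀ * C₂)) with hd
  obtain ⟨α₀, hα₀, hmin⟩ := exists_minorant_twist.{u} K (le_max_left _ _ : K.d0 ≤ d)
  -- With this weight the common minorant outweighs the additive constant of the drift.
  set β : ℝ := α₀ / (2 * c + 1) with hβ
  have hβ0 : 0 < β := by positivity
  have hβc : 2 * β * c ≤ α₀ := by
    rw [hβ, mul_div_assoc', div_mul_eq_mul_div, div_le_iff₀ (by positivity)]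
    nlinarith
  set ε : ℝ := min (1 / 8) (min (β / 2) (α₀ / 2)) with hε
  have hε0 : 0 < ε := by positivity
  have hε1 : ε ≤ 1 / 8 := min_le_left _ _
  have hε2 : ε ≤ β / 2 := (min_le_right _ _).trans (min_le_left _ _)
  have hε3 : ε ≤ α₀ / 2 := (min_le_right _ _).trans (min_le_right _ _)
  refine ⟨β, 1 - ε, hβ0, by linarith, by linarith, fun X _ m V H s φ hφ k => ?_⟩
  induction k with
  | zero =>
    intro p x y
    have h1 := abs_le.1 (H.abs_normQ_le s p 0 hφ.le_supNorm x)
    have h2 := abs_le.1 (H.abs_normQ_le s p 0 hφ.le_supNorm y)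
    have h3 := mul_nonneg (supNorm_nonneg φ) (mul_nonneg hβ0.le (H.W_nonneg s p 0 x))
    have h4 := mul_nonneg (supNorm_nonneg φ) (mul_nonneg hβ0.le (H.W_nonneg s p 0 y))
    rw [pow_zero]
    linarith [h1.1, h1.2, h2.1, h2.2]
  | succ k ih =>
    intro p x y
    have hx := H.isProbabilityMeasure_twist s p k x
    have hy := H.isProbabilityMeasure_twist s p k y
    set Wx := W m V s p (p + (k + 1)) x with hWx
    set Wy := W m V s p (p + (k + 1)) y with hWy
    have hWx0 : 0 ≤ Wx := H.W_nonneg s p (k + 1) x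
    have hWy0 : 0 ≤ Wy := H.W_nonneg s p (k + 1) y
    have hM : 0 ≤ supNorm φ * (1 - ε) ^ k :=
      mul_nonneg (supNorm_nonneg φ) (pow_nonneg (by linarith) k)
    have hbd : IsBdd (normQ m s (p + 1) (p + 1 + k) φ) :=
      ⟨measurable_normQ m s _ _ hφ.1, supNorm φ, H.abs_normQ_le s (p + 1) k hφ.le_supNorm⟩
    have hdx := hdrift X m V H s p k x
    have hdy := hdrift X m V H s p k y
    have key : ∀ (τ : Measure X) (α : ℝ), τ ≤ twist m s p k x → τ ≤ twist m s p k y →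
        α ≤ τ.real Set.univ →
        normQ m s p (p + (k + 1)) φ x - normQ m s p (p + (k + 1)) φ y ≤
          supNorm φ * (1 - ε) ^ k *
            (2 - 2 * α + β * (1 / 2 * Wx + c) + β * (1 / 2 * Wy + c)) := by
      intro τ α hτx hτy hα
      rw [H.normQ_succ s p k hφ, H.normQ_succ s p k hφ]
      refine (integral_sub_le_of_common_minorant hτx hτy (H.W_nonneg s (p + 1) k)
        (H.integral_W_twist s p k x).1 (H.integral_W_twist s p k y).1
        (hbd.integrable _) (hbd.integrable _) hM hβ0.le hα (ih (p + 1))).trans ?_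
      gcongr
    have hfin : supNorm φ * (1 - ε) ^ (k + 1) * (2 + β * Wx + β * Wy) =
        supNorm φ * (1 - ε) ^ k * ((1 - ε) * (2 + β * Wx + β * Wy)) := by ring
    rw [hfin]
    have hβx := mul_nonneg hβ0.le hWx0
    have hβy := mul_nonneg hβ0.le hWy0
    have hC₂' : 0 < C₂ := zero_lt_one.trans_le hC₂
    have hsub : ∀ z, W m V s p (p + (k + 1)) z ≤ R₀ → z ∈ Csub V d := by
      intro z hz
      rw [W, div_le_iff₀ (H.h_pos s p (k + 1) z)] at hz
      have h1 := hz.trans (mul_le_mul_of_nonneg_left (hh X m V H s p (k + 1) z)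
        (by positivity : (0 : ℝ) ≤ R₀))
      have h2 : vpow V 1 z = vpow V (1 / 2) z * vpow V (1 / 2) z := by
        rw [← vpow_add]; norm_num
      rw [h2, ← mul_assoc] at h1
      have h3 := le_of_mul_le_mul_right h1 (vpow_pos V _ z)
      rw [vpow_eq, ← Real.le_log_iff_exp_le (by positivity)] at h3
      have h4 : V z ≤ 2 * Real.log (R₀ * C₂) := by linarith
      exact h4.trans (le_max_right _ _)
    by_cases hcase : Wx ≤ R₀ ∧ Wy ≤ R₀
    · obtain ⟨τ, hτα, hτ⟩ := hmin X m V H s p k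
      refine (key τ α₀ (hτ x (hsub x hcase.1)) (hτ y (hsub y hcase.2)) hτα).trans ?_
      refine mul_le_mul_of_nonneg_left ?_ hM
      have h1 : ε * (β * Wx) ≤ 1 / 8 * (β * Wx) := mul_le_mul_of_nonneg_right hε1 hβx
      have h2 : ε * (β * Wy) ≤ 1 / 8 * (β * Wy) := mul_le_mul_of_nonneg_right hε1 hβy
      nlinarith
    · have hS : R₀ ≤ Wx + Wy := by
        by_contra hlt
        exact hcase ⟨by linarith, by linarith⟩
      refine (key 0 0 (Measure.zero_le _) (Measure.zero_le _) (by simp)).trans ?_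
      refine mul_le_mul_of_nonneg_left ?_ hM
      have h1 : ε * (β * (Wx + Wy)) ≤ 1 / 8 * (β * (Wx + Wy)) :=
        mul_le_mul_of_nonneg_right hε1 (mul_nonneg hβ0.le (by linarith))
      have h2 : β * R₀ ≤ β * (Wx + Wy) := mul_le_mul_of_nonneg_left hS hβ0.le
      rw [hR₀] at h2
      nlinarith

/-- A quantity below both `A` and `A r` is below `A r ^ θ`. -/
lemma le_mul_rpow_of_le {a A r θ : ℝ} (hA : 0 ≤ A) (hr : 0 ≤ r) (h0 : 0 ≤ θ) (h1 : θ ≤ 1)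
    (ha : a ≤ A) (ha' : a ≤ A * r) : a ≤ A * r ^ θ := by
  rcases le_total r 1 with h | h
  · refine ha'.trans (mul_le_mul_of_nonneg_left ?_ hA)
    rcases hr.eq_or_lt with h' | h'
    · rw [← h']; exact Real.rpow_nonneg le_rfl _
    · calc r = r ^ (1 : ℝ) := (Real.rpow_one r).symm
        _ ≤ r ^ θ := Real.rpow_le_rpow_of_exponent_ge h' h h1
  · refine ha.trans (le_mul_of_one_le_right hA (Real.one_le_rpow h h0))

/-- The normalised semigroup forgets its starting point geometrically fast. -/
lemma exists_abs_normQ_sub_le (K : HConstants) {ξ : ℝ} (h0 : 0 < ξ) (h1 : ξ ≤ 1) :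
    ∃ ρ C : ℝ, 0 < ρ ∧ ρ < 1 ∧ 1 ≤ C ∧
      ∀ (X : Type u) [MeasurableSpace X] (m : CoupledModel X) (V : X → ℝ),
      H1to6 m V K → ∀ (s : Level) (φ : X → ℝ), IsBdd φ → ∀ (p k : ℕ) (x : X),
        |normQ m s p (p + k) φ x - ∫ z, φ z ∂(m.eta s (p + k))| ≤
          C * supNorm φ * ρ ^ k * vpow V ξ x := by
  obtain ⟨β, ρ, hβ, hρ0, hρ1, hcon⟩ := exists_contraction.{u} K
  obtain ⟨T, hT, hη⟩ := exists_integral_vpow_le.{u} K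
  obtain ⟨C₃, hC₃, hh⟩ := exists_one_le_h.{u} K
  set C : ℝ := 2 + β * C₃ + β * T with hC
  have hC1 : 2 ≤ C := by
    have : 0 ≤ β * C₃ := by positivity
    have : 0 ≤ β * T := by positivity
    linarith
  refine ⟨ρ ^ (ξ / 2), C, Real.rpow_pos_of_pos hρ0 _, Real.rpow_lt_one hρ0.le hρ1 (by positivity),
    by linarith, fun X _ m V H s φ hφ p k x => ?_⟩
  have := H.isProbabilityMeasure_eta s p
  have := H.isProbabilityMeasure_eta s (p + k)
  have hN := supNorm_nonneg φ
  have hv := vpow_pos V 1 x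
  have hv1 := H.one_le_vpow zero_le_one x
  set F := normQ m s p (p + k) φ with hF
  have hFb : ∀ y, |F y| ≤ supNorm φ := H.abs_normQ_le s p k hφ.le_supNorm
  have hint_h : Integrable (m.h s p (p + k)) (m.eta s p) := by
    by_contra hni
    have := H.integral_h s p k
    rw [integral_undef hni] at this
    exact zero_ne_one this
  have hint_hF : Integrable (fun y => m.h s p (p + k) y * F y) (m.eta s p) :=
    hint_h.mul_bdd (c := supNorm φ) (measurable_normQ m s _ _ hφ.1).aestronglyMeasurable
      (ae_of_all _ hFb)
  -- The predictor at time `p + k` is the average of the normalised semigroup.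
  have hrep : F x - ∫ z, φ z ∂(m.eta s (p + k))
      = ∫ y, m.h s p (p + k) y * (F x - F y) ∂(m.eta s p) := by
    rw [← H.integral_h_mul_normQ s p k hφ]
    simp only [mul_sub]
    rw [integral_sub (hint_h.mul_const _) hint_hF, integral_mul_const, H.integral_h, one_mul]
  have hbig : |F x - ∫ z, φ z ∂(m.eta s (p + k))| ≤
      supNorm φ * ρ ^ k * (2 + β * W m V s p (p + k) x + β * T) := by
    rw [hrep]
    have hint : Integrable (fun y => supNorm φ * ρ ^ k *
        ((2 + β * W m V s p (p + k) x) * m.h s p (p + k) y + β * vpow V 1 y)) (m.eta s p) :=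
      ((hint_h.const_mul _).add ((hη X m V H s p).1.const_mul _)).const_mul _
    have hle := norm_integral_le_of_norm_le (f := fun y => m.h s p (p + k) y * (F x - F y)) hint
      (ae_of_all _ fun y => ?_)
    · rw [integral_const_mul, integral_add (hint_h.const_mul _)
        ((hη X m V H s p).1.const_mul _), integral_const_mul, integral_const_mul,
        H.integral_h, mul_one] at hle
      refine hle.trans ?_
      gcongr
      exact (hη X m V H s p).2
    · have hhy := H.h_pos s p k y
      have hxy := hcon X m V H s φ hφ k p x y
      have hyx := hcon X m V H s φ hφ k p y x
      have habs : |F x - F y| ≤ supNorm φ * ρ ^ k *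
          (2 + β * W m V s p (p + k) x + β * W m V s p (p + k) y) := by
        rw [abs_le]
        constructor <;> linarith
      have hWh : m.h s p (p + k) y * W m V s p (p + k) y = vpow V 1 y := by
        rw [W, mul_div_cancel₀ _ hhy.ne']
      rw [Real.norm_eq_abs, abs_mul, abs_of_pos hhy]
      refine (mul_le_mul_of_nonneg_left habs hhy.le).trans (le_of_eq ?_)
      rw [← hWh]
      ring
  have hWle : W m V s p (p + k) x ≤ C₃ * vpow V 2 x := by
    rw [W, div_le_iff₀ (H.h_pos s p k x), show (2 : ℝ) = 1 + 1 by norm_num, vpow_add]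
    have := mul_le_mul_of_nonneg_left (hh X m V H s p k x) hv.le
    linarith
  have hv2 := H.one_le_vpow (a := 2) (by norm_num) x
  have hb1 : |F x - ∫ z, φ z ∂(m.eta s (p + k))| ≤ C * supNorm φ := by
    have hI : |∫ z, φ z ∂(m.eta s (p + k))| ≤ supNorm φ := by
      have := norm_integral_le_of_norm_le_const (μ := m.eta s (p + k)) (f := φ)
        (ae_of_all _ hφ.le_supNorm)
      simpa using this
    calc _ ≤ |F x| + |∫ z, φ z ∂(m.eta s (p + k))| := abs_sub _ _
      _ ≤ 2 * supNorm φ := by linarith [hFb x]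
      _ ≤ _ := by gcongr
  have hb2 : |F x - ∫ z, φ z ∂(m.eta s (p + k))| ≤ C * supNorm φ * (ρ ^ k * vpow V 2 x) := by
    refine hbig.trans ?_
    have : 2 + β * W m V s p (p + k) x + β * T ≤ C * vpow V 2 x := by
      have e1 := mul_le_mul_of_nonneg_left hWle hβ.le
      have e2 : β * T * 1 ≤ β * T * vpow V 2 x := by gcongr
      rw [hC]
      linarith
    calc _ ≤ supNorm φ * ρ ^ k * (C * vpow V 2 x) := by gcongr
      _ = _ := by ring
  have := le_mul_rpow_of_le (θ := ξ / 2) (by positivity)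
    (mul_nonneg (by positivity) (vpow_pos V 2 x).le) (by positivity) (by linarith) hb1 hb2
  refine this.trans (le_of_eq ?_)
  rw [Real.mul_rpow (by positivity) (vpow_pos V 2 x).le, ← Real.rpow_natCast, ← Real.rpow_mul hρ0.le,
    mul_comm (k : ℝ), Real.rpow_mul hρ0.le, Real.rpow_natCast]
  have : vpow V 2 x ^ (ξ / 2) = vpow V ξ x := by
    rw [vpow_eq, vpow_eq, ← Real.exp_mul]; ring_nf
  rw [this]
  ring

/-- Geometric decay of the centred normalised semigroup. -/
lemma exists_abs_D_le (K : HConstants) {ξ : ℝ} (h0 : 0 < ξ) (h1 : ξ ≤ 1) :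
    ∃ ρ C : ℝ, 0 < ρ ∧ ρ < 1 ∧ 1 ≤ C ∧
      ∀ (X : Type u) [MeasurableSpace X] (m : CoupledModel X) (V : X → ℝ),
      H1to6 m V K → ∀ (s : Level) (φ : X → ℝ), IsBdd φ → ∀ (p k : ℕ) (x : X),
        |m.D s p (p + k) φ x| ≤ C * supNorm φ * ρ ^ k * vpow V ξ x := by
  obtain ⟨ρ, C, hρ0, hρ1, hC, hF⟩ := exists_abs_normQ_sub_le.{u} K (ξ := ξ / 2) (by positivity)
    (by linarith)
  obtain ⟨C', hC', hh⟩ := exists_h_le.{u} K (ξ := ξ / 2) (by positivity) (by linarith)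
  refine ⟨ρ, C' * C, hρ0, hρ1, one_le_mul_of_one_le_of_one_le hC' hC,
    fun X _ m V H s φ hφ p k x => ?_⟩
  rw [H.D_eq s p k hφ, abs_mul, abs_of_pos (H.h_pos s p k x)]
  refine (mul_le_mul (hh X m V H s p k x) (hF X m V H s φ hφ p k x) (abs_nonneg _)
    (mul_nonneg (by linarith) (vpow_pos V _ x).le)).trans (le_of_eq ?_)
  rw [show vpow V ξ x = vpow V (ξ / 2) x * vpow V (ξ / 2) x by
    rw [← vpow_add]; congr 1; ring]
  ring

/-! ### Marginals of the limiting pair laws -/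

/-- `κ` is a coupling of the two predictors at time `n`. -/
structure IsPairLaw {X : Type u} [MeasurableSpace X] (m : CoupledModel X) (n : ℕ)
    (κ : Measure (X × X)) : Prop where
  fst : κ.map Prod.fst = m.eta .f n
  snd : κ.map Prod.snd = m.eta .c n

section

variable {X : Type u} [MeasurableSpace X] {m : CoupledModel X} {V : X → ℝ} {K : HConstants}

lemma massE_one (m : CoupledModel X) (s : Level) (n : ℕ) :
    massE m s n 1 = ∫⁻ x, (m.G n x : ℝ≥0∞) ∂(m.eta s n) := by
  rw [massE]
  refine lintegral_congr fun x => ?_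
  rw [m.U_succ]
  simp [m.U_zero, m.Q_univ]

lemma H1to6.lintegral_G_ne_zero (H : H1to6 m V K) (s : Level) (n : ℕ) :
    ∫⁻ x, (m.G n x : ℝ≥0∞) ∂(m.eta s n) ≠ 0 := by
  rw [← massE_one, H.massE_eq]
  exact mul_ne_zero (ENNReal.inv_ne_zero.2 (measure_ne_top _ _)) (H.gamma_univ_ne_zero _ _)

lemma H1to6.lintegral_G_ne_top (H : H1to6 m V K) (s : Level) (n : ℕ) :
    ∫⁻ x, (m.G n x : ℝ≥0∞) ∂(m.eta s n) ≠ ⊤ := by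
  rw [← massE_one]
  exact H.massE_ne_top _ _ _

lemma measurable_G_coe (m : CoupledModel X) (n : ℕ) : Measurable fun x => (m.G n x : ℝ≥0∞) :=
  (m.measurable_G n).coe_nnreal_ennreal

lemma H1to6.isProbabilityMeasure_etaBar (H : H1to6 m V K) (s : Level) (n : ℕ) :
    IsProbabilityMeasure (m.etaBar s n) := by
  refine ⟨?_⟩
  rw [CoupledModel.etaBar, Measure.smul_apply, withDensity_apply _ .univ, Measure.restrict_univ,
    smul_eq_mul, ENNReal.inv_mul_cancel (H.lintegral_G_ne_zero s n) (H.lintegral_G_ne_top s n)]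

lemma withDensity_bind_M (m : CoupledModel X) (s : Level) (n : ℕ) (μ : Measure X) :
    (μ.withDensity fun x => (m.G n x : ℝ≥0∞)).bind (m.M s n) = μ.bind (m.Q s n) := by
  ext B hB
  rw [Measure.bind_apply hB (Kernel.aemeasurable _), Measure.bind_apply hB (Kernel.aemeasurable _),
    lintegral_withDensity_eq_lintegral_mul _ (measurable_G_coe m n) (Kernel.measurable_coe _ hB)]
  refine lintegral_congr fun x => ?_
  rw [m.Q_apply]
  rfl

lemma H1to6.eta_succ_eq_bind (H : H1to6 m V K) (s : Level) (n : ℕ) :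
    m.eta s (n + 1) = (m.etaBar s n).bind (m.M s n) := by
  rw [H.eta_succ, massE_one, CoupledModel.etaBar, Measure.comp_smul, withDensity_bind_M]

lemma map_fst_bind_cM (m : CoupledModel X) (n : ℕ) (ω : Measure (X × X)) :
    (ω.bind (m.cM n)).map Prod.fst = (ω.map Prod.fst).bind (m.M .f n) := by
  ext B hB
  rw [Measure.map_apply measurable_fst hB,
    Measure.bind_apply (measurable_fst hB) (Kernel.aemeasurable _),
    Measure.bind_apply hB (Kernel.aemeasurable _),
    lintegral_map (Kernel.measurable_coe _ hB) measurable_fst]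
  refine lintegral_congr fun z => ?_
  rw [← m.cM_fst n z, Measure.map_apply measurable_fst hB]

lemma map_snd_bind_cM (m : CoupledModel X) (n : ℕ) (ω : Measure (X × X)) :
    (ω.bind (m.cM n)).map Prod.snd = (ω.map Prod.snd).bind (m.M .c n) := by
  ext B hB
  rw [Measure.map_apply measurable_snd hB,
    Measure.bind_apply (measurable_snd hB) (Kernel.aemeasurable _),
    Measure.bind_apply hB (Kernel.aemeasurable _),
    lintegral_map (Kernel.measurable_coe _ hB) measurable_snd]
  refine lintegral_congr fun z => ?_
  rw [← m.cM_snd n z, Measure.map_apply measurable_snd hB]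

/-- Any coupling of the two filters, followed by the coupled transition, gives a coupling of the
two predictors. -/
lemma H1to6.isPairLaw_bind (H : H1to6 m V K) {n : ℕ} {ω : Measure (X × X)}
    (h₁ : ω.map Prod.fst = m.etaBar .f n) (h₂ : ω.map Prod.snd = m.etaBar .c n) :
    IsPairLaw m (n + 1) (ω.bind (m.cM n)) :=
  ⟨by rw [map_fst_bind_cM, h₁, H.eta_succ_eq_bind],
    by rw [map_snd_bind_cM, h₂, H.eta_succ_eq_bind]⟩

lemma eta_zero (m : CoupledModel X) (s : Level) : m.eta s 0 = m.init s := by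
  rw [CoupledModel.eta, m.gamma_zero, measure_univ, inv_one, one_smul]

lemma isPairLaw_cinit (m : CoupledModel X) : IsPairLaw m 0 m.cinit :=
  ⟨by rw [m.cinit_fst, eta_zero], by rw [m.cinit_snd, eta_zero]⟩

lemma H1to6.isPairLaw_couplingI (H : H1to6 m V K) (n : ℕ) : IsPairLaw m n (m.couplingI n) := by
  cases n with
  | zero => exact isPairLaw_cinit m
  | succ n =>
    have := H.isProbabilityMeasure_eta .f n
    have := H.isProbabilityMeasure_eta .c n
    have hG := measurable_G_coe m n
    have hf0 := H.lintegral_G_ne_zero .f n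
    have hc0 := H.lintegral_G_ne_zero .c n
    have hft := H.lintegral_G_ne_top .f n
    have hct := H.lintegral_G_ne_top .c n
    rw [CoupledModel.couplingI, CoupledModel.PhiI, ← Measure.comp_smul,
      lintegral_prod_mul hG.aemeasurable hG.aemeasurable, ← prod_withDensity hG hG]
    apply H.isPairLaw_bind
    · rw [Measure.map_smul, Measure.map_fst_prod, withDensity_apply _ .univ,
        Measure.restrict_univ, smul_smul, CoupledModel.etaBar,
        ENNReal.mul_inv (Or.inl hf0) (Or.inl hft), mul_assoc, ENNReal.inv_mul_cancel hc0 hct,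
        mul_one]
    · rw [Measure.map_smul, Measure.map_snd_prod, withDensity_apply _ .univ,
        Measure.restrict_univ, smul_smul, CoupledModel.etaBar,
        ENNReal.mul_inv (Or.inl hf0) (Or.inl hft), mul_comm (∫⁻ x, _ ∂(m.eta .f n))⁻¹, mul_assoc,
        ENNReal.inv_mul_cancel hf0 hft, mul_one]

end

section

variable {Y : Type u} [MeasurableSpace Y] {μ : Measure Y} {p q : Y → ℝ≥0∞}

lemma lintegral_sub_min (hp : Measurable p) (hq : Measurable q) (hp1 : ∫⁻ y, p y ∂μ = 1) :
    ∫⁻ y, (p y - min (p y) (q y)) ∂μ = 1 - ∫⁻ y, min (p y) (q y) ∂μ := by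
  have hle : ∫⁻ y, min (p y) (q y) ∂μ ≤ 1 := by
    rw [← hp1]; exact lintegral_mono fun y => min_le_left _ _
  rw [lintegral_sub (hp.min hq) (ne_top_of_le_ne_top ENNReal.one_ne_top hle)
    (ae_of_all _ fun y => min_le_left _ _), hp1]

/-- Normalising the product of two measures of mass `r` by `r⁻¹` gives a measure with these
marginals, also for `r = 0`. -/
lemma map_inv_smul_prod {μ₁ μ₂ : Measure Y} [SFinite μ₁] [SFinite μ₂] {r : ℝ≥0∞} (hr : r ≠ ⊤)
    (h₁ : μ₁ Set.univ = r) (h₂ : μ₂ Set.univ = r) :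
    (r⁻¹ • μ₁.prod μ₂).map Prod.fst = μ₁ ∧ (r⁻¹ • μ₁.prod μ₂).map Prod.snd = μ₂ := by
  rw [Measure.map_smul, Measure.map_smul, Measure.map_fst_prod, Measure.map_snd_prod, h₁, h₂,
    smul_smul]
  rcases eq_or_ne r 0 with h | h
  · rw [h] at h₁ h₂
    rw [Measure.measure_univ_eq_zero] at h₁ h₂
    simp [h₁, h₂]
  · rw [ENNReal.inv_mul_cancel h hr, one_smul, smul_smul, ENNReal.inv_mul_cancel h hr, one_smul]
    exact ⟨rfl, rfl⟩

lemma withDensity_min_add (hp : Measurable p) (hq : Measurable q) :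
    μ.withDensity (fun y => min (p y) (q y)) + μ.withDensity (fun y => p y - min (p y) (q y))
      = μ.withDensity p := by
  have hmin : Measurable fun y => min (p y) (q y) := hp.min hq
  rw [← withDensity_add_left hmin]
  congr 1
  funext y
  exact add_tsub_cancel_of_le (min_le_left _ _)

/-- The maximal coupling has the right marginals. -/
lemma map_maxCoupling [SFinite μ] (hp : Measurable p) (hq : Measurable q) (hp1 : ∫⁻ y, p y ∂μ = 1)
    (hq1 : ∫⁻ y, q y ∂μ = 1) :
    (CoupledModel.maxCoupling μ p q).map Prod.fst = μ.withDensity p ∧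
      (CoupledModel.maxCoupling μ p q).map Prod.snd = μ.withDensity q := by
  have hcomm : ∀ y, min (p y) (q y) = min (q y) (p y) := fun y => min_comm _ _
  have hmin : Measurable fun y => min (p y) (q y) := hp.min hq
  have hr : 1 - ∫⁻ y, min (p y) (q y) ∂μ ≠ ⊤ :=
    ne_top_of_le_ne_top ENNReal.one_ne_top tsub_le_self
  have hdiag : Measurable fun u : Y => (u, u) := measurable_id.prodMk measurable_id
  have hq' : ∫⁻ y, (q y - min (p y) (q y)) ∂μ = 1 - ∫⁻ y, min (p y) (q y) ∂μ := by
    simp only [hcomm]; exact lintegral_sub_min hq hp hq1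
  have hres := map_inv_smul_prod (μ₁ := μ.withDensity fun y => p y - min (p y) (q y))
    (μ₂ := μ.withDensity fun y => q y - min (p y) (q y)) hr
    (by rw [withDensity_apply _ .univ, Measure.restrict_univ, lintegral_sub_min hp hq hp1])
    (by rw [withDensity_apply _ .univ, Measure.restrict_univ, hq'])
  have hpm : Measurable fun y => p y - min (p y) (q y) := hp.sub hmin
  have hqm : Measurable fun y => q y - min (p y) (q y) := hq.sub hmin
  rw [prod_withDensity hpm hqm] at hres
  constructor
  · rw [CoupledModel.maxCoupling, Measure.map_add _ _ measurable_fst, hres.1,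
      Measure.map_map measurable_fst hdiag]
    change Measure.map id _ + _ = _
    rw [Measure.map_id, withDensity_min_add hp hq]
  · rw [CoupledModel.maxCoupling, Measure.map_add _ _ measurable_snd, hres.2,
      Measure.map_map measurable_snd hdiag]
    change Measure.map id _ + _ = _
    rw [Measure.map_id]
    simp only [hcomm]
    rw [withDensity_min_add hq hp]

end

section

variable {X : Type u} [MeasurableSpace X] {m : CoupledModel X} {V : X → ℝ} {K : HConstants}

instance (s : Level) (n : ℕ) : SFinite (m.eta s n) := by
  unfold CoupledModel.eta; infer_instance

lemma measurable_Ff (m : CoupledModel X) (n : ℕ) (μ : Measure (X × X)) :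
    Measurable (m.Ff n μ) :=
  ((measurable_G_coe m n).comp measurable_fst).div_const _

lemma measurable_Fc (m : CoupledModel X) (n : ℕ) (μ : Measure (X × X)) :
    Measurable (m.Fc n μ) :=
  ((measurable_G_coe m n).comp measurable_snd).div_const _

/-- Maximally coupled resampling is the maximal coupling of the two reweighted copies of `μ`, of
which the first coordinate of the first pair and the second coordinate of the second are kept. -/
lemma PhiM_eq (m : CoupledModel X) (n : ℕ) (μ : Measure (X × X)) [SFinite μ]
    (hf : ∫⁻ z, m.Ff n μ z ∂μ = 1) (hc : ∫⁻ z, m.Fc n μ z ∂μ = 1) :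
    m.PhiM n μ = ((CoupledModel.maxCoupling μ (m.Ff n μ) (m.Fc n μ)).map
      fun w => (w.1.1, w.2.2)).bind (m.cM n) := by
  have hmf := measurable_Ff m n μ
  have hmc := measurable_Fc m n μ
  have hmin : Measurable fun z => min (m.Ff n μ z) (m.Fc n μ z) := hmf.min hmc
  have hdiag : Measurable fun u : X × X => (u, u) := measurable_id.prodMk measurable_id
  have hsel : Measurable fun w : (X × X) × (X × X) => (w.1.1, w.2.2) := by fun_prop
  have hmap : ∀ ω : Measure ((X × X) × (X × X)),
      (ω.map fun w => (w.1.1, w.2.2)).bind (m.cM n) = ω.bind fun w => m.cM n (w.1.1, w.2.2) := by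
    intro ω
    ext B hB
    rw [Measure.bind_apply hB (Kernel.aemeasurable _),
      Measure.bind_apply (f := fun w : (X × X) × (X × X) => m.cM n (w.1.1, w.2.2)) hB
        ((m.cM n).measurable.comp hsel).aemeasurable,
      lintegral_map (Kernel.measurable_coe _ hB) hsel]
  set r := 1 - ∫⁻ z, min (m.Ff n μ z) (m.Fc n μ z) ∂μ with hr
  have hrt : r ≠ ⊤ := ne_top_of_le_ne_top ENNReal.one_ne_top tsub_le_self
  have hrf : ∫⁻ z, (m.Ff n μ z - min (m.Ff n μ z) (m.Fc n μ z)) ∂μ = r :=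
    lintegral_sub_min hmf hmc hf
  have hrc : ∫⁻ z, (m.Fc n μ z - min (m.Ff n μ z) (m.Fc n μ z)) ∂μ = r := by
    rw [hr]
    simp only [fun y => min_comm (m.Ff n μ y) (m.Fc n μ y)]
    exact lintegral_sub_min hmc hmf hc
  rw [CoupledModel.maxCoupling, Measure.map_add _ _ hsel, Measure.comp_add,
    Measure.map_map hsel hdiag, Measure.map_smul, Measure.comp_smul, hmap]
  have hid : ((fun w : (X × X) × (X × X) => (w.1.1, w.2.2)) ∘ fun u => (u, u)) = id := rfl
  rw [hid, Measure.map_id, CoupledModel.PhiM]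
  congr 1
  have hfun : (fun w : (X × X) × (X × X) => m.FfBar n μ w.1 * m.FcBar n μ w.2) =
      (r⁻¹ * r⁻¹) • fun w : (X × X) × (X × X) =>
        (m.Ff n μ w.1 - min (m.Ff n μ w.1) (m.Fc n μ w.1)) *
          (m.Fc n μ w.2 - min (m.Ff n μ w.2) (m.Fc n μ w.2)) := by
    funext w
    simp only [CoupledModel.FfBar, CoupledModel.FcBar, CoupledModel.Fmin, Pi.smul_apply,
      smul_eq_mul]
    rw [hrf, hrc, div_eq_mul_inv, div_eq_mul_inv]
    ring
  have hmw : Measurable fun w : (X × X) × (X × X) =>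
      (m.Ff n μ w.1 - min (m.Ff n μ w.1) (m.Fc n μ w.1)) *
        (m.Fc n μ w.2 - min (m.Ff n μ w.2) (m.Fc n μ w.2)) :=
    ((hmf.sub hmin).comp measurable_fst).mul ((hmc.sub hmin).comp measurable_snd)
  simp only [CoupledModel.Fmin]
  rw [← hr]
  have hsm : ∀ (a : ℝ≥0∞) (ω : Measure ((X × X) × (X × X))),
      (a • ω).bind (fun w => m.cM n (w.1.1, w.2.2))
        = a • ω.bind (fun w => m.cM n (w.1.1, w.2.2)) := by
    intro a ω
    rw [← hmap, ← hmap, Measure.map_smul, Measure.comp_smul]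
  rw [hfun, withDensity_smul _ hmw, hsm, smul_smul]
  rcases eq_or_ne r 0 with h0 | h0
  · -- Without residual mass the product of the residuals vanishes.
    have hz : (μ.prod μ).withDensity (fun w : (X × X) × (X × X) =>
        (m.Ff n μ w.1 - min (m.Ff n μ w.1) (m.Fc n μ w.1)) *
          (m.Fc n μ w.2 - min (m.Ff n μ w.2) (m.Fc n μ w.2))) = 0 := by
      have hfm : Measurable fun z => m.Ff n μ z - min (m.Ff n μ z) (m.Fc n μ z) := hmf.sub hmin
      have hcm : Measurable fun z => m.Fc n μ z - min (m.Ff n μ z) (m.Fc n μ z) := hmc.sub hmin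
      rw [← prod_withDensity hfm hcm]
      have : μ.withDensity (fun z => m.Ff n μ z - min (m.Ff n μ z) (m.Fc n μ z)) = 0 := by
        rw [← Measure.measure_univ_eq_zero, withDensity_apply _ .univ, Measure.restrict_univ, hrf,
          h0]
      rw [this, Measure.zero_prod]
    rw [hz]
    simp
  · rw [← mul_assoc, ENNReal.mul_inv_cancel h0 hrt, one_mul]

lemma H1to6.isPairLaw_PhiM (H : H1to6 m V K) {n : ℕ} {μ : Measure (X × X)} [SFinite μ]
    (hμ : IsPairLaw m n μ) : IsPairLaw m (n + 1) (m.PhiM n μ) := by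
  have hG := measurable_G_coe m n
  have hG₁ : Measurable fun z : X × X => (m.G n z.1 : ℝ≥0∞) := hG.comp measurable_fst
  have hG₂ : Measurable fun z : X × X => (m.G n z.2 : ℝ≥0∞) := hG.comp measurable_snd
  have hf : ∫⁻ z, (m.G n z.1 : ℝ≥0∞) ∂μ = ∫⁻ x, (m.G n x : ℝ≥0∞) ∂(m.eta .f n) := by
    rw [← hμ.fst, lintegral_map hG measurable_fst]
  have hc : ∫⁻ z, (m.G n z.2 : ℝ≥0∞) ∂μ = ∫⁻ x, (m.G n x : ℝ≥0∞) ∂(m.eta .c n) := by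
    rw [← hμ.snd, lintegral_map hG measurable_snd]
  have hf1 : ∫⁻ z, m.Ff n μ z ∂μ = 1 := by
    simp only [CoupledModel.Ff, div_eq_mul_inv]
    rw [lintegral_mul_const _ hG₁, hf,
      ENNReal.mul_inv_cancel (H.lintegral_G_ne_zero .f n) (H.lintegral_G_ne_top .f n)]
  have hc1 : ∫⁻ z, m.Fc n μ z ∂μ = 1 := by
    simp only [CoupledModel.Fc, div_eq_mul_inv]
    rw [lintegral_mul_const _ hG₂, hc,
      ENNReal.mul_inv_cancel (H.lintegral_G_ne_zero .c n) (H.lintegral_G_ne_top .c n)]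
  have hsel : Measurable fun w : (X × X) × (X × X) => (w.1.1, w.2.2) := by fun_prop
  obtain ⟨hm1, hm2⟩ := map_maxCoupling (measurable_Ff m n μ) (measurable_Fc m n μ) hf1 hc1
  rw [PhiM_eq m n μ hf1 hc1]
  apply H.isPairLaw_bind
  · rw [Measure.map_map measurable_fst hsel]
    change Measure.map (Prod.fst ∘ Prod.fst) _ = _
    rw [← Measure.map_map measurable_fst measurable_fst, hm1]
    ext B hB
    rw [Measure.map_apply measurable_fst hB, withDensity_apply _ (measurable_fst hB),
      CoupledModel.etaBar, Measure.smul_apply, withDensity_apply _ hB, ← hf, ← hμ.fst,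
      setLIntegral_map hB hG measurable_fst, smul_eq_mul,
      ← lintegral_const_mul _ hG₁]
    simp only [CoupledModel.Ff, div_eq_mul_inv, mul_comm]
  · rw [Measure.map_map measurable_snd hsel]
    change Measure.map (Prod.snd ∘ Prod.snd) _ = _
    rw [← Measure.map_map measurable_snd measurable_snd, hm2]
    ext B hB
    rw [Measure.map_apply measurable_snd hB, withDensity_apply _ (measurable_snd hB),
      CoupledModel.etaBar, Measure.smul_apply, withDensity_apply _ hB, ← hc, ← hμ.snd,
      setLIntegral_map hB hG measurable_snd, smul_eq_mul,
      ← lintegral_const_mul _ hG₂]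
    simp only [CoupledModel.Fc, div_eq_mul_inv, mul_comm]

lemma H1to6.isProbabilityMeasure_of_isPairLaw (H : H1to6 m V K) {n : ℕ} {κ : Measure (X × X)}
    (hκ : IsPairLaw m n κ) : IsProbabilityMeasure κ := by
  have := H.isProbabilityMeasure_eta .f n
  refine ⟨?_⟩
  rw [← measure_univ (μ := m.eta .f n), ← hκ.fst, Measure.map_apply measurable_fst .univ,
    Set.preimage_univ]

lemma H1to6.isPairLaw_couplingM (H : H1to6 m V K) (n : ℕ) : IsPairLaw m n (m.couplingM n) := by
  induction n with
  | zero => exact isPairLaw_cinit m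
  | succ n ih =>
    have := H.isProbabilityMeasure_of_isPairLaw ih
    exact H.isPairLaw_PhiM ih

lemma H1to6.isPairLaw_couplingC (H : H1to6 m V K) (D : m.Densities) (n : ℕ) :
    IsPairLaw m n (m.couplingC D n) := by
  have := D.sigmaFinite_ref
  cases n with
  | zero =>
    have h1 : ∀ s, ∫⁻ x, D.dinit s x ∂D.ref = 1 := fun s => by
      rw [← setLIntegral_univ, ← withDensity_apply _ .univ, ← D.init_eq, measure_univ]
    obtain ⟨hm1, hm2⟩ := map_maxCoupling (D.measurable_dinit .f) (D.measurable_dinit .c)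
      (h1 .f) (h1 .c)
    exact ⟨by rw [CoupledModel.couplingC, hm1, eta_zero, D.init_eq],
      by rw [CoupledModel.couplingC, hm2, eta_zero, D.init_eq]⟩
  | succ n =>
    have hG := measurable_G_coe m n
    have hjoint : ∀ s, Measurable fun z : X × X => (m.G n z.1 : ℝ≥0∞) * D.dM s n z.1 z.2 :=
      fun s => (hG.comp measurable_fst).mul (D.measurable_dM s n)
    have hmeas : ∀ s, Measurable (m.predDensity D s n (m.eta s n)) := fun s =>
      Measurable.div_const (Measurable.lintegral_prod_left' (μ := m.eta s n) (hjoint s)) _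
    have hdens : ∀ s, D.ref.withDensity (m.predDensity D s n (m.eta s n)) = m.eta s (n + 1) := by
      intro s
      rw [H.eta_succ, massE_one]
      ext B hB
      have hsm : m.predDensity D s n (m.eta s n)
          = fun x => (∫⁻ u, (m.G n u : ℝ≥0∞) ∂(m.eta s n))⁻¹ *
            ∫⁻ u, (m.G n u : ℝ≥0∞) * D.dM s n u x ∂(m.eta s n) := by
        funext x
        rw [CoupledModel.predDensity, div_eq_mul_inv, mul_comm]
      rw [withDensity_apply _ hB, hsm, lintegral_const_mul _
        (Measurable.lintegral_prod_left' (μ := m.eta s n) (hjoint s)), Measure.smul_apply,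
        smul_eq_mul, Measure.bind_apply hB (Kernel.aemeasurable _),
        lintegral_lintegral_swap (f := fun x u => (m.G n u : ℝ≥0∞) * D.dM s n u x)
          ((hjoint s).comp measurable_swap).aemeasurable]
      congr 1
      refine lintegral_congr fun u => ?_
      rw [m.Q_apply, Measure.smul_apply, smul_eq_mul, D.M_eq, withDensity_apply _ hB,
        lintegral_const_mul (f := D.dM s n u) _
        ((D.measurable_dM s n).comp measurable_prodMk_left)]
    have h1 : ∀ s, ∫⁻ x, m.predDensity D s n (m.eta s n) x ∂D.ref = 1 := fun s => by
      have := H.isProbabilityMeasure_eta s (n + 1)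
      rw [← setLIntegral_univ, ← withDensity_apply _ .univ, hdens, measure_univ]
    obtain ⟨hm1, hm2⟩ := map_maxCoupling (hmeas .f) (hmeas .c) (h1 .f) (h1 .c)
    exact ⟨by rw [CoupledModel.couplingC, CoupledModel.PhiC, hm1, hdens],
      by rw [CoupledModel.couplingC, CoupledModel.PhiC, hm2, hdens]⟩

end

/-! ### The quantile coupling -/

section

variable {μ : Measure ℝ}

/-- The quantile function is the lower adjoint of the distribution function. -/
lemma quantile_le_iff {w : ℝ} (hw : w ∈ Set.Ioo (0 : ℝ) 1) (x : ℝ) : quantile μ w ≤ x ↔ w ≤ cdf μ x := by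
  have hne : {x : ℝ | w ≤ cdf μ x}.Nonempty := by
    obtain ⟨y, hy⟩ := ((tendsto_cdf_atTop μ).eventually (lt_mem_nhds hw.2)).exists
    exact ⟨y, le_of_lt hy⟩
  have hbdd : BddBelow {x : ℝ | w ≤ cdf μ x} := by
    obtain ⟨y, hy⟩ := ((tendsto_cdf_atBot μ).eventually (gt_mem_nhds hw.1)).exists
    refine ⟨y, fun z hz => ?_⟩
    by_contra hlt
    have := monotone_cdf μ (le_of_not_ge hlt)
    exact absurd hy (not_lt.2 (le_trans hz this))
  refine ⟨fun h => ?_, fun h => csInf_le hbdd h⟩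
  -- Right continuity puts the infimum into the set.
  have hmem : ∀ y, x < y → w ≤ cdf μ y := fun y hy => by
    obtain ⟨z, hz, hzy⟩ := exists_lt_of_csInf_lt hne (lt_of_le_of_lt h hy)
    exact le_trans hz (monotone_cdf μ hzy.le)
  have hcont := ((cdf μ).right_continuous x).mono Set.Ioi_subset_Ici_self
  refine ge_of_tendsto hcont ?_
  filter_upwards [self_mem_nhdsWithin] with y hy using hmem y hy

lemma aemeasurable_quantile :
    AEMeasurable (quantile μ) ((volume : Measure ℝ).restrict (Set.Ioo 0 1)) := by
  refine aemeasurable_restrict_of_monotoneOn measurableSet_Ioo fun a ha b hb hab => ?_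
  rw [quantile_le_iff ha]
  exact hab.trans ((quantile_le_iff hb _).1 le_rfl)

lemma map_quantile [IsProbabilityMeasure μ] : ((volume : Measure ℝ).restrict (Set.Ioo 0 1)).map (quantile μ) = μ := by
  have : IsFiniteMeasure ((volume : Measure ℝ).restrict (Set.Ioo 0 1)) :=
    ⟨by rw [Measure.restrict_apply_univ, Real.volume_Ioo]; exact ENNReal.ofReal_lt_top⟩
  refine Measure.ext_of_Iic _ _ fun x => ?_
  rw [Measure.map_apply_of_aemeasurable aemeasurable_quantile measurableSet_Iic,
    ← ofReal_cdf]
  have h1 : ((volume : Measure ℝ).restrict (Set.Ioo 0 1)) (quantile μ ⁻¹' Set.Iic x)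
      = ((volume : Measure ℝ).restrict (Set.Ioo 0 1)) (Set.Iic (cdf μ x)) := by
    refine measure_congr ?_
    filter_upwards [ae_restrict_mem measurableSet_Ioo] with w hw
    exact propext (quantile_le_iff hw x)
  have h2 : ((volume : Measure ℝ).restrict (Set.Ioo 0 1)) (Set.Iic (cdf μ x))
      = ((volume : Measure ℝ).restrict (Set.Ioc 0 1)) (Set.Iic (cdf μ x)) := by
    rw [Measure.restrict_congr_set Ioo_ae_eq_Ioc]
  rw [h1, h2, Measure.restrict_apply measurableSet_Iic, Set.inter_comm, Set.Ioc_inter_Iic,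
    min_eq_right (cdf_le_one μ x), Real.volume_Ioc, sub_zero]

end

lemma H1to6.isPairLaw_couplingW {m : CoupledModel ℝ} {V : ℝ → ℝ} {K : HConstants}
    (H : H1to6 m V K) (n : ℕ) : IsPairLaw m n (m.couplingW n) := by
  cases n with
  | zero => exact isPairLaw_cinit m
  | succ n =>
    have := H.isProbabilityMeasure_etaBar .f n
    have := H.isProbabilityMeasure_etaBar .c n
    have hq := (aemeasurable_quantile (μ := m.etaBar .f n)).prodMk
      (aemeasurable_quantile (μ := m.etaBar .c n))
    apply H.isPairLaw_bind
    · rw [AEMeasurable.map_map_of_aemeasurable measurable_fst.aemeasurable hq]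
      exact map_quantile
    · rw [AEMeasurable.map_map_of_aemeasurable measurable_snd.aemeasurable hq]
      exact map_quantile

/-! ### The variance bound -/

lemma exp_mul_exp_rpow {X : Type u} (V : X → ℝ) (t : ℝ) (x y : X) :
    (Real.exp (V x) * Real.exp (V y)) ^ t = vpow V t x * vpow V t y := by
  rw [Real.mul_rpow (Real.exp_nonneg _) (Real.exp_nonneg _)]; rfl

section

variable {X : Type u} [MeasurableSpace X] {m : CoupledModel X} {V : X → ℝ} {K : HConstants}

lemma H1to6.D_self (H : H1to6 m V K) (s : Level) (n : ℕ) {φ : X → ℝ} (hφ : IsBdd φ) (x : X) :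
    m.D s n n φ x = φ x - ∫ z, φ z ∂(m.eta s n) := by
  rw [CoupledModel.D, H.mass_self, div_one, Qop_self m s n (hφ.1.sub_const _)]

/-- The difference of the two centred semigroups at one point, split into the difference of the
normalised semigroups, of the predictors, and of the total masses. -/
lemma H1to6.D_sub_D (H : H1to6 m V K) (p k : ℕ) {φ : X → ℝ} (hφ : IsBdd φ) (y : X) :
    m.D .f p (p + k) φ y - m.D .c p (p + k) φ y =
      m.h .f p (p + k) y * m.S p (p + k) φ y - m.h .f p (p + k) y * m.etaDiff (p + k) φ
        + (m.h .f p (p + k) y - m.h .c p (p + k) y)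
          * (normQ m .c p (p + k) φ y - ∫ z, φ z ∂(m.eta .c (p + k))) := by
  rw [H.D_eq .f p k hφ, H.D_eq .c p k hφ, CoupledModel.S, CoupledModel.etaDiff]
  simp only [normQ]
  ring

lemma vpow_mul_vpow_le {a b : ℝ} (H : H1to6 m V K) (ha : 0 ≤ a) (hb : 0 ≤ b) (hab : a + b ≤ 1)
    (x y : X) : vpow V a x * vpow V b y ≤ vpow V 1 x + vpow V 1 y := by
  have hx := zero_le_one.trans (H.one_le_V x)
  have hy := zero_le_one.trans (H.one_le_V y)
  rw [vpow_eq, vpow_eq, vpow_eq, vpow_eq, ← Real.exp_add, one_mul, one_mul]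
  rcases le_total (V x) (V y) with h | h
  · refine le_trans (Real.exp_le_exp.2 (?_ : _ ≤ V y)) (le_add_of_nonneg_left (Real.exp_nonneg _))
    nlinarith [mul_le_mul_of_nonneg_left h ha]
  · refine le_trans (Real.exp_le_exp.2 (?_ : _ ≤ V x)) (le_add_of_nonneg_right (Real.exp_nonneg _))
    nlinarith [mul_le_mul_of_nonneg_left h hb]

lemma IsPairLaw.integrable_fst {n : ℕ} {κ : Measure (X × X)} (hκ : IsPairLaw m n κ) {f : X → ℝ}
    (hf : Integrable f (m.eta .f n)) : Integrable (fun z : X × X => f z.1) κ := by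
  rw [← hκ.fst] at hf
  exact hf.comp_measurable measurable_fst

lemma IsPairLaw.integrable_snd {n : ℕ} {κ : Measure (X × X)} (hκ : IsPairLaw m n κ) {f : X → ℝ}
    (hf : Integrable f (m.eta .c n)) : Integrable (fun z : X × X => f z.2) κ := by
  rw [← hκ.snd] at hf
  exact hf.comp_measurable measurable_snd

lemma IsPairLaw.integral_snd {n : ℕ} {κ : Measure (X × X)} (hκ : IsPairLaw m n κ) {f : X → ℝ}
    (hf : Measurable f) : ∫ z, f z.2 ∂κ = ∫ x, f x ∂(m.eta .c n) := by
  rw [← hκ.snd, integral_map measurable_snd.aemeasurable hf.aestronglyMeasurable]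

end

/-- The bracket in the `p`-th term of `Bterm`, with `r` for `ρ ^ (n - p)`. -/
noncomputable def bracket {X : Type u} [MeasurableSpace X] (m : CoupledModel X) (V : X → ℝ)
    (ξ r : ℝ) (p n : ℕ) (φ : X → ℝ) : ℝ :=
  wnorm (vpow V ξ) (fun x => m.h .f p n x * m.S p n φ x) + |m.etaDiff n φ|
    + supNorm φ * wnorm (vpow V ξ) (fun x => m.h .f p n x - m.h .c p n x) * r

lemma bracket_nonneg {X : Type u} [MeasurableSpace X] (m : CoupledModel X) (V : X → ℝ)
    (ξ : ℝ) {r : ℝ} (hr : 0 ≤ r) (p n : ℕ) (φ : X → ℝ) : 0 ≤ bracket m V ξ r p n φ := by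
  have h := fun f => wnorm_nonneg (φ := f) fun x => (vpow_pos V ξ x).le
  exact add_nonneg (add_nonneg (h _) (abs_nonneg _))
    (mul_nonneg (mul_nonneg (supNorm_nonneg φ) (h _)) hr)

/-- Squared difference at one point: one factor is bounded by the geometric decay of each centred
semigroup, the other by the splitting of their difference. -/
lemma exists_sq_D_sub_D_le (K : HConstants) {ξ : ℝ} (h0 : 0 < ξ) (h1 : 3 * ξ ≤ 1) :
    ∃ ρ₀ C : ℝ, 0 < ρ₀ ∧ ρ₀ < 1 ∧ 0 ≤ C ∧ ∀ ρ : ℝ, ρ₀ ≤ ρ →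
      ∀ (X : Type u) [MeasurableSpace X] (m : CoupledModel X) (V : X → ℝ),
      H1to6 m V K → ∀ φ : X → ℝ, IsBdd φ → ∀ (p k : ℕ) (y : X),
        (m.D .f p (p + k) φ y - m.D .c p (p + k) φ y) ^ 2 ≤
          C * (supNorm φ * (ρ ^ k * bracket m V ξ (ρ ^ k) p (p + k) φ)) * vpow V 1 y := by
  have hξ1 : ξ ≤ 1 := by linarith
  obtain ⟨ρD, CD, hρD0, hρD1, hCD, hD⟩ := exists_abs_D_le.{u} K h0 hξ1
  obtain ⟨ρF, CF, hρF0, hρF1, hCF, hF⟩ := exists_abs_normQ_sub_le.{u} K h0 hξ1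
  obtain ⟨Ch, hCh, hh⟩ := exists_h_le.{u} K h0 hξ1
  have hCD0 : 0 ≤ CD := zero_le_one.trans hCD
  have hCF0 : 0 ≤ CF := zero_le_one.trans hCF
  have hCh0 : 0 ≤ Ch := zero_le_one.trans hCh
  refine ⟨max ρD ρF, 2 * CD * (Ch * CF), lt_max_of_lt_left hρD0, max_lt hρD1 hρF1,
    by positivity, fun ρ hρ X _ m V H φ hφ p k y => ?_⟩
  have hDρ : ρD ^ k ≤ ρ ^ k := pow_le_pow_left₀ hρD0.le ((le_max_left _ _).trans hρ) k
  have hFρ : ρF ^ k ≤ ρ ^ k := pow_le_pow_left₀ hρF0.le ((le_max_right _ _).trans hρ) k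
  set r := ρ ^ k with hr
  have hr0 : 0 ≤ r := (pow_nonneg hρD0.le k).trans hDρ
  have hN := supNorm_nonneg φ
  have hv := vpow_pos V ξ
  have hv1 := H.one_le_vpow h0.le y
  set N₁ := wnorm (vpow V ξ) (fun x => m.h .f p (p + k) x * m.S p (p + k) φ x) with hN₁
  set N₂ := wnorm (vpow V ξ) (fun x => m.h .f p (p + k) x - m.h .c p (p + k) x) with hN₂
  have hN₁0 : 0 ≤ N₁ := wnorm_nonneg fun x => (hv x).le
  have hN₂0 : 0 ≤ N₂ := wnorm_nonneg fun x => (hv x).le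
  have hhS : |m.h .f p (p + k) y * m.S p (p + k) φ y| ≤ N₁ * vpow V ξ y := by
    refine le_wnorm (φ := fun x => m.h .f p (p + k) x * m.S p (p + k) φ x) hv
      (L := Ch * (2 * supNorm φ)) (fun x => ?_) y
    have hS : |m.S p (p + k) φ x| ≤ 2 * supNorm φ := by
      have e1 := H.abs_normQ_le .f p k hφ.le_supNorm x
      have e2 := H.abs_normQ_le .c p k hφ.le_supNorm x
      exact (abs_sub _ _).trans ((add_le_add e1 e2).trans_eq (two_mul _).symm)
    rw [abs_mul, abs_of_pos (H.h_pos .f p k x)]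
    calc _ ≤ Ch * vpow V ξ x * (2 * supNorm φ) :=
          mul_le_mul (hh X m V H .f p k x) hS (abs_nonneg _) (mul_nonneg hCh0 (hv x).le)
      _ = _ := by ring
  have hhh : |m.h .f p (p + k) y - m.h .c p (p + k) y| ≤ N₂ * vpow V ξ y := by
    refine le_wnorm (φ := fun x => m.h .f p (p + k) x - m.h .c p (p + k) x) hv
      (L := Ch) (fun x => ?_) y
    rw [abs_le]
    have e1 := hh X m V H .f p k x
    have e2 := hh X m V H .c p k x
    have e3 := H.h_pos .f p k x
    have e4 := H.h_pos .c p k x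
    constructor <;> linarith
  have hfirst : |m.D .f p (p + k) φ y - m.D .c p (p + k) φ y|
      ≤ 2 * CD * supNorm φ * r * vpow V ξ y := by
    have e : ∀ s, |m.D s p (p + k) φ y| ≤ CD * supNorm φ * r * vpow V ξ y := fun s =>
      (hD X m V H s φ hφ p k y).trans (by gcongr)
    exact (abs_sub _ _).trans ((add_le_add (e .f) (e .c)).trans_eq (by ring))
  have hsecond : |m.D .f p (p + k) φ y - m.D .c p (p + k) φ y|
      ≤ Ch * CF * (N₁ + |m.etaDiff (p + k) φ| + supNorm φ * N₂ * r)
        * (vpow V ξ y * vpow V ξ y) := by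
    have hFy : |normQ m .c p (p + k) φ y - ∫ z, φ z ∂(m.eta .c (p + k))|
        ≤ CF * supNorm φ * r * vpow V ξ y :=
      (hF X m V H .c φ hφ p k y).trans (by gcongr)
    have hChF : 1 ≤ Ch * CF := one_le_mul_of_one_le_of_one_le hCh hCF
    have hvv : vpow V ξ y ≤ vpow V ξ y * vpow V ξ y := le_mul_of_one_le_left (hv y).le hv1
    have t1 : N₁ * vpow V ξ y ≤ Ch * CF * N₁ * (vpow V ξ y * vpow V ξ y) := by
      refine mul_le_mul (le_mul_of_one_le_left hN₁0 hChF) hvv (hv y).le (by positivity)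
    have t2 : |m.h .f p (p + k) y * m.etaDiff (p + k) φ|
        ≤ Ch * CF * |m.etaDiff (p + k) φ| * (vpow V ξ y * vpow V ξ y) := by
      rw [abs_mul, abs_of_pos (H.h_pos .f p k y)]
      calc m.h .f p (p + k) y * |m.etaDiff (p + k) φ|
          ≤ Ch * vpow V ξ y * |m.etaDiff (p + k) φ| := by gcongr; exact hh X m V H .f p k y
        _ ≤ Ch * CF * (vpow V ξ y * vpow V ξ y) * |m.etaDiff (p + k) φ| := by
            gcongr
            exact le_mul_of_one_le_right hCh0 hCF
        _ = _ := by ring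
    have t3 : |(m.h .f p (p + k) y - m.h .c p (p + k) y)
          * (normQ m .c p (p + k) φ y - ∫ z, φ z ∂(m.eta .c (p + k)))|
        ≤ Ch * CF * (supNorm φ * N₂ * r) * (vpow V ξ y * vpow V ξ y) := by
      rw [abs_mul]
      calc _ ≤ N₂ * vpow V ξ y * (CF * supNorm φ * r * vpow V ξ y) :=
            mul_le_mul hhh hFy (abs_nonneg _) (mul_nonneg hN₂0 (hv y).le)
        _ = 1 * (CF * (supNorm φ * N₂ * r) * (vpow V ξ y * vpow V ξ y)) := by ring
        _ ≤ Ch * (CF * (supNorm φ * N₂ * r) * (vpow V ξ y * vpow V ξ y)) := by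
            gcongr
        _ = _ := by ring
    rw [H.D_sub_D p k hφ y]
    refine (abs_add_le _ _).trans ((add_le_add ((abs_sub _ _).trans
      (add_le_add (hhS.trans t1) t2)) t3).trans_eq (by ring))
  have hv3 : vpow V ξ y * (vpow V ξ y * vpow V ξ y) ≤ vpow V 1 y := by
    rw [← vpow_add, ← vpow_add]
    exact H.vpow_mono (by linarith) y
  have hb := bracket_nonneg m V ξ hr0 p (p + k) φ
  have hbr : bracket m V ξ r p (p + k) φ
      = N₁ + |m.etaDiff (p + k) φ| + supNorm φ * N₂ * r := rfl
  rw [← hbr] at hsecond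
  rw [← sq_abs, sq]
  calc _ ≤ (2 * CD * supNorm φ * r * vpow V ξ y) *
        (Ch * CF * bracket m V ξ r p (p + k) φ * (vpow V ξ y * vpow V ξ y)) :=
        mul_le_mul hfirst hsecond (abs_nonneg _) (by have := hv y; positivity)
    _ = 2 * CD * (Ch * CF) * (supNorm φ * (r * bracket m V ξ r p (p + k) φ)) *
        (vpow V ξ y * (vpow V ξ y * vpow V ξ y)) := by ring
    _ ≤ _ := by gcongr

/-- The variance bound for any family of couplings of the predictors, given a weight `g` that
controls the squared increments of the fine centred semigroups. -/
lemma exists_varBound (K : HConstants) {ξ : ℝ} (h0 : 0 < ξ) (h1 : 3 * ξ ≤ 1) :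
    ∃ ρ₀ C₀ : ℝ, 0 < ρ₀ ∧ ρ₀ < 1 ∧ 0 ≤ C₀ ∧ ∀ ρ C Cg : ℝ, ρ₀ ≤ ρ → 0 ≤ Cg → C₀ + 2 * Cg ≤ C →
      ∀ (X : Type u) [MeasurableSpace X] (m : CoupledModel X) (V : X → ℝ),
      H1to6 m V K → ∀ κ : ℕ → Measure (X × X), (∀ p, IsPairLaw m p (κ p)) →
      ∀ φ : X → ℝ, IsBdd φ → ∀ g : X × X → ℝ, (∀ z, 0 ≤ g z) → (∀ p, Integrable g (κ p)) →
      (∀ (p k : ℕ) (z : X × X),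
        (m.D .f p (p + (k + 1)) φ z.1 - m.D .f p (p + (k + 1)) φ z.2) ^ 2
          ≤ Cg * supNorm φ ^ 2 * (ρ ^ (k + 1)) ^ 2 * g z) →
      ∀ n, VarBound m V κ ρ C ξ g n φ := by
  obtain ⟨ρ₀, C₁, hρ0, hρ1, hC₁, hsq⟩ := exists_sq_D_sub_D_le.{u} K h0 h1
  obtain ⟨T, hT, hη⟩ := exists_integral_vpow_le.{u} K
  have hT0 : 0 ≤ T := zero_le_one.trans hT
  refine ⟨ρ₀, 2 * C₁ * T, hρ0, hρ1, by positivity,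
    fun ρ C Cg hρ hCg hC X _ m V H κ hκ φ hφ g hg hgi hinc n => ?_⟩
  have hρ' : 0 ≤ ρ := hρ0.le.trans hρ
  have hN := supNorm_nonneg φ
  set E : ℕ → ℝ := fun p => ρ ^ (n - p) * bracket m V ξ (ρ ^ (n - p)) p n φ with hE
  set J : ℕ → ℝ := fun p => ρ ^ (n - p) * ((∫ z, g z ∂(κ p)) * (ρ ^ (n - p) + 1)) with hJ
  have hE0 : ∀ p, 0 ≤ E p := fun p =>
    mul_nonneg (pow_nonneg hρ' _) (bracket_nonneg m V ξ (pow_nonneg hρ' _) p n φ)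
  have hJ0 : ∀ p, 0 ≤ J p := fun p => mul_nonneg (pow_nonneg hρ' _)
    (mul_nonneg (integral_nonneg hg) (add_nonneg (pow_nonneg hρ' _) zero_le_one))
  have hterm : ∀ p ∈ Finset.range n, ∫ z, (m.D .f p n φ z.1 - m.D .c p n φ z.2) ^ 2 ∂(κ p)
      ≤ C * (supNorm φ * E p + supNorm φ ^ 2 * J p) := by
    intro p hp
    obtain ⟨k, rfl⟩ : ∃ k, n = p + (k + 1) :=
      ⟨n - p - 1, by have := Finset.mem_range.1 hp; omega⟩
    have hk : p + (k + 1) - p = k + 1 := by omega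
    set r := ρ ^ (k + 1) with hr
    have hr0 : 0 ≤ r := pow_nonneg hρ' _
    have hEp : E p = r * bracket m V ξ r p (p + (k + 1)) φ := by simp only [hE, hk, hr]
    have hJp : J p = r * ((∫ z, g z ∂(κ p)) * (r + 1)) := by simp only [hJ, hk, hr]
    have hvi := hη X m V H .c p
    have hvκ := (hκ p).integrable_snd hvi.1
    have hpt : ∀ z : X × X,
        (m.D .f p (p + (k + 1)) φ z.1 - m.D .c p (p + (k + 1)) φ z.2) ^ 2
        ≤ 2 * (Cg * supNorm φ ^ 2 * r ^ 2) * g z + 2 * (C₁ * (supNorm φ * E p)) * vpow V 1 z.2 := by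
      intro z
      have e1 := hinc p k z
      have e2 := hsq ρ hρ X m V H φ hφ p (k + 1) z.2
      rw [← hr] at e1 e2
      rw [← hEp] at e2
      have e3 : ∀ a b c : ℝ, (a - c) ^ 2 ≤ 2 * (a - b) ^ 2 + 2 * (b - c) ^ 2 := fun a b c => by
        nlinarith [sq_nonneg (a - b - (b - c))]
      have e4 := e3 (m.D .f p (p + (k + 1)) φ z.1) (m.D .f p (p + (k + 1)) φ z.2)
        (m.D .c p (p + (k + 1)) φ z.2)
      linarith
    have hint : Integrable (fun z : X × X => 2 * (Cg * supNorm φ ^ 2 * r ^ 2) * g z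
        + 2 * (C₁ * (supNorm φ * E p)) * vpow V 1 z.2) (κ p) :=
      ((hgi p).const_mul _).add (hvκ.const_mul _)
    refine (integral_mono_of_nonneg (ae_of_all _ fun z => sq_nonneg _) hint
      (ae_of_all _ hpt)).trans ?_
    rw [integral_add ((hgi p).const_mul _) (hvκ.const_mul _), integral_const_mul,
      integral_const_mul, (hκ p).integral_snd (H.measurable_vpow 1)]
    have hI0 : 0 ≤ ∫ z, g z ∂(κ p) := integral_nonneg hg
    have hJge : r ^ 2 * ∫ z, g z ∂(κ p) ≤ J p := by
      rw [hJp]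
      nlinarith [mul_nonneg hr0 hI0]
    have a1 : 0 ≤ supNorm φ * E p := mul_nonneg hN (hE0 p)
    have a2 : 0 ≤ supNorm φ ^ 2 * J p := mul_nonneg (sq_nonneg _) (hJ0 p)
    calc 2 * (Cg * supNorm φ ^ 2 * r ^ 2) * ∫ z, g z ∂(κ p)
          + 2 * (C₁ * (supNorm φ * E p)) * ∫ x, vpow V 1 x ∂(m.eta .c p)
        ≤ 2 * Cg * (supNorm φ ^ 2 * J p) + 2 * (C₁ * (supNorm φ * E p)) * T := by
          refine add_le_add ?_ ?_
          · calc 2 * (Cg * supNorm φ ^ 2 * r ^ 2) * ∫ z, g z ∂(κ p)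
                = 2 * Cg * (supNorm φ ^ 2 * (r ^ 2 * ∫ z, g z ∂(κ p))) := by ring
              _ ≤ _ := by gcongr
          · exact mul_le_mul_of_nonneg_left hvi.2 (by positivity)
      _ ≤ (2 * C₁ * T + 2 * Cg) * (supNorm φ * E p + supNorm φ ^ 2 * J p) := by
          have b1 := mul_nonneg (mul_nonneg hC₁ hT0) a2
          have b2 := mul_nonneg hCg a1
          nlinarith
      _ ≤ _ := mul_le_mul_of_nonneg_right hC (add_nonneg a1 a2)
  have hlast : ∫ z, (m.D .f n n φ z.1 - m.D .c n n φ z.2) ^ 2 ∂(κ n) = leadTerm m κ n φ := by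
    rw [leadTerm]
    refine integral_congr_ae (ae_of_all _ fun z => ?_)
    simp only [H.D_self _ n hφ, CoupledModel.etaDiff]
    ring
  rw [VarBound, CoupledModel.asympVar, Finset.sum_range_succ, hlast, add_comm]
  gcongr
  refine (Finset.sum_le_sum hterm).trans (le_of_eq ?_)
  rw [← Finset.mul_sum, Finset.sum_add_distrib, ← Finset.mul_sum, ← Finset.mul_sum]
  rfl

/-! ### The two weights -/

/-- The bound with the off-diagonal weight: on the diagonal the increments vanish. -/
lemma exists_varBound_offDiag (K : HConstants) {ξ : ℝ} (h0 : 0 < ξ) (h1 : ξ < 1 / 4) :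
    ∃ ρ₀ C₀ : ℝ, 0 < ρ₀ ∧ ρ₀ < 1 ∧ 0 ≤ C₀ ∧ ∀ ρ C : ℝ, ρ₀ ≤ ρ → C₀ ≤ C →
      ∀ (X : Type u) [MeasurableSpace X] [MeasurableEq X] (m : CoupledModel X) (V : X → ℝ),
      H1to6 m V K → ∀ κ : ℕ → Measure (X × X), (∀ p, IsPairLaw m p (κ p)) →
      ∀ φ : X → ℝ, IsBdd φ → ∀ n, VarBound m V κ ρ C ξ (offDiagWeight V ξ) n φ := by
  obtain ⟨ρ₀, C₀, hρ0, hρ1, hC₀, hvar⟩ := exists_varBound.{u} K h0 (by linarith)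
  obtain ⟨ρD, CD, hρD0, hρD1, hCD, hD⟩ := exists_abs_D_le.{u} K h0 (by linarith)
  obtain ⟨T, hT, hη⟩ := exists_integral_vpow_le.{u} K
  have hCD0 : 0 ≤ CD := zero_le_one.trans hCD
  refine ⟨max ρ₀ ρD, C₀ + 2 * (2 * CD) ^ 2, lt_max_of_lt_left hρ0, max_lt hρ1 hρD1, by positivity,
    fun ρ C hρ hC X _ _ m V H κ hκ φ hφ => ?_⟩
  have hN := supNorm_nonneg φ
  have hg0 : ∀ z : X × X, 0 ≤ (Real.exp (V z.1) * Real.exp (V z.2)) ^ (2 * ξ) := fun z => by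
    positivity
  refine hvar ρ C ((2 * CD) ^ 2) ((le_max_left _ _).trans hρ) (by positivity) hC X m V H κ hκ φ hφ
    _ (fun z => Set.indicator_nonneg (fun z _ => hg0 z) z) (fun p => ?_) (fun p k z => ?_)
  · have hA : MeasurableSet {z : X × X | z.1 ≠ z.2} :=
      (MeasurableEq.measurableSet_diagonal (α := X)).compl
    have hmeas : Measurable fun z : X × X =>
        (Real.exp (V z.1) * Real.exp (V z.2)) ^ (2 * ξ) :=
      ((H.measurable_V.exp.comp measurable_fst).mul
        (H.measurable_V.exp.comp measurable_snd)).pow_const _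
    have hdom := ((hκ p).integrable_fst (hη X m V H .f p).1).add
      ((hκ p).integrable_snd (hη X m V H .c p).1)
    refine Integrable.indicator (hdom.mono' hmeas.aestronglyMeasurable (ae_of_all _ fun z => ?_)) hA
    rw [Real.norm_of_nonneg (hg0 z), exp_mul_exp_rpow]
    exact vpow_mul_vpow_le H (by linarith) (by linarith) (by linarith) _ _
  · by_cases hz : z.1 = z.2
    · simp [offDiagWeight, hz]
    · have hw : offDiagWeight V ξ z = (vpow V ξ z.1 * vpow V ξ z.2) ^ 2 := by
        rw [offDiagWeight, Set.indicator_of_mem (show z ∈ {z : X × X | z.1 ≠ z.2} from hz),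
          exp_mul_exp_rpow, two_mul, vpow_add, vpow_add]
        ring
      have hr : ρD ^ (k + 1) ≤ ρ ^ (k + 1) :=
        pow_le_pow_left₀ hρD0.le ((le_max_right _ _).trans hρ) _
      have hr0 := pow_nonneg hρD0.le (k + 1)
      have hx := H.one_le_vpow h0.le z.1
      have hy := H.one_le_vpow h0.le z.2
      have hb : ∀ y, |m.D .f p (p + (k + 1)) φ y| ≤ CD * supNorm φ * ρ ^ (k + 1) * vpow V ξ y :=
        fun y => (hD X m V H .f φ hφ p (k + 1) y).trans
          (by gcongr; exact (vpow_pos V ξ y).le)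
      have hρk := hr0.trans hr
      have habs : |m.D .f p (p + (k + 1)) φ z.1 - m.D .f p (p + (k + 1)) φ z.2|
          ≤ 2 * CD * supNorm φ * ρ ^ (k + 1) * (vpow V ξ z.1 * vpow V ξ z.2) := by
        refine (abs_sub _ _).trans ((add_le_add (hb _) (hb _)).trans ?_)
        have e1 : vpow V ξ z.1 ≤ vpow V ξ z.1 * vpow V ξ z.2 :=
          le_mul_of_one_le_right (by linarith) hy
        have e2 : vpow V ξ z.2 ≤ vpow V ξ z.1 * vpow V ξ z.2 :=
          le_mul_of_one_le_left (by linarith) hx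
        have e3 : 0 ≤ CD * supNorm φ * ρ ^ (k + 1) := by positivity
        have := mul_le_mul_of_nonneg_left e1 e3
        have := mul_le_mul_of_nonneg_left e2 e3
        linarith
      rw [hw, ← sq_abs]
      refine (pow_le_pow_left₀ (abs_nonneg _) habs 2).trans (le_of_eq ?_)
      ring

lemma IsMetric.nonneg {X : Type u} {d : X → X → ℝ} (hd : IsMetric d) (x y : X) : 0 ≤ d x y := by
  have h1 := hd.triangle x y x
  rw [hd.symm y x, (hd.eq_zero_iff x x).2 rfl] at h1
  linarith

section

variable {X : Type u} [MeasurableSpace X] {m : CoupledModel X} {V : X → ℝ} {K : HConstants}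

lemma H1to6.D_succ (H : H1to6 m V K) (s : Level) (p k : ℕ) {φ : X → ℝ} (hφ : IsBdd φ) (x : X) :
    m.D s p (p + (k + 1)) φ x
      = (∫ y, m.D s (p + 1) (p + 1 + k) φ y ∂(m.Q s p x)) / m.mass s p (p + 1) := by
  simp only [CoupledModel.D]
  rw [Qop_succ m s p k (hφ.sub_const _), H.mass_succ s p k, integral_div, div_div,
    show p + 1 + k = p + (k + 1) by ring, mul_comm]

lemma measurable_D (m : CoupledModel X) (s : Level) (p n : ℕ) {φ : X → ℝ} (hφ : Measurable φ) :
    Measurable (m.D s p n φ) :=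
  (measurable_Qop m s p n (hφ.sub_const _)).div_const _

/-- The centred semigroups inherit the Lipschitz regularity of the one-step kernels. -/
lemma H1to6.isLip_D (H : H1to6 m V K) {d : X → X → ℝ} {K7 : ℝ → ℝ} (hd : IsMetric d)
    (h7 : H7 m V d K7) {ξ : ℝ} (h0 : 0 < ξ) (h1 : ξ ≤ 1) {φ : X → ℝ} (hφ : IsBdd φ)
    (hlip : IsLip (fun _ => 1) d φ) {ρ C : ℝ} (s : Level)
    (hD : ∀ (p k : ℕ) (x : X), |m.D s p (p + k) φ x| ≤ C * supNorm φ * ρ ^ k * vpow V ξ x)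
    (p k : ℕ) : IsLip (vpow V ξ) d (m.D s p (p + k) φ) := by
  induction k generalizing p with
  | zero =>
    obtain ⟨L, hL⟩ := hlip
    refine ⟨|L|, fun x y => ?_⟩
    rw [add_zero, H.D_self s p hφ, H.D_self s p hφ, sub_sub_sub_cancel_right]
    have e := hL x y
    simp only [mul_one] at e
    have hx := H.one_le_vpow h0.le x
    have hy := H.one_le_vpow h0.le y
    have hdn := hd.nonneg x y
    calc _ ≤ L * d x y := e
      _ ≤ |L| * d x y * 1 * 1 := by
          rw [mul_one, mul_one]
          exact mul_le_mul_of_nonneg_right (le_abs_self L) hdn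
      _ ≤ _ := by gcongr
  | succ k ih =>
    have hmass := H.mass_pos s p 1
    refine ⟨K7 ξ * wnorm (vpow V ξ) (m.D s (p + 1) (p + 1 + k) φ) / m.mass s p (p + 1),
      fun x y => ?_⟩
    have h := h7 ξ h0 h1 _ (measurable_D m s (p + 1) (p + 1 + k) hφ.1) ⟨_, hD (p + 1) k⟩
      (ih (p + 1)) x y s p
    rw [H.D_succ s p k hφ, H.D_succ s p k hφ, ← sub_div, abs_div, abs_of_pos hmass,
      div_le_iff₀ hmass]
    refine h.trans (le_of_eq ?_)
    rw [exp_mul_exp_rpow]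
    field_simp

end

/-- The bound with the metric weight: the one-step Lipschitz regularisation acts on the centred
semigroup started one step later, which has already decayed. -/
lemma exists_varBound_metric (K : HConstants) (K7 : ℝ → ℝ) {ξ' ξ : ℝ} (h0' : 0 < ξ')
    (h0 : 0 < ξ) (h1 : ξ < (1 - 2 * ξ') / 12) :
    ∃ ρ₀ C₀ : ℝ, 0 < ρ₀ ∧ ρ₀ < 1 ∧ 0 ≤ C₀ ∧ ∀ ρ C : ℝ, ρ₀ ≤ ρ → C₀ ≤ C →
      ∀ (X : Type u) [MeasurableSpace X] (m : CoupledModel X) (V : X → ℝ) (d : X → X → ℝ),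
      IsMetric d → Measurable (Function.uncurry d) → H1to6 m V K → H7 m V d K7 →
      InL (fun z : X × X => (Real.exp (V z.1) * Real.exp (V z.2)) ^ ξ') (fun z => d z.1 z.2 ^ 2) →
      ∀ κ : ℕ → Measure (X × X), (∀ p, IsPairLaw m p (κ p)) →
      ∀ φ : X → ℝ, IsBdd φ → IsLip (fun _ => 1) d φ → ∀ n,
        VarBound m V κ ρ C ξ (metricWeight V d ξ) n φ := by
  have hξ1 : ξ ≤ 1 := by linarith
  obtain ⟨ρ₀, C₀, hρ0, hρ1, hC₀, hvar⟩ := exists_varBound.{u} K h0 (by linarith)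
  obtain ⟨ρD, CD, hρD0, hρD1, hCD, hD⟩ := exists_abs_D_le.{u} K h0 hξ1
  obtain ⟨Cm, hCm, hm⟩ := exists_one_le_mass_one.{u} K
  obtain ⟨T, hT, hη⟩ := exists_integral_vpow_le.{u} K
  have hCD0 : 0 ≤ CD := zero_le_one.trans hCD
  have hCm0 : 0 ≤ Cm := zero_le_one.trans hCm
  set A : ℝ := Cm * |K7 ξ| * CD / ρD with hA
  have hA0 : 0 ≤ A := by positivity
  refine ⟨max ρ₀ ρD, C₀ + 2 * A ^ 2, lt_max_of_lt_left hρ0, max_lt hρ1 hρD1, by positivity,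
    fun ρ C hρ hC X _ m V d hd hdm H h7 hInL κ hκ φ hφ hlip => ?_⟩
  have hN := supNorm_nonneg φ
  have hw0 : ∀ z : X × X, 0 ≤ metricWeight V d ξ z := fun z =>
    mul_nonneg (sq_nonneg _) (mul_nonneg (vpow_pos V _ _).le (vpow_pos V _ _).le)
  refine hvar ρ C (A ^ 2) ((le_max_left _ _).trans hρ) (by positivity) hC X m V H κ hκ φ hφ
    _ hw0 (fun p => ?_) (fun p k z => ?_)
  · obtain ⟨L, hL⟩ := hInL
    have hmeas : Measurable (metricWeight V d ξ) :=
      (hdm.pow_const 2).mul (((H.measurable_vpow _).comp measurable_fst).mul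
        ((H.measurable_vpow _).comp measurable_snd))
    have hdom := (((hκ p).integrable_fst (hη X m V H .f p).1).add
      ((hκ p).integrable_snd (hη X m V H .c p).1)).const_mul |L|
    refine hdom.mono' hmeas.aestronglyMeasurable (ae_of_all _ fun z => ?_)
    rw [Real.norm_of_nonneg (hw0 z), metricWeight]
    have hLz : |d z.1 z.2 ^ 2| ≤ L * (Real.exp (V z.1) * Real.exp (V z.2)) ^ ξ' := hL z
    rw [abs_of_nonneg (sq_nonneg _), exp_mul_exp_rpow] at hLz
    have p1 := vpow_pos V ξ' z.1
    have p2 := vpow_pos V ξ' z.2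
    have p3 := vpow_pos V (4 * ξ) z.1
    have p4 := vpow_pos V (8 * ξ) z.2
    calc d z.1 z.2 ^ 2 * (vpow V (4 * ξ) z.1 * vpow V (8 * ξ) z.2)
        ≤ |L| * (vpow V ξ' z.1 * vpow V ξ' z.2) * (vpow V (4 * ξ) z.1 * vpow V (8 * ξ) z.2) := by
          gcongr
          exact hLz.trans (by gcongr; exact le_abs_self L)
      _ = |L| * (vpow V (ξ' + 4 * ξ) z.1 * vpow V (ξ' + 8 * ξ) z.2) := by
          rw [vpow_add, vpow_add]; ring
      _ ≤ _ := by
          refine mul_le_mul_of_nonneg_left ?_ (abs_nonneg L)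
          exact vpow_mul_vpow_le H (by linarith) (by linarith) (by linarith) _ _
  · have hDf := fun q j x => hD X m V H .f φ hφ q j x
    have hdz := hd.nonneg z.1 z.2
    have hmass := H.mass_pos .f p 1
    have h := h7 ξ h0 hξ1 _ (measurable_D m .f (p + 1) (p + 1 + k) hφ.1) ⟨_, hDf (p + 1) k⟩
      (H.isLip_D hd h7 h0 hξ1 hφ hlip .f hDf (p + 1) k) z.1 z.2 .f p
    have hwn : wnorm (vpow V ξ) (m.D .f (p + 1) (p + 1 + k) φ) ≤ CD * supNorm φ * ρD ^ k :=
      wnorm_le (vpow_pos V ξ) (by positivity) (hDf (p + 1) k)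
    have hwn0 : 0 ≤ wnorm (vpow V ξ) (m.D .f (p + 1) (p + 1 + k) φ) :=
      wnorm_nonneg fun x => (vpow_pos V ξ x).le
    have hx := vpow_pos V ξ z.1
    have hy := vpow_pos V ξ z.2
    have hr : ρD ^ (k + 1) ≤ ρ ^ (k + 1) :=
      pow_le_pow_left₀ hρD0.le ((le_max_right _ _).trans hρ) _
    have habs : |m.D .f p (p + (k + 1)) φ z.1 - m.D .f p (p + (k + 1)) φ z.2|
        ≤ A * supNorm φ * ρ ^ (k + 1) * (d z.1 z.2 * (vpow V ξ z.1 * vpow V ξ z.2)) := by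
      rw [H.D_succ .f p k hφ, H.D_succ .f p k hφ, ← sub_div, abs_div, abs_of_pos hmass,
        div_le_iff₀ hmass]
      rw [exp_mul_exp_rpow] at h
      calc _ ≤ K7 ξ * wnorm (vpow V ξ) (m.D .f (p + 1) (p + 1 + k) φ) * d z.1 z.2
              * (vpow V ξ z.1 * vpow V ξ z.2) := h
        _ ≤ |K7 ξ| * (CD * supNorm φ * ρD ^ k) * d z.1 z.2
              * (vpow V ξ z.1 * vpow V ξ z.2) := by
            gcongr
            exact le_abs_self _
        _ = 1 * (|K7 ξ| * CD / ρD * supNorm φ * ρD ^ (k + 1) *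
              (d z.1 z.2 * (vpow V ξ z.1 * vpow V ξ z.2))) := by
            rw [pow_succ]; field_simp
        _ ≤ (Cm * m.mass .f p (p + 1)) * (|K7 ξ| * CD / ρD * supNorm φ * ρ ^ (k + 1) *
              (d z.1 z.2 * (vpow V ξ z.1 * vpow V ξ z.2))) := by
            gcongr
            exact hm X m V H .f p
        _ = _ := by rw [hA]; ring
    have hvle : (vpow V ξ z.1 * vpow V ξ z.2) ^ 2 ≤ vpow V (4 * ξ) z.1 * vpow V (8 * ξ) z.2 := by
      rw [mul_pow, sq, sq, ← vpow_add, ← vpow_add]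
      exact mul_le_mul (H.vpow_mono (by linarith) _) (H.vpow_mono (by linarith) _)
        (vpow_pos V _ _).le (vpow_pos V _ _).le
    rw [← sq_abs, metricWeight]
    calc _ ≤ (A * supNorm φ * ρ ^ (k + 1) * (d z.1 z.2 * (vpow V ξ z.1 * vpow V ξ z.2))) ^ 2 :=
          pow_le_pow_left₀ (abs_nonneg _) habs 2
      _ = A ^ 2 * supNorm φ ^ 2 * (ρ ^ (k + 1)) ^ 2 *
            (d z.1 z.2 ^ 2 * (vpow V ξ z.1 * vpow V ξ z.2) ^ 2) := by ring
      _ ≤ _ := by gcongr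

end CPF

theorem theorem4p3 (K : CPF.HConstants) :
    (∀ ξ : ℝ, 0 < ξ → ξ < 1 / 4 →
      ∃ ρ C : ℝ, 0 < ρ ∧ ρ < 1 ∧ 0 < C ∧
        (∀ (X : Type u) [MeasurableSpace X] [MeasurableEq X] (m : CPF.CoupledModel X) (V : X → ℝ),
          CPF.H1to6 m V K → ∀ φ : X → ℝ, CPF.IsBdd φ → ∀ n : ℕ, 1 ≤ n →
            CPF.VarBoundIMC m V ρ C ξ (CPF.offDiagWeight V ξ) n φ) ∧
        (∀ (m : CPF.CoupledModel ℝ) (V : ℝ → ℝ),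
          CPF.H1to6 m V K → ∀ φ : ℝ → ℝ, CPF.IsBdd φ → ∀ n : ℕ, 1 ≤ n →
            CPF.VarBound m V m.couplingW ρ C ξ (CPF.offDiagWeight V ξ) n φ)) ∧
    (∀ (K7 : ℝ → ℝ) (ξ' : ℝ), 0 < ξ' → ξ' < 1 / 2 →
      ∀ ξ : ℝ, 0 < ξ → ξ < (1 - 2 * ξ') / 12 →
      ∃ ρ C : ℝ, 0 < ρ ∧ ρ < 1 ∧ 0 < C ∧
        (∀ (X : Type u) [MeasurableSpace X] (m : CPF.CoupledModel X) (V : X → ℝ)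
          (d : X → X → ℝ), CPF.IsMetric d → Measurable (Function.uncurry d) →
          CPF.H1to6 m V K → CPF.H7 m V d K7 →
          CPF.InL (fun z : X × X => (Real.exp (V z.1) * Real.exp (V z.2)) ^ ξ')
            (fun z => d z.1 z.2 ^ 2) →
          ∀ φ : X → ℝ, CPF.IsBdd φ → CPF.IsLip (fun _ => 1) d φ → ∀ n : ℕ, 1 ≤ n →
            CPF.VarBoundIMC m V ρ C ξ (CPF.metricWeight V d ξ) n φ) ∧
        (∀ (m : CPF.CoupledModel ℝ) (V : ℝ → ℝ)
          (d : ℝ → ℝ → ℝ), CPF.IsMetric d → Measurable (Function.uncurry d) →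
          CPF.H1to6 m V K → CPF.H7 m V d K7 →
          CPF.InL (fun z : ℝ × ℝ => (Real.exp (V z.1) * Real.exp (V z.2)) ^ ξ')
            (fun z => d z.1 z.2 ^ 2) →
          ∀ φ : ℝ → ℝ, CPF.IsBdd φ → CPF.IsLip (fun _ => 1) d φ → ∀ n : ℕ, 1 ≤ n →
            CPF.VarBound m V m.couplingW ρ C ξ (CPF.metricWeight V d ξ) n φ)) := by
  constructor
  · intro ξ h0 h1
    -- The two universe levels give two pairs of constants; the bound is monotone in both.
    obtain ⟨ρ₁, C₁, hρ₁, hρ₁', hC₁, H₁⟩ := CPF.exists_varBound_offDiag.{u} K h0 h1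
    obtain ⟨ρ₂, C₂, hρ₂, hρ₂', hC₂, H₂⟩ := CPF.exists_varBound_offDiag.{0} K h0 h1
    have hC : C₁ ≤ C₁ + C₂ + 1 := by linarith
    have hC' : C₂ ≤ C₁ + C₂ + 1 := by linarith
    refine ⟨max ρ₁ ρ₂, C₁ + C₂ + 1, lt_max_of_lt_left hρ₁, max_lt hρ₁' hρ₂', by linarith,
      fun X _ _ m V H φ hφ n _ => ⟨?_, ?_, fun D => ?_⟩, fun m V H φ hφ n _ => ?_⟩
    · exact H₁ _ _ (le_max_left _ _) hC X m V H _ H.isPairLaw_couplingI φ hφ n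
    · exact H₁ _ _ (le_max_left _ _) hC X m V H _ H.isPairLaw_couplingM φ hφ n
    · exact H₁ _ _ (le_max_left _ _) hC X m V H _ (H.isPairLaw_couplingC D) φ hφ n
    · exact H₂ _ _ (le_max_right _ _) hC' ℝ m V H _ H.isPairLaw_couplingW φ hφ n
  · intro K7 ξ' h0' _ ξ h0 h1
    obtain ⟨ρ₁, C₁, hρ₁, hρ₁', hC₁, H₁⟩ := CPF.exists_varBound_metric.{u} K K7 h0' h0 h1
    obtain ⟨ρ₂, C₂, hρ₂, hρ₂', hC₂, H₂⟩ := CPF.exists_varBound_metric.{0} K K7 h0' h0 h1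
    have hC : C₁ ≤ C₁ + C₂ + 1 := by linarith
    have hC' : C₂ ≤ C₁ + C₂ + 1 := by linarith
    refine ⟨max ρ₁ ρ₂, C₁ + C₂ + 1, lt_max_of_lt_left hρ₁, max_lt hρ₁' hρ₂', by linarith,
      fun X _ m V d hd hdm H h7 hL φ hφ hlip n _ => ⟨?_, ?_, fun D => ?_⟩,
      fun m V d hd hdm H h7 hL φ hφ hlip n _ => ?_⟩
    · exact H₁ _ _ (le_max_left _ _) hC X m V d hd hdm H h7 hL _ H.isPairLaw_couplingI φ hφ hlip n
    · exact H₁ _ _ (le_max_left _ _) hC X m V d hd hdm H h7 hL _ H.isPairLaw_couplingM φ hφ hlip n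
    · exact H₁ _ _ (le_max_left _ _) hC X m V d hd hdm H h7 hL _ (H.isPairLaw_couplingC D) φ hφ
        hlip n
    · exact H₂ _ _ (le_max_right _ _) hC' ℝ m V d hd hdm H h7 hL _ H.isPairLaw_couplingW φ hφ hlip n
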